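/- Call a finite-dimensional integral domain $R$ Jaffard if $\dim R[X_1,\dots,X_n]=n+\dim R$ for all $n\ge 1$, and call an integral domain $R$ locally Jaffard if $R_p$ is a Jaffard domain for every prime ideal $p$ of $R$. Let $F\in\mathbb{C}[X,Y,Z]$ be a homogeneous cubic form defining a nonsingular plane (elliptic) curve, and let $A=\mathbb{C}[X,Y,Z]/(F)$ be its homogeneous coordinate ring. For a prime ideal $P$ of $A$ of height one let $P^{(n)}=P^nA_P\cap A$ be its $n$th symbolic power, let $t$ be an indeterminate, and let $$R=R(P)=A[t^{-1},Pt,P^{(2)}t^2,\dots,P^{(n)}t^n,\dots]\subset A[t,t^{-1}]$$ be the symbolic Rees algebra of $A$ with respect to $P$. 1. For every height-one prime $P$ of $A$, the ring $R(P)$ is a $3$-dimensional Krull domain and is locally Jaffard. Consequently every localization $R(P)_M$ at a prime ideal $M$ of $R(P)$ is locally Jaffard; in particular this holds for the example of Anderson, Dobbs, Eakin and Heinzer, which is the localization of a non-Noetherian such $R(P)$ at a maximal ideal of height $3$. 2. There is a height-one prime $P$ of $A$ for which $R(P)$ is not Noetherian (Eakin and Heinzer's example). -/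

import Mathlib

open scoped LaurentPolynomial

noncomputable section

/-- A Jaffard domain: an integral domain of finite Krull dimension with
`dim R[X₁, …, Xₙ] = n + dim R` for all `n ≥ 1`. -/
def IsJaffard (R : Type*) [CommRing R] : Prop :=
  IsDomain R ∧ ringKrullDim R ≠ ⊤ ∧
    ∀ n : ℕ, 1 ≤ n → ringKrullDim (MvPolynomial (Fin n) R) = n + ringKrullDim R

/-- A locally Jaffard domain: an integral domain all of whose localizations at prime ideals are
Jaffard domains. -/
def IsLocallyJaffard (R : Type*) [CommRing R] : Prop :=
  IsDomain R ∧ ∀ (p : Ideal R) [p.IsPrime], IsJaffard (Localization.AtPrime p)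

/-- A Krull domain: an integral domain that is the intersection, inside its quotient field, of a
family of discrete valuation rings of that field such that every nonzero element of the field is a
unit in all but finitely many members of the family. -/
def IsKrullDomain (R : Type*) [CommRing R] : Prop :=
  ∃ _ : IsDomain R, ∃ 𝒱 : Set (ValuationSubring (FractionRing R)),
    (∀ V ∈ 𝒱, IsDiscreteValuationRing V) ∧
    (∀ x : FractionRing R, x ∈ (algebraMap R (FractionRing R)).range ↔ ∀ V ∈ 𝒱, x ∈ V) ∧
    (∀ x : FractionRing R, x ≠ 0 → {V ∈ 𝒱 | ¬ (x ∈ V ∧ x⁻¹ ∈ V)}.Finite)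

/-- A ternary cubic form over `ℂ` whose zero locus in the projective plane is nonsingular:
the form and its three partial derivatives have no common zero other than the origin. -/
structure IsNonsingularCubic (F : MvPolynomial (Fin 3) ℂ) : Prop where
  isHomogeneous : F.IsHomogeneous 3
  nonsingular : ∀ v : Fin 3 → ℂ, v ≠ 0 → MvPolynomial.eval v F = 0 →
    ∃ i, MvPolynomial.eval v (MvPolynomial.pderiv i F) ≠ 0

/-- The homogeneous coordinate ring `ℂ[X, Y, Z] / (F)` of the plane curve `F = 0`. -/
abbrev HomogeneousCoordinateRing (F : MvPolynomial (Fin 3) ℂ) : Type :=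
  MvPolynomial (Fin 3) ℂ ⧸ Ideal.span {F}

variable {A : Type*} [CommRing A]

/-- The `n`-th symbolic power `P⁽ⁿ⁾ = Pⁿ A_P ∩ A` of a prime ideal `P`. -/
def symbolicPower (P : Ideal A) [P.IsPrime] (n : ℕ) : Ideal A :=
  ((P ^ n).map (algebraMap A (Localization.AtPrime P))).comap
    (algebraMap A (Localization.AtPrime P))

/-- The symbolic Rees algebra `A[t⁻¹, P t, P⁽²⁾ t², …, P⁽ⁿ⁾ tⁿ, …]` of a prime ideal `P`, as a
subalgebra of the ring `A[t, t⁻¹]` of Laurent polynomials. -/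
def symbolicReesAlgebra (P : Ideal A) [P.IsPrime] : Subalgebra A A[T;T⁻¹] :=
  Algebra.adjoin A
    ({LaurentPolynomial.T (-1)} ∪
      {f | ∃ n : ℕ, 1 ≤ n ∧ ∃ a ∈ symbolicPower P n,
        f = LaurentPolynomial.C a * LaurentPolynomial.T (n : ℤ)})

end

/-! Write `u = t⁻¹`. The algebra `R(P)` consists of the Laurent polynomials whose coefficient in
degree `n` lies in `P⁽ⁿ⁾`, with `P⁽ⁿ⁾ = A` for `n ≤ 0`. It is controlled by two facts: `R(P)[1/u] =
A[t, t⁻¹]`, which is Noetherian and normal, and `u` is a prime element, because the order of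
vanishing along `P` is a discrete valuation. A Nagata-type criterion (`isKrullDomain_of_away`) then
gives the Krull property.

For the Jaffard property, any domain `S` over a field `k` satisfies `ht p + trdeg (S/p) ≤ trdeg S`
(`height_add_le_of_trdeg_le`). Applied to polynomial rings over `S_p`, this bounds their dimension
by `n + ht p` as soon as equality holds at `p`. Here `trdeg R(P) ≤ 3`. A prime without `u` has a
Noetherian localization, and `(u)` gives a discrete valuation ring. A prime strictly above `(u)` has
height at least 2, and height 3 if its residue ring is algebraic over `ℂ`
(`three_le_height_of_isAlgebraic`); so equality holds in both cases.

All this needs `A` to be a normal domain. A factorization of `F` would produce a singular point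
where the factors meet. For normality, `A` is free and monogenic over the ring of a linear
projection from a point off the curve, so the conductor of an integral element contains a
directional derivative of `F`; moving the centre gives all partial derivatives, and nonsingularity
makes the conductor primary to the irrelevant ideal or trivial.

For the non-Noetherian example, `P` is the prime of a very general point of the curve. The
derivation `D = F_Y ∂_X - F_X ∂_Y` detects symbolic powers: `a ∈ P⁽ⁿ⁾` iff `Dⁱ a ∈ P` for `i < n`.
The forms of degree `m` make up a space of dimension `3m`, and their Wronskian under `D` is nonzero;
as `ℂ` is uncountable, some point avoids the zeros of all these Wronskians. There no nonzero form of
degree `m` lies in `P⁽³ᵐ⁾`, whereas `P⁽³ᵐ⁾` does contain a nonzero form `g_m` of degree `m + 1`.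
Hence `g_M t³ᴹ` is never in the ideal generated by the `g_i t³ⁱ` with `i < M`, and the ascending
chain condition fails. -/

/-! ### Heights of primes and transcendence degree. -/

section DimensionAndTranscendence

variable {k S : Type*} [Field k] [CommRing S] [Algebra k S]

/-- Going down strictly from a prime `Q'` to a prime `Q`, an algebraically independent family
modulo `Q'` extends by one element to an algebraically independent family modulo `Q`. -/
lemma exists_algebraicIndependent_of_lt {Q Q' : Ideal S} [Q.IsPrime] (h : Q < Q') {r : ℕ}
    {x : Fin r → S} (hx : AlgebraicIndependent k fun i ↦ Ideal.Quotient.mkₐ k Q' (x i)) :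
    ∃ y : Fin (r + 1) → S, AlgebraicIndependent k fun i ↦ Ideal.Quotient.mkₐ k Q (y i) := by
  obtain ⟨f, hfQ', hfQ⟩ := Set.exists_of_ssubset h
  set x' : Fin r → S ⧸ Q := fun i ↦ Ideal.Quotient.mkₐ k Q (x i) with hx'
  let φ : S ⧸ Q →ₐ[k] S ⧸ Q' := Ideal.Quotient.factorₐ k h.le
  have hφ (s : S) : φ (Ideal.Quotient.mkₐ k Q s) = Ideal.Quotient.mkₐ k Q' s := rfl
  have hx'i : AlgebraicIndependent k x' := by
    apply AlgebraicIndependent.of_comp φ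
    convert! hx
  have hf0 : Ideal.Quotient.mkₐ k Q f ≠ 0 := by
    simpa [Ideal.Quotient.eq_zero_iff_mem] using hfQ
  -- An algebraic relation for `f` can be chosen with nonzero constant term, since `f ≠ 0` in a
  -- domain. Modulo `Q'` the element `f` dies, so the constant term becomes a relation among the
  -- independent elements and must be zero.
  have htr : Transcendental (Algebra.adjoin k (Set.range x')) (Ideal.Quotient.mkₐ k Q f) := by
    intro halg
    obtain ⟨q, hq0, hq⟩ := halg.exists_nonzero_coeff_and_aeval_eq_zero
      (mem_nonZeroDivisors_of_ne_zero hf0)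
    obtain ⟨p, hp⟩ := Polynomial.X_dvd_sub_C (p := q)
    have h1 : ((q.coeff 0 : Algebra.adjoin k (Set.range x')) : S ⧸ Q) =
        - (Ideal.Quotient.mkₐ k Q f * Polynomial.aeval (Ideal.Quotient.mkₐ k Q f) p) := by
      have := congrArg (Polynomial.aeval (Ideal.Quotient.mkₐ k Q f)) hp
      rw [map_sub, hq, map_mul, Polynomial.aeval_X, Polynomial.aeval_C, zero_sub] at this
      rw [← this, neg_neg]; rfl
    have h2 : φ (q.coeff 0 : S ⧸ Q) = 0 := by
      rw [h1, map_neg, map_mul, hφ]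
      have : Ideal.Quotient.mkₐ k Q' f = 0 := by
        simpa [Ideal.Quotient.eq_zero_iff_mem] using hfQ'
      rw [this, zero_mul, neg_zero]
    obtain ⟨g, hg⟩ : ∃ g : MvPolynomial (Fin r) k, MvPolynomial.aeval x' g = (q.coeff 0 : S ⧸ Q) := by
      have := (Algebra.adjoin_range_eq_range_aeval k x').le (q.coeff 0).2
      exact this
    have hg0 : g = 0 := by
      apply hx
      rw [map_zero, ← h2, ← hg, ← AlgHom.comp_apply, MvPolynomial.comp_aeval]
      rfl
    apply hq0
    ext
    rw [← hg, hg0, map_zero]; rfl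
  have hopt := (hx'i.option_iff_transcendental _).2 htr
  refine ⟨fun i ↦ ((finSuccEquiv r i).elim f x), ?_⟩
  have := hopt.comp (finSuccEquiv r) (finSuccEquiv r).injective
  convert! this using 2 with i
  simp only [Function.comp]
  cases finSuccEquiv r i <;> rfl

/-- Each strict step down a chain of primes below `p` yields one more independent element; the
family is finally lifted from a quotient to `S` itself. -/
lemma exists_algebraicIndependent_of_le_height [IsDomain S] (n : ℕ) :
    ∀ (r : ℕ) (p : Ideal S) [p.IsPrime], (n : ℕ∞) ≤ p.height → ∀ x : Fin r → S,
    AlgebraicIndependent k (fun i ↦ Ideal.Quotient.mkₐ k p (x i)) →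
    ∃ y : Fin (n + r) → S, AlgebraicIndependent k y := by
  induction n with
  | zero =>
    intro r p _ _ x hx
    rw [Nat.zero_add]
    exact ⟨x, AlgebraicIndependent.of_comp (Ideal.Quotient.mkₐ k p) hx⟩
  | succ n ih =>
    intro r p _ hp x hx
    have : ¬ p.height ≤ n := by
      intro hle
      have := hp.trans hle
      norm_cast at this
      omega
    rw [Ideal.height_le_iff] at this
    push Not at this
    obtain ⟨q, hq, hqp, hn⟩ := this
    obtain ⟨y, hy⟩ := exists_algebraicIndependent_of_lt hqp hx
    obtain ⟨z, hz⟩ := ih (r + 1) q hn y hy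
    have e : n + 1 + r = n + (r + 1) := by omega
    rw [e]
    exact ⟨z, hz⟩

lemma card_le_of_algebraicIndependent {d : ℕ} (hd : Algebra.trdeg k S ≤ d) {n : ℕ}
    {x : Fin n → S} (hx : AlgebraicIndependent k x) : n ≤ d := by
  have h1 := hx.lift_cardinalMk_le_trdeg
  rw [Cardinal.mk_fin, Cardinal.lift_natCast] at h1
  have h2 := h1.trans (Cardinal.lift_le.2 hd)
  rw [Cardinal.lift_natCast] at h2
  exact_mod_cast h2

/-- In a domain of transcendence degree at most `d`, the height of a prime `p` plus the number of
algebraically independent elements modulo `p` is at most `d`. -/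
theorem height_add_le_of_trdeg_le [IsDomain S] {d : ℕ} (hd : Algebra.trdeg k S ≤ d)
    (p : Ideal S) [p.IsPrime] {r : ℕ} {x : Fin r → S}
    (hx : AlgebraicIndependent k (fun i ↦ Ideal.Quotient.mkₐ k p (x i))) :
    p.height + r ≤ d := by
  have key (n : ℕ) (hn : (n : ℕ∞) ≤ p.height) : n + r ≤ d := by
    obtain ⟨y, hy⟩ := exists_algebraicIndependent_of_le_height n r p hn x hx
    exact card_le_of_algebraicIndependent hd hy
  have hfin : p.height ≠ ⊤ := by
    intro h
    have := key (d + 1) (h ▸ le_top)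
    omega
  obtain ⟨n, hn⟩ := ENat.ne_top_iff_exists.1 hfin
  rw [← hn]
  exact_mod_cast key n hn.le

theorem height_le_of_trdeg_le [IsDomain S] {d : ℕ} (hd : Algebra.trdeg k S ≤ d)
    (p : Ideal S) [p.IsPrime] : p.height ≤ d := by
  have hinj : Function.Injective (algebraMap k (S ⧸ p)) := (algebraMap k (S ⧸ p)).injective
  have := height_add_le_of_trdeg_le (r := 0) (x := Fin.elim0) hd p
    ((algebraicIndependent_empty_type_iff (R := k)).2 hinj)
  simpa using this

theorem ringKrullDim_le_of_trdeg_le [IsDomain S] {d : ℕ} (hd : Algebra.trdeg k S ≤ d) :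
    ringKrullDim S ≤ d := by
  rw [ringKrullDim_le_iff_height_le]
  intro p hp
  exact_mod_cast height_le_of_trdeg_le hd p

/-- Dividing by a nonzero prime lowers the transcendence degree. -/
theorem trdeg_quotient_le [IsDomain S] {d : ℕ} (hd : Algebra.trdeg k S ≤ (d + 1 : ℕ))
    {p : Ideal S} [p.IsPrime] (hp : p ≠ ⊥) : Algebra.trdeg k (S ⧸ p) ≤ d := by
  -- The transcendence degree is a supremum over independent sets. Lifting `d + 1` independent
  -- elements of `S/p` would give `ht p + (d + 1) ≤ d + 1`, against `ht p ≥ 1`.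
  refine ciSup_le' fun s ↦ ?_
  by_contra! h
  have h' : (((d + 1 : ℕ) : Cardinal)) ≤ Cardinal.mk s.1 := by
    rw [Nat.cast_add, Nat.cast_one, ← Cardinal.succ_natCast]
    exact Order.succ_le_of_lt h
  obtain ⟨f⟩ : Nonempty (Fin (d + 1) ↪ s.1) := by
    rw [← Cardinal.lift_mk_le']
    simpa using h'
  choose y hy using Ideal.Quotient.mkₐ_surjective k p
  have := height_add_le_of_trdeg_le hd p (x := fun i ↦ y (f i))
    (by simp only [hy]; exact s.2.comp f f.injective)
  have h1 : 1 ≤ p.height := by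
    rwa [Order.one_le_iff_ne_zero, Ne, Ideal.height_eq_zero_iff_eq_bot]
  obtain ⟨n, hn⟩ := ENat.ne_top_iff_exists.1 (ne_top_of_le_ne_top (ENat.natCast_ne_top (d+1)) (height_le_of_trdeg_le hd p))
  rw [← hn] at this h1
  norm_cast at this h1
  omega

theorem trdeg_mvPolynomial_le {k S : Type*} [Field k] [CommRing S] [IsDomain S] [Algebra k S] {d : ℕ}
    (hd : Algebra.trdeg k S ≤ d) (n : ℕ) : Algebra.trdeg k (MvPolynomial (Fin n) S) ≤ (d + n : ℕ) := by
  have := trdeg_add_eq k S (A := MvPolynomial (Fin n) S)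
  rw [← this, MvPolynomial.trdeg_of_isDomain]
  push_cast
  gcongr
  simp

theorem trdeg_localization_le {k S T : Type*} [Field k] [CommRing S] [IsDomain S] [Algebra k S]
    [CommRing T] [Algebra S T] [Algebra k T] [IsScalarTower k S T] (M : Submonoid S)
    (hM : M ≤ nonZeroDivisors S) [IsLocalization M T] {d : ℕ}
    (hd : Algebra.trdeg k S ≤ d) : Algebra.trdeg k T ≤ d := by
  have : IsDomain T := IsLocalization.isDomain_of_le_nonZeroDivisors _ hM
  have : FaithfulSMul S T := (faithfulSMul_iff_algebraMap_injective S T).2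
    (IsLocalization.injective T hM)
  have : Algebra.IsAlgebraic S T := IsLocalization.isAlgebraic T M
  have h := lift_trdeg_add_eq k S (A := T)
  rw [trdeg_eq_zero (R := S) (A := T), Cardinal.lift_zero, add_zero] at h
  have h2 := Cardinal.lift_le.2 hd
  rw [h] at h2
  simpa using h2

/-- Elements of `S` algebraically independent modulo the prime `p` stay so in every nontrivial
algebra over the localization of `S` at `p`. -/
lemma algebraicIndependent_algebraMap_of_atPrime (p : Ideal S) [p.IsPrime] {T : Type*} [CommRing T]
    [Nontrivial T] [Algebra k T] (φ : Localization.AtPrime p →+* T)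
    (hφ : φ.comp ((algebraMap S (Localization.AtPrime p)).comp (algebraMap k S)) = algebraMap k T)
    {r : ℕ} {x : Fin r → S} (hx : AlgebraicIndependent k (fun i ↦ Ideal.Quotient.mkₐ k p (x i))) :
    AlgebraicIndependent k fun i ↦ φ (algebraMap S _ (x i)) := by
  let ψ : S →ₐ[k] T := { φ.comp (algebraMap S (Localization.AtPrime p)) with
    commutes' := fun c ↦ by rw [← hφ]; rfl }
  change AlgebraicIndependent k fun i ↦ ψ (x i)
  rw [algebraicIndependent_iff] at hx ⊢
  intro g hg
  apply hx
  have e1 : MvPolynomial.aeval (fun i ↦ ψ (x i)) g = ψ (MvPolynomial.aeval x g) := by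
    rw [← AlgHom.comp_apply, MvPolynomial.comp_aeval]
  have e2 : MvPolynomial.aeval (fun i ↦ Ideal.Quotient.mkₐ k p (x i)) g =
      Ideal.Quotient.mkₐ k p (MvPolynomial.aeval x g) := by
    rw [← AlgHom.comp_apply, MvPolynomial.comp_aeval]
  rw [e2]
  rw [e1] at hg
  by_contra hne
  -- A polynomial in the `x i` that is nonzero modulo `p` is a unit in the localization, hence
  -- cannot die in a nontrivial algebra over it.
  have hu : IsUnit (algebraMap S (Localization.AtPrime p) (MvPolynomial.aeval x g)) := by
    apply IsLocalization.map_units (M := p.primeCompl) _ ⟨_, ?_⟩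
    intro hmem
    exact hne (Ideal.Quotient.eq_zero_iff_mem.2 hmem)
  have : IsUnit (ψ (MvPolynomial.aeval x g)) := hu.map φ
  rw [hg] at this
  exact not_isUnit_zero this

/-- Bound for the dimension of polynomial rings over the localization at a prime `p`, given `r`
algebraically independent elements modulo `p`. -/
theorem ringKrullDim_mvPolynomial_atPrime_le [IsDomain S] {d : ℕ} (hd : Algebra.trdeg k S ≤ d)
    (p : Ideal S) [p.IsPrime] {r : ℕ} {x : Fin r → S}
    (hx : AlgebraicIndependent k (fun i ↦ Ideal.Quotient.mkₐ k p (x i))) (n e : ℕ)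
    (he : d + n ≤ e + r) :
    ringKrullDim (MvPolynomial (Fin n) (Localization.AtPrime p)) ≤ e := by
  have hM := p.primeCompl_le_nonZeroDivisors
  have : IsDomain (Localization.AtPrime p) :=
    IsLocalization.isDomain_of_le_nonZeroDivisors _ hM
  have hd' : Algebra.trdeg k (Localization.AtPrime p) ≤ d :=
    trdeg_localization_le p.primeCompl hM hd
  have hd'' := trdeg_mvPolynomial_le hd' n
  rw [ringKrullDim_le_iff_height_le]
  intro Q hQ
  -- The `x i` stay independent modulo every prime `Q` of the polynomial ring, so they lower the
  -- bound for each height by `r`.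
  have h := height_add_le_of_trdeg_le hd'' Q
    (x := fun i ↦ MvPolynomial.C (algebraMap S (Localization.AtPrime p) (x i)))
    (algebraicIndependent_algebraMap_of_atPrime p
      ((Ideal.Quotient.mk Q).comp MvPolynomial.C) (by
        ext c
        rfl) hx)
  obtain ⟨m, hm⟩ := ENat.ne_top_iff_exists.1 (ne_top_of_le_ne_top (ENat.natCast_ne_top (d+n))
    (height_le_of_trdeg_le hd'' Q))
  rw [← hm] at h ⊢
  norm_cast at h ⊢
  have : m ≤ e := by omega
  exact_mod_cast this

end DimensionAndTranscendence

/-! ### Discrete valuation rings at primes and a criterion for Krull domains. -/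

section KrullCriterion

open IsLocalRing in
/-- In a Noetherian integrally closed local domain, the maximal ideal is principal as soon as it is
the annihilator of an element modulo a nonzero principal ideal. -/
lemma maximalIdeal_isPrincipal_of_mul_mem_span {R : Type*} [CommRing R] [IsDomain R]
    [IsNoetherianRing R] [IsLocalRing R] [IsIntegrallyClosed R] {a b : R}
    (ha₁ : a ∈ maximalIdeal R) (ha₂ : a ≠ 0)
    (hb₂ : b ∉ Ideal.span {a}) (hb₃ : ∀ m ∈ maximalIdeal R, ∃ k : R, k * a = b * m) :
    (maximalIdeal R).IsPrincipal := by
  have hb₄ : b ≠ 0 := by rintro rfl; apply hb₂; exact zero_mem _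
  let K := FractionRing R
  let x : K := algebraMap R K b / algebraMap R K a
  let M := Submodule.map (Algebra.linearMap R K) (maximalIdeal R)
  have ha₃ : algebraMap R K a ≠ 0 := IsFractionRing.to_map_eq_zero_iff.not.mpr ha₂
  -- The fraction `x = b/a` maps the maximal ideal into `R`. If it maps it into itself, `x` is
  -- integral, so it lies in `R`, against `b ∉ (a)`. Otherwise the image is all of `R` and `x⁻¹`
  -- generates the maximal ideal.
  by_cases hx : ∀ y ∈ M, x * y ∈ M
  · have := isIntegral_of_smul_mem_submodule M ?_ ?_ x hx
    · obtain ⟨y, e⟩ := IsIntegrallyClosed.algebraMap_eq_of_integral this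
      refine (hb₂ (Ideal.mem_span_singleton'.mpr ⟨y, ?_⟩)).elim
      apply IsFractionRing.injective R K
      rw [map_mul, e, div_mul_cancel₀ _ ha₃]
    · rw [Submodule.ne_bot_iff]; refine ⟨_, ⟨a, ha₁, rfl⟩, ?_⟩
      exact (IsFractionRing.to_map_eq_zero_iff (K := K)).not.mpr ha₂
    · apply Submodule.FG.map; exact IsNoetherian.noetherian _
  · have :
        (M.map (DistribSMul.toLinearMap R K x)).comap (Algebra.linearMap R K) = ⊤ := by
      contrapose! hx with h
      rintro m' ⟨m, hm, rfl : algebraMap R K m = m'⟩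
      obtain ⟨k, hk⟩ := hb₃ m hm
      have hk' : x * algebraMap R K m = algebraMap R K k := by
        rw [← mul_div_right_comm, ← map_mul, ← hk, map_mul, mul_div_cancel_right₀ _ ha₃]
      exact ⟨k, le_maximalIdeal h ⟨_, ⟨_, hm, rfl⟩, hk'⟩, hk'.symm⟩
    obtain ⟨y, hy₁, hy₂⟩ : ∃ y ∈ maximalIdeal R, b * y = a := by
      rw [Ideal.eq_top_iff_one, Submodule.mem_comap] at this
      obtain ⟨_, ⟨y, hy, rfl⟩, hy' : x * algebraMap R K y = algebraMap R K 1⟩ := this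
      rw [map_one, ← mul_div_right_comm, div_eq_one_iff_eq ha₃, ← map_mul] at hy'
      exact ⟨y, hy, IsFractionRing.injective R K hy'⟩
    refine ⟨⟨y, ?_⟩⟩
    apply le_antisymm
    · intro m hm; obtain ⟨k, hk⟩ := hb₃ m hm; rw [← hy₂, mul_comm, mul_assoc] at hk
      rw [← mul_left_cancel₀ hb₄ hk, mul_comm]; exact Ideal.mem_span_singleton'.mpr ⟨_, rfl⟩
    · rwa [Submodule.span_le, Set.singleton_subset_iff]

/-- In a Noetherian integrally closed domain, the localization at an associated prime of a nonzero
principal ideal is a discrete valuation ring. -/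
lemma isDiscreteValuationRing_atPrime_of_colon {B : Type*} [CommRing B] [IsDomain B]
    [IsNoetherianRing B] [IsIntegrallyClosed B] {b g : B} (hb : b ≠ 0) (Q : Ideal B) [Q.IsPrime]
    (hQ : ∀ s, s ∈ Q ↔ b ∣ s * g) : IsDiscreteValuationRing (Localization.AtPrime Q) := by
  have hM := Q.primeCompl_le_nonZeroDivisors
  set O := Localization.AtPrime Q
  have : IsDomain O := IsLocalization.isDomain_of_le_nonZeroDivisors _ hM
  have : IsNoetherianRing O := IsLocalization.isNoetherianRing Q.primeCompl _ inferInstance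
  have : IsIntegrallyClosed O := isIntegrallyClosed_of_isLocalization O Q.primeCompl hM
  have hinj : Function.Injective (algebraMap B O) := IsLocalization.injective O hM
  have hbQ : b ∈ Q := (hQ b).2 (dvd_mul_right _ _)
  have hb' : algebraMap B O b ∈ IsLocalRing.maximalIdeal O :=
    (IsLocalization.AtPrime.to_map_mem_maximal_iff O Q b).2 hbQ
  have hb0 : algebraMap B O b ≠ 0 := by
    rwa [Ne, map_eq_zero_iff _ hinj]
  have hnf : ¬ IsField O := by
    intro h
    rw [IsLocalRing.isField_iff_maximalIdeal_eq] at h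
    rw [h] at hb'
    exact hb0 hb'
  have hp : (IsLocalRing.maximalIdeal O).IsPrincipal := by
    refine maximalIdeal_isPrincipal_of_mul_mem_span (b := algebraMap B O g) hb' hb0 ?_ ?_
    · intro h
      rw [Ideal.mem_span_singleton] at h
      obtain ⟨c, hc⟩ := h
      obtain ⟨⟨c, s⟩, hs⟩ := IsLocalization.surj Q.primeCompl c
      apply s.2
      rw [SetLike.mem_coe, hQ]
      refine ⟨c, hinj ?_⟩
      rw [map_mul, map_mul, ← hs, hc]
      ring
    · intro m hm
      obtain ⟨⟨m', s⟩, hs⟩ := IsLocalization.surj Q.primeCompl m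
      have hm' : m' ∈ Q := by
        rw [← IsLocalization.AtPrime.to_map_mem_maximal_iff O Q, ← hs]
        exact Ideal.mul_mem_right _ _ hm
      obtain ⟨k, hk⟩ := (hQ m').1 hm'
      refine ⟨IsLocalization.mk' O k s, ?_⟩
      apply (IsLocalization.map_units (M := Q.primeCompl) O s).mul_right_cancel
      have h1 : algebraMap B O m' * algebraMap B O g = algebraMap B O b * algebraMap B O k := by
        rw [← map_mul, ← map_mul, hk]
      calc IsLocalization.mk' O k s * algebraMap B O b * algebraMap B O s
          = algebraMap B O b * (IsLocalization.mk' O k s * algebraMap B O s) := by ring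
        _ = algebraMap B O g * (m * algebraMap B O s) := by
          rw [IsLocalization.mk'_spec, ← h1, ← hs]; ring
        _ = algebraMap B O g * m * algebraMap B O s := by ring
  exact ((IsDiscreteValuationRing.TFAE O hnf).out 0 4).2 hp

/-- In a Noetherian integrally closed domain, divisibility by a nonzero element can be tested at
the primes whose localization is a discrete valuation ring. -/
lemma exists_isDiscreteValuationRing_atPrime_of_not_dvd {B : Type*} [CommRing B] [IsDomain B]
    [IsNoetherianRing B] [IsIntegrallyClosed B] {a b : B} (hb : b ≠ 0) (hab : ¬ b ∣ a) :
    ∃ (Q : Ideal B) (_ : Q.IsPrime), IsDiscreteValuationRing (Localization.AtPrime Q) ∧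
      ∀ s, b ∣ s * a → s ∈ Q := by
  have hx : (Ideal.Quotient.mk (Ideal.span {b}) a) ≠ 0 := by
    rwa [Ne, Ideal.Quotient.eq_zero_iff_mem, Ideal.mem_span_singleton]
  -- An associated prime of `B/(b)` containing the annihilator of the class of `a`. It is a colon
  -- ideal `(b) : g`, which is the form needed for a discrete valuation ring.
  obtain ⟨Q, hQ, hle⟩ := exists_le_isAssociatedPrime_of_isNoetherianRing B _ hx
  have hprime := hQ.isPrime
  rw [isAssociatedPrime_iff] at hQ
  obtain ⟨-, g', hg'⟩ := hQ
  obtain ⟨g, rfl⟩ := Ideal.Quotient.mk_surjective g'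
  have key (s c : B) : s ∈ Submodule.colon ⊥ {Ideal.Quotient.mk (Ideal.span {b}) c} ↔ b ∣ s * c := by
    rw [Submodule.mem_colon_singleton, Submodule.mem_bot, ← Ideal.mem_span_singleton,
      ← Ideal.Quotient.eq_zero_iff_mem, map_mul]
    rfl
  refine ⟨Q, hprime, isDiscreteValuationRing_atPrime_of_colon hb Q (g := g) fun s ↦ ?_, fun s hs ↦ ?_⟩
  · rw [hg', key]
  · exact hle ((key s a).2 hs)

section

variable {R : Type*} [CommRing R] [IsDomain R]

/-- The localization of a domain at a prime, as a valuation subring of the quotient field. -/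
noncomputable def valuationSubringAtPrime (Q : Ideal R) [Q.IsPrime]
    [ValuationRing (Localization.AtPrime Q)] : ValuationSubring (FractionRing R) where
  toSubring := (Localization.subalgebra.ofField (FractionRing R) Q.primeCompl
    Q.primeCompl_le_nonZeroDivisors).toSubring
  mem_or_inv_mem' x := by
    have : IsLocalization.AtPrime (Localization.subalgebra.ofField (FractionRing R) Q.primeCompl
      Q.primeCompl_le_nonZeroDivisors) Q := Localization.subalgebra.isLocalization_ofField ..
    have e := IsLocalization.algEquiv Q.primeCompl (Localization.AtPrime Q)
      (Localization.subalgebra.ofField (FractionRing R) Q.primeCompl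
        Q.primeCompl_le_nonZeroDivisors)
    have : ValuationRing (Localization.subalgebra.ofField (FractionRing R) Q.primeCompl
        Q.primeCompl_le_nonZeroDivisors) :=
      Function.Surjective.valuationRing e.toRingEquiv.toRingHom e.surjective
    rcases ValuationRing.isInteger_or_isInteger (Localization.subalgebra.ofField (FractionRing R)
      Q.primeCompl Q.primeCompl_le_nonZeroDivisors) x with ⟨y, hy⟩ | ⟨y, hy⟩
    · left; rw [← hy]; exact y.2
    · right; rw [← hy]; exact y.2

lemma mem_valuationSubringAtPrime (Q : Ideal R) [Q.IsPrime]
    [ValuationRing (Localization.AtPrime Q)] (x : FractionRing R) :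
    x ∈ valuationSubringAtPrime Q ↔ ∃ a s : R, s ∉ Q ∧
      x = algebraMap R (FractionRing R) a / algebraMap R (FractionRing R) s := by
  constructor
  · rintro ⟨a, s, hs, h⟩
    exact ⟨a, s, hs, by rw [h, div_eq_mul_inv]⟩
  · rintro ⟨a, s, hs, h⟩
    exact ⟨a, s, hs, by rw [h, div_eq_mul_inv]⟩

lemma isDiscreteValuationRing_valuationSubringAtPrime (Q : Ideal R) [Q.IsPrime]
    [IsDiscreteValuationRing (Localization.AtPrime Q)] :
    IsDiscreteValuationRing (valuationSubringAtPrime Q) := by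
  have : IsLocalization.AtPrime (Localization.subalgebra.ofField (FractionRing R) Q.primeCompl
      Q.primeCompl_le_nonZeroDivisors) Q := Localization.subalgebra.isLocalization_ofField ..
  have e := (IsLocalization.algEquiv Q.primeCompl (Localization.AtPrime Q)
      (Localization.subalgebra.ofField (FractionRing R) Q.primeCompl
        Q.primeCompl_le_nonZeroDivisors)).toRingEquiv
  have e' : (Localization.AtPrime Q) ≃+* (valuationSubringAtPrime Q) := e
  exact IsDiscreteValuationRing.RingEquivClass.isDiscreteValuationRing e'

/-- A criterion for a Krull domain in terms of a set of primes. -/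
theorem isKrullDomain_of_primes (𝒬 : Set (Ideal R))
    (h𝒬 : ∀ Q ∈ 𝒬, ∃ _ : Q.IsPrime, IsDiscreteValuationRing (Localization.AtPrime Q))
    (hdvd : ∀ a b : R, b ≠ 0 → (∀ Q ∈ 𝒬, ∃ s, s ∉ Q ∧ b ∣ s * a) → b ∣ a)
    (hfin : ∀ a : R, a ≠ 0 → {Q ∈ 𝒬 | a ∈ Q}.Finite) : IsKrullDomain R := by
  choose hp hd using h𝒬
  let V (Q : 𝒬) : ValuationSubring (FractionRing R) :=
    have := hp Q.1 Q.2
    have := hd Q.1 Q.2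
    valuationSubringAtPrime Q.1
  have hV (Q : 𝒬) (x : FractionRing R) : x ∈ V Q ↔ ∃ a s : R, s ∉ Q.1 ∧
      x = algebraMap R (FractionRing R) a / algebraMap R (FractionRing R) s :=
    have := hp Q.1 Q.2
    have := hd Q.1 Q.2
    mem_valuationSubringAtPrime Q.1 x
  have hne (Q : 𝒬) {s : R} (hs : s ∉ Q.1) : algebraMap R (FractionRing R) s ≠ 0 := by
    rw [Ne, IsFractionRing.to_map_eq_zero_iff]
    rintro rfl
    exact hs (zero_mem _)
  have hone (Q : 𝒬) : (1 : R) ∉ Q.1 := (Ideal.ne_top_iff_one _).1 (hp Q.1 Q.2).ne_top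
  refine ⟨inferInstance, Set.range V, ?_, fun x ↦ ⟨?_, fun hx ↦ ?_⟩, fun x hx ↦ ?_⟩
  · rintro _ ⟨Q, rfl⟩
    have := hp Q.1 Q.2
    have := hd Q.1 Q.2
    exact isDiscreteValuationRing_valuationSubringAtPrime Q.1
  · rintro ⟨a, rfl⟩ _ ⟨Q, rfl⟩
    rw [hV]
    exact ⟨a, 1, hone Q, by simp⟩
  · obtain ⟨a, b, hb, rfl⟩ := IsFractionRing.div_surjective R x
    have hb0 : b ≠ 0 := nonZeroDivisors.ne_zero hb
    have hb0' : algebraMap R (FractionRing R) b ≠ 0 := by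
      rwa [Ne, IsFractionRing.to_map_eq_zero_iff]
    obtain ⟨c, rfl⟩ : b ∣ a := by
      refine hdvd a b hb0 fun Q hQ ↦ ?_
      obtain ⟨c, s, hs, h⟩ := (hV ⟨Q, hQ⟩ _).1 (hx _ ⟨⟨Q, hQ⟩, rfl⟩)
      refine ⟨s, hs, c, ?_⟩
      rw [div_eq_div_iff hb0' (hne ⟨Q, hQ⟩ hs), ← map_mul, ← map_mul] at h
      have := IsFractionRing.injective R (FractionRing R) h
      rw [mul_comm, this, mul_comm]
    exact ⟨c, by rw [map_mul, mul_div_cancel_left₀ _ hb0']⟩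
  · obtain ⟨a, b, hb, rfl⟩ := IsFractionRing.div_surjective R x
    have hb0 : b ≠ 0 := nonZeroDivisors.ne_zero hb
    have ha0 : a ≠ 0 := by
      rintro rfl
      simp at hx
    -- The fraction `a/b` fails to be a unit only at primes containing `a` or `b`.
    refine (((hfin a ha0).union (hfin b hb0)).preimage Subtype.val_injective.injOn |>.image V).subset ?_
    rintro _ ⟨⟨Q, rfl⟩, hQ⟩
    refine ⟨Q, ?_, rfl⟩
    by_contra hcon
    simp only [Set.mem_preimage, Set.mem_union, Set.mem_ofPred_eq, Q.2, true_and, not_or] at hcon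
    apply hQ
    rw [inv_div, hV, hV]
    exact ⟨⟨a, b, hcon.2, rfl⟩, ⟨b, a, hcon.1, rfl⟩⟩

/-- A principal prime of a domain that is separated for its powers gives a discrete valuation
ring. -/
lemma isDiscreteValuationRing_atPrime_span_singleton {u : R} (hu : Prime u)
    (hsep : ∀ x : R, x ≠ 0 → ∃ n : ℕ, ¬ u ^ n ∣ x) [(Ideal.span {u}).IsPrime] :
    IsDiscreteValuationRing (Localization.AtPrime (Ideal.span {u})) := by
  have hM := (Ideal.span {u}).primeCompl_le_nonZeroDivisors
  set O := Localization.AtPrime (Ideal.span {u})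
  have : IsDomain O := IsLocalization.isDomain_of_le_nonZeroDivisors _ hM
  have hinj : Function.Injective (algebraMap R O) := IsLocalization.injective O hM
  have hunit {s : R} (hs : ¬ u ∣ s) : IsUnit (algebraMap R O s) :=
    IsLocalization.map_units (M := (Ideal.span {u}).primeCompl) O
      ⟨s, fun h ↦ hs (Ideal.mem_span_singleton.1 h)⟩
  have huu : ¬ IsUnit (algebraMap R O u) := by
    have := (IsLocalization.AtPrime.to_map_mem_maximal_iff O (Ideal.span {u}) u).2
      (Ideal.mem_span_singleton_self u)
    exact this
  have key {x : O} (hx : x ≠ 0) : ∃ n : ℕ, Associated (algebraMap R O u ^ n) x := by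
    obtain ⟨⟨a, s⟩, has⟩ := IsLocalization.surj (Ideal.span {u}).primeCompl x
    have hs : IsUnit (algebraMap R O s) := IsLocalization.map_units (M := (Ideal.span {u}).primeCompl) O s
    have ha : a ≠ 0 := by
      rintro rfl
      rw [map_zero] at has
      exact hx ((hs.mul_left_eq_zero).1 has)
    obtain ⟨n, c, hc, rfl⟩ : ∃ n : ℕ, ∃ c, ¬ u ∣ c ∧ a = u ^ n * c := by
      have hfin : FiniteMultiplicity u a := by
        obtain ⟨n, hn⟩ := hsep a ha
        exact ⟨n, fun h ↦ hn ((pow_dvd_pow u n.le_succ).trans h)⟩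
      obtain ⟨c, hc, hnc⟩ := hfin.exists_eq_pow_mul_and_not_dvd
      exact ⟨_, c, hnc, hc⟩
    refine ⟨n, ?_⟩
    have h1 : Associated (algebraMap R O u ^ n) (algebraMap R O (u ^ n * c)) := by
      rw [map_mul, map_pow]
      exact associated_mul_unit_right _ _ (hunit hc)
    have h2 : Associated x (x * algebraMap R O s) := associated_mul_unit_right _ _ hs
    rw [has] at h2
    exact h1.trans h2.symm
  apply IsDiscreteValuationRing.ofHasUnitMulPowIrreducibleFactorization
  refine ⟨algebraMap R O u, ⟨huu, fun x y hxy ↦ ?_⟩, key⟩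
  have hu0 : algebraMap R O u ≠ 0 := by
    rw [Ne, map_eq_zero_iff _ hinj]; exact hu.ne_zero
  have hprime : Prime (algebraMap R O u) := by
    have h0 := IsLocalization.AtPrime.map_eq_maximalIdeal (Ideal.span {u}) O
    rw [Ideal.map_span, Set.image_singleton] at h0
    rw [← Ideal.span_singleton_prime hu0, h0]
    exact (IsLocalRing.maximalIdeal.isMaximal O).isPrime
  exact hprime.irreducible.isUnit_or_isUnit hxy

variable {B : Type*} [CommRing B] [Algebra R B]

/-- Nagata-type criterion: if `u` is a separated prime element of the domain `R` and `R[1/u]` is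
Noetherian and integrally closed, then `R` is a Krull domain. -/
theorem isKrullDomain_of_away {u : R} (hu : Prime u) (hsep : ∀ x : R, x ≠ 0 → ∃ n : ℕ, ¬ u ^ n ∣ x)
    [IsLocalization.Away u B] [IsNoetherianRing B] [IsIntegrallyClosed B] : IsKrullDomain R := by
  have hM : Submonoid.powers u ≤ nonZeroDivisors R :=
    powers_le_nonZeroDivisors_of_noZeroDivisors hu.ne_zero
  have : IsDomain B := IsLocalization.isDomain_of_le_nonZeroDivisors _ hM
  have hinj : Function.Injective (algebraMap R B) := IsLocalization.injective B hM
  have hprime : (Ideal.span {u}).IsPrime := (Ideal.span_singleton_prime hu.ne_zero).2 hu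
  have hdvr := isDiscreteValuationRing_atPrime_span_singleton hu hsep
  -- The primes contracted from `B` test divisibility up to a power of `u`; the prime `(u)` then
  -- removes that power.
  let 𝒬 : Set (Ideal R) := {Ideal.span {u}} ∪
    (Ideal.comap (algebraMap R B)) '' {Q | ∃ _ : Q.IsPrime, IsDiscreteValuationRing (Localization.AtPrime Q)}
  refine isKrullDomain_of_primes 𝒬 ?_ ?_ ?_
  · rintro _ (rfl | ⟨Q, ⟨hQ, hd⟩, rfl⟩)
    · exact ⟨hprime, hdvr⟩
    · refine ⟨inferInstance, ?_⟩
      have := IsLocalization.isLocalization_isLocalization_atPrime_isLocalization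
        (Submonoid.powers u) (Localization.AtPrime Q) Q
      have e := (IsLocalization.algEquiv (Q.comap (algebraMap R B)).primeCompl (Localization.AtPrime Q)
        (Localization.AtPrime (Q.comap (algebraMap R B))))
      exact IsDiscreteValuationRing.RingEquivClass.isDiscreteValuationRing e
  · intro a b hb h
    have h1 : algebraMap R B b ∣ algebraMap R B a := by
      by_contra hcon
      obtain ⟨Q, hQ, hd, hs⟩ := exists_isDiscreteValuationRing_atPrime_of_not_dvd
        (by rwa [Ne, map_eq_zero_iff _ hinj]) hcon
      obtain ⟨s, hsQ, hsd⟩ := h (Q.comap (algebraMap R B)) (Or.inr ⟨Q, ⟨hQ, hd⟩, rfl⟩)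
      apply hsQ
      apply hs
      rw [← map_mul]
      exact map_dvd _ hsd
    obtain ⟨c, hc⟩ := h1
    obtain ⟨⟨c, ⟨_, N, rfl⟩⟩, hN⟩ := IsLocalization.surj (Submonoid.powers u) c
    have h2 : u ^ N * a = b * c := by
      apply hinj
      simp only at hN
      rw [map_mul, map_mul, hc, ← hN]
      ring
    obtain ⟨s, hs, d, hd⟩ := h (Ideal.span {u}) (Or.inl rfl)
    rw [Ideal.mem_span_singleton] at hs
    have h3 : u ^ N * d = s * c := by
      apply mul_left_cancel₀ hb
      calc b * (u ^ N * d) = u ^ N * (b * d) := by ring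
        _ = s * (u ^ N * a) := by rw [← hd]; ring
        _ = b * (s * c) := by rw [h2]; ring
    obtain ⟨c', rfl⟩ : u ^ N ∣ c := hu.pow_dvd_of_dvd_mul_left N hs ⟨d, h3.symm⟩
    exact ⟨c', mul_left_cancel₀ (pow_ne_zero N hu.ne_zero) (by rw [h2]; ring)⟩
  · intro a ha
    have ha' : algebraMap R B a ≠ 0 := by rwa [Ne, map_eq_zero_iff _ hinj]
    refine ((Set.finite_singleton (Ideal.span {u})).union
      ((Ideal.finite_minimalPrimes_of_isNoetherianRing B (Ideal.span {algebraMap R B a})).image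
        (Ideal.comap (algebraMap R B)))).subset ?_
    rintro _ ⟨rfl | ⟨Q, ⟨hQ, hd⟩, rfl⟩, haQ⟩
    · exact Or.inl rfl
    -- A prime whose localization is a discrete valuation ring has height one, so if it contains `a
    -- ≠ 0` it is minimal over `(a)`; a Noetherian ring has only finitely many such primes.
    · refine Or.inr ⟨Q, ?_, rfl⟩
      have hle : Ideal.span {algebraMap R B a} ≤ Q := by
        rw [Ideal.span_singleton_le_iff_mem]; exact haQ
      obtain ⟨Q', hQ', hle'⟩ := Ideal.exists_minimalPrimes_le hle
      convert! hQ'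
      by_contra hne
      have hQ'p := hQ'.isPrime
      have h1 := Ideal.height_add_one_le_of_lt_of_isPrime (lt_of_le_of_ne hle' (Ne.symm hne))
      have h2 : Q'.height ≠ 0 := by
        rw [Ne, Ideal.height_eq_zero_iff_eq_bot]
        rintro rfl
        have := hQ'.1.2 (Ideal.mem_span_singleton_self _)
        exact ha' this
      have h3 := IsLocalization.AtPrime.ringKrullDim_eq_height Q (Localization.AtPrime Q)
      rw [IsDiscreteValuationRing.ringKrullDim_eq_one] at h3
      have h4 : Q.height = 1 := by exact_mod_cast h3.symm
      rw [h4] at h1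
      have h5 : (1 : ℕ∞) ≤ Q'.height := Order.one_le_iff_ne_zero.2 h2
      have := (add_le_add_left h5 1).trans h1
      norm_num at this

end

end KrullCriterion

/-! ### Coefficients of Laurent polynomials. -/

section LaurentCoefficients

variable {A : Type*} [CommRing A]

lemma LaurentPolynomial.coeff_mul_eq_sum (f g : A[T;T⁻¹]) (N : ℤ) :
    (f * g).coeff N = ∑ i ∈ f.coeff.support, f.coeff i * g.coeff (N - i) := by
  rw [AddMonoidAlgebra.coeff_mul, Finsupp.sum]
  refine Finset.sum_congr rfl fun i _ ↦ ?_
  rw [Finsupp.sum]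
  simp_rw [show ∀ j, i + j = N ↔ j = N - i from fun j ↦ by omega]
  rw [Finset.sum_ite_eq']
  split_ifs with h
  · rfl
  · rw [Finsupp.notMem_support_iff.1 h, mul_zero]

lemma LaurentPolynomial.coeff_C_mul_T (a : A) (n m : ℤ) :
    (LaurentPolynomial.C a * LaurentPolynomial.T n).coeff m = if n = m then a else 0 := by
  classical
  rw [← LaurentPolynomial.single_eq_C_mul_T, AddMonoidAlgebra.coeff_single, Finsupp.single_apply]

lemma LaurentPolynomial.coeff_T_mul (n : ℤ) (f : A[T;T⁻¹]) (m : ℤ) :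
    (LaurentPolynomial.T n * f).coeff m = f.coeff (m - n) := by
  rcases subsingleton_or_nontrivial A with _ | _
  · exact Subsingleton.elim _ _
  have : (LaurentPolynomial.T n : A[T;T⁻¹]) = AddMonoidAlgebra.single n 1 := rfl
  have hs : (LaurentPolynomial.T n : A[T;T⁻¹]).coeff.support = {n} := by
    rw [this, AddMonoidAlgebra.coeff_single]
    exact Finsupp.support_single _ one_ne_zero
  rw [LaurentPolynomial.coeff_mul_eq_sum, hs, Finset.sum_singleton]
  simp

lemma LaurentPolynomial.eq_sum_C_mul_T (f : A[T;T⁻¹]) :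
    f = ∑ n ∈ f.coeff.support, LaurentPolynomial.C (f.coeff n) * LaurentPolynomial.T n := by
  ext m
  rw [AddMonoidAlgebra.coeff_sum, Finset.sum_apply']
  simp_rw [LaurentPolynomial.coeff_C_mul_T]
  rw [Finset.sum_ite_eq']
  split_ifs with h
  · rfl
  · exact Finsupp.notMem_support_iff.1 h

instance LaurentPolynomial.instIsNoetherianRing [IsNoetherianRing A] : IsNoetherianRing A[T;T⁻¹] :=
  IsLocalization.isNoetherianRing (Submonoid.powers (Polynomial.X : Polynomial A)) _ inferInstance

instance LaurentPolynomial.instIsIntegrallyClosed [IsDomain A] [IsIntegrallyClosed A] :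
    IsIntegrallyClosed A[T;T⁻¹] :=
  isIntegrallyClosed_of_isLocalization _ (Submonoid.powers (Polynomial.X : Polynomial A))
    (powers_le_nonZeroDivisors_of_noZeroDivisors Polynomial.X_ne_zero)

end LaurentCoefficients

/-! ### Symbolic powers and the order of vanishing along a prime. -/

section SymbolicPowers

variable {A : Type*} [CommRing A] (P : Ideal A) [P.IsPrime]

lemma symbolicPower_zero : symbolicPower P 0 = ⊤ := by
  rw [symbolicPower, pow_zero, Ideal.one_eq_top, Ideal.map_top, Ideal.comap_top]

lemma symbolicPower_antitone {m n : ℕ} (h : m ≤ n) : symbolicPower P n ≤ symbolicPower P m :=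
  Ideal.comap_mono (Ideal.map_mono (Ideal.pow_le_pow_right h))

lemma symbolicPower_one : symbolicPower P 1 = P := by
  rw [symbolicPower, pow_one, Localization.AtPrime.map_eq_maximalIdeal]
  exact Localization.AtPrime.under_maximalIdeal

lemma mul_mem_symbolicPower {m n : ℕ} {a b : A} (ha : a ∈ symbolicPower P m)
    (hb : b ∈ symbolicPower P n) : a * b ∈ symbolicPower P (m + n) := by
  rw [symbolicPower, Ideal.mem_comap] at *
  rw [map_mul, pow_add, Ideal.map_mul]
  exact Ideal.mul_mem_mul ha hb

lemma mem_symbolicPower_iff {n : ℕ} {a : A} :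
    a ∈ symbolicPower P n ↔ ∃ s, s ∉ P ∧ s * a ∈ P ^ n := by
  rw [symbolicPower, Ideal.mem_comap, IsLocalization.algebraMap_mem_map_algebraMap_iff P.primeCompl]
  rfl

/-- `Int.toNat` encodes the convention `P⁽ⁿ⁾ = A` for `n ≤ 0`; multiplicativity survives because
truncation at zero is subadditive. -/
lemma mul_mem_symbolicPower_toNat {m n : ℤ} {a b : A} (ha : a ∈ symbolicPower P m.toNat)
    (hb : b ∈ symbolicPower P n.toNat) : a * b ∈ symbolicPower P (m + n).toNat :=
  symbolicPower_antitone P (by omega) (mul_mem_symbolicPower P ha hb)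

section Order

variable [IsDomain A] [IsDiscreteValuationRing (Localization.AtPrime P)]

open IsDiscreteValuationRing

/-- The order of vanishing along a prime `P` whose localization is a discrete valuation ring. -/
noncomputable def primeOrder (a : A) : ℕ∞ :=
  addVal (Localization.AtPrime P) (algebraMap A _ a)

lemma mem_symbolicPower_iff_le_primeOrder {n : ℕ} {a : A} :
    a ∈ symbolicPower P n ↔ (n : ℕ∞) ≤ primeOrder P a := by
  obtain ⟨ϖ, hϖ⟩ := IsDiscreteValuationRing.exists_irreducible (Localization.AtPrime P)
  rw [symbolicPower, Ideal.mem_comap, Ideal.map_pow, Localization.AtPrime.map_eq_maximalIdeal,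
    hϖ.maximalIdeal_eq, Ideal.span_singleton_pow, Ideal.mem_span_singleton, primeOrder,
    ← addVal_le_iff_dvd, hϖ.addVal_pow]

lemma primeOrder_mul (a b : A) : primeOrder P (a * b) = primeOrder P a + primeOrder P b := by
  rw [primeOrder, map_mul, addVal_mul]; rfl

lemma primeOrder_eq_top_iff {a : A} : primeOrder P a = ⊤ ↔ a = 0 := by
  rw [primeOrder, addVal_eq_top_iff, map_eq_zero_iff]
  exact IsLocalization.injective _ P.primeCompl_le_nonZeroDivisors

lemma exists_notMem_symbolicPower {a : A} (ha : a ≠ 0) : ∃ n : ℕ, a ∉ symbolicPower P n := by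
  obtain ⟨n, hn⟩ := ENat.ne_top_iff_exists.1 (mt (primeOrder_eq_top_iff P).1 ha)
  refine ⟨n + 1, fun h ↦ ?_⟩
  rw [mem_symbolicPower_iff_le_primeOrder, ← hn] at h
  norm_cast at h
  omega

lemma primeOrder_eq {n : ℕ} {a : A} (h1 : a ∈ symbolicPower P n)
    (h2 : a ∉ symbolicPower P (n + 1)) : primeOrder P a = n := by
  rw [mem_symbolicPower_iff_le_primeOrder] at h1 h2
  push_cast at h2
  apply le_antisymm _ h1
  rw [not_le] at h2
  exact Order.le_of_lt_add_one h2

lemma mul_notMem_symbolicPower {m n : ℕ} {a b : A} (ha : a ∈ symbolicPower P m)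
    (ha' : a ∉ symbolicPower P (m + 1)) (hb : b ∈ symbolicPower P n)
    (hb' : b ∉ symbolicPower P (n + 1)) : a * b ∉ symbolicPower P (m + n + 1) := by
  rw [mem_symbolicPower_iff_le_primeOrder, primeOrder_mul, primeOrder_eq P ha ha',
    primeOrder_eq P hb hb']
  norm_cast
  omega

/-- Clear the denominator of a uniformizer of `A_P`. -/
lemma exists_mem_notMem_symbolicPower_two : ∃ a ∈ P, a ∉ symbolicPower P 2 := by
  by_contra! h
  obtain ⟨ϖ, hϖ⟩ := IsDiscreteValuationRing.exists_irreducible (Localization.AtPrime P)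
  obtain ⟨⟨a, s⟩, hs⟩ := IsLocalization.surj P.primeCompl ϖ
  have hu := IsLocalization.map_units (M := P.primeCompl) (Localization.AtPrime P) s
  have h1 : primeOrder P a = 1 := by
    rw [primeOrder, ← hs, addVal_mul, addVal_uniformizer hϖ, addVal_eq_zero_iff.2 hu, add_zero]
  have haP : a ∈ P := by
    rw [← symbolicPower_one P, mem_symbolicPower_iff_le_primeOrder, h1]; rfl
  have := h a haP
  rw [mem_symbolicPower_iff_le_primeOrder, h1] at this
  norm_num at this

end Order

end SymbolicPowers

/-! ### The symbolic Rees algebra, its prime element `t⁻¹`, and the Krull property. -/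

section SymbolicRees

variable {A : Type*} [CommRing A] (P : Ideal A) [P.IsPrime]

open LaurentPolynomial

lemma C_mul_T_mem_symbolicReesAlgebra {a : A} {n : ℤ} (ha : a ∈ symbolicPower P n.toNat) :
    C a * T n ∈ symbolicReesAlgebra P := by
  rcases le_or_gt n 0 with hn | hn
  · obtain ⟨m, rfl⟩ : ∃ m : ℕ, n = -m := ⟨(-n).toNat, by omega⟩
    have h1 : (T (-1) : A[T;T⁻¹]) ∈ symbolicReesAlgebra P :=
      Algebra.subset_adjoin (Or.inl rfl)
    have h2 : (T (-(m : ℤ)) : A[T;T⁻¹]) = T (-1) ^ m := by rw [T_pow]; congr 1; ring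
    rw [h2]
    exact mul_mem (Subalgebra.algebraMap_mem _ a) (pow_mem h1 m)
  · refine Algebra.subset_adjoin (Or.inr ⟨n.toNat, by omega, a, ha, ?_⟩)
    congr 2
    omega

/-- This coefficientwise description turns later questions about the algebra into questions about
symbolic powers. -/
lemma mem_symbolicReesAlgebra_iff {f : A[T;T⁻¹]} :
    f ∈ symbolicReesAlgebra P ↔ ∀ n : ℤ, f.coeff n ∈ symbolicPower P n.toNat := by
  constructor
  · intro hf
    induction hf using Algebra.adjoin_induction with
    | mem f hf =>
      intro n
      rcases hf with rfl | ⟨m, -, a, ha, rfl⟩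
      · rw [T_apply]
        split_ifs with h
        · subst h
          rw [show (-1 : ℤ).toNat = 0 from rfl, symbolicPower_zero]
          trivial
        · exact zero_mem _
      · rw [coeff_C_mul_T]
        split_ifs with h
        · subst h
          simpa using ha
        · exact zero_mem _
    | algebraMap r =>
      intro n
      change (C r).coeff n ∈ _
      rw [C_apply]
      split_ifs with h
      · subst h
        rw [Int.toNat_zero, symbolicPower_zero]
        trivial
      · exact zero_mem _
    | add f g _ _ hf hg =>
      intro n
      rw [AddMonoidAlgebra.coeff_add]
      exact add_mem (hf n) (hg n)
    | mul f g _ _ hf hg =>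
      intro n
      rw [coeff_mul_eq_sum]
      refine Ideal.sum_mem _ fun i _ ↦ ?_
      have := mul_mem_symbolicPower_toNat P (hf i) (hg (n - i))
      rwa [add_sub_cancel] at this
  · intro h
    rw [eq_sum_C_mul_T f]
    exact sum_mem fun n _ ↦ C_mul_T_mem_symbolicReesAlgebra P (h n)

/-- The homogeneous element `a tⁿ` of the symbolic Rees algebra. -/
noncomputable def reesMonomial {a : A} {n : ℤ} (ha : a ∈ symbolicPower P n.toNat) :
    symbolicReesAlgebra P :=
  ⟨C a * T n, C_mul_T_mem_symbolicReesAlgebra P ha⟩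

/-- The element `t⁻¹` of the symbolic Rees algebra. -/
noncomputable def reesInv : symbolicReesAlgebra P := ⟨T (-1), Algebra.subset_adjoin (Or.inl rfl)⟩

lemma coe_reesInv_pow (n : ℕ) : ((reesInv P ^ n : symbolicReesAlgebra P) : A[T;T⁻¹]) = T (-n) := by
  change (T (-1) : A[T;T⁻¹]) ^ n = _
  rw [T_pow]; congr 1; ring

lemma reesInv_pow_dvd_iff {n : ℕ} {f : symbolicReesAlgebra P} :
    reesInv P ^ n ∣ f ↔ ∀ i : ℤ, (f : A[T;T⁻¹]).coeff i ∈ symbolicPower P (i + n).toNat := by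
  constructor
  · rintro ⟨g, rfl⟩ i
    rw [MulMemClass.coe_mul, coe_reesInv_pow, coeff_T_mul, sub_neg_eq_add]
    exact (mem_symbolicReesAlgebra_iff P).1 g.2 _
  · intro h
    refine ⟨⟨T n * (f : A[T;T⁻¹]), (mem_symbolicReesAlgebra_iff P).2 fun i ↦ ?_⟩, ?_⟩
    · rw [coeff_T_mul]
      simpa using h (i - n)
    · apply Subtype.ext
      rw [MulMemClass.coe_mul, coe_reesInv_pow, ← mul_assoc, ← T_add, neg_add_cancel, T_zero,
        one_mul]

lemma reesInv_dvd_iff {f : symbolicReesAlgebra P} :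
    reesInv P ∣ f ↔ ∀ i : ℤ, (f : A[T;T⁻¹]).coeff i ∈ symbolicPower P (i + 1).toNat := by
  have := reesInv_pow_dvd_iff P (n := 1) (f := f)
  rwa [pow_one, Nat.cast_one] at this

/-- A large power of `t⁻¹` pushes any Laurent polynomial into nonpositive degrees, where the
coefficients are unrestricted. -/
instance isLocalization_away_reesInv : IsLocalization.Away (reesInv P) A[T;T⁻¹] where
  map_units := by
    rintro ⟨_, n, rfl⟩
    change IsUnit ((reesInv P ^ n : symbolicReesAlgebra P) : A[T;T⁻¹])
    rw [coe_reesInv_pow]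
    exact isUnit_T _
  surj f := by
    obtain ⟨N, hN⟩ := f.coeff.support.bddAbove
    refine ⟨⟨⟨f * T (-N.toNat), (mem_symbolicReesAlgebra_iff P).2 fun i ↦ ?_⟩,
      ⟨reesInv P ^ N.toNat, N.toNat, rfl⟩⟩, ?_⟩
    · rw [← T_mul, coeff_T_mul, sub_neg_eq_add]
      rcases le_or_gt i 0 with hi | hi
      · rw [show i.toNat = 0 by omega, symbolicPower_zero]; trivial
      · have : i + N.toNat ∉ f.coeff.support := by
          intro hmem
          have := hN hmem
          omega
        rw [Finsupp.notMem_support_iff.1 this]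
        exact zero_mem _
    · change f * ((reesInv P ^ N.toNat : symbolicReesAlgebra P) : A[T;T⁻¹]) = f * T (-N.toNat)
      rw [coe_reesInv_pow]
  exists_of_eq {x y} h := ⟨1, by rw [Subtype.ext h]⟩

variable [IsDomain A] [IsDiscreteValuationRing (Localization.AtPrime P)]

/-- The quotient by `t⁻¹` is the graded ring of the filtration by symbolic powers, and it has no
zero divisors because orders along `P` add up. -/
lemma prime_reesInv : Prime (reesInv P) := by
  refine ⟨?_, ?_, ?_⟩
  · intro h
    have := congrArg (fun f : symbolicReesAlgebra P ↦ (f : A[T;T⁻¹]).coeff (-1)) h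
    simp [reesInv] at this
  · intro h
    have := (reesInv_dvd_iff P (f := 1)).1 h.dvd 0
    rw [OneMemClass.coe_one, zero_add, show (1 : ℤ).toNat = 1 from rfl, symbolicPower_one,
      ← T_zero, T_apply, if_pos rfl] at this
    exact (Ideal.ne_top_iff_one P).1 ‹P.IsPrime›.ne_top this
  -- The highest degree whose coefficient obstructs divisibility by `t⁻¹`. It is nonnegative, since
  -- in negative degrees the condition is void; there the coefficient has order exactly `n`.
  · have key (f : symbolicReesAlgebra P) (hf : ¬ reesInv P ∣ f) :
        ∃ n : ℕ, (f : A[T;T⁻¹]).coeff n ∉ symbolicPower P (n + 1) ∧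
          ∀ i : ℤ, n < i → (f : A[T;T⁻¹]).coeff i ∈ symbolicPower P (i + 1).toNat := by
      classical
      rw [reesInv_dvd_iff, not_forall] at hf
      obtain ⟨i₀, hi₀⟩ := hf
      let s := (f : A[T;T⁻¹]).coeff.support.filter
        fun i ↦ (f : A[T;T⁻¹]).coeff i ∉ symbolicPower P (i + 1).toNat
      have hs (i : ℤ) : i ∈ s ↔ (f : A[T;T⁻¹]).coeff i ∉ symbolicPower P (i + 1).toNat := by
        rw [Finset.mem_filter, and_iff_right_iff_imp]
        intro h
        rw [Finsupp.mem_support_iff]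
        intro h0
        rw [h0] at h
        exact h (zero_mem _)
      have hne : s.Nonempty := ⟨i₀, (hs i₀).2 hi₀⟩
      have hm := (hs _).1 (s.max'_mem hne)
      have hnn : 0 ≤ s.max' hne := by
        by_contra hneg
        rw [show (s.max' hne + 1).toNat = 0 by omega, symbolicPower_zero] at hm
        exact hm trivial
      obtain ⟨n, hn⟩ := Int.eq_ofNat_of_zero_le hnn
      rw [hn] at hm
      refine ⟨n, hm, fun i hi ↦ ?_⟩
      by_contra hcon
      have := s.le_max' i ((hs i).2 hcon)
      omega
    intro f g hfg
    by_contra! hcon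
    obtain ⟨n, hn, hn'⟩ := key f hcon.1
    obtain ⟨m, hm, hm'⟩ := key g hcon.2
    have h := (reesInv_dvd_iff P).1 hfg (n + m)
    have hf := (mem_symbolicReesAlgebra_iff P).1 f.2
    have hg := (mem_symbolicReesAlgebra_iff P).1 g.2
    have hnm : (f : A[T;T⁻¹]).coeff n * (g : A[T;T⁻¹]).coeff m ∉ symbolicPower P (n + m + 1) :=
      mul_notMem_symbolicPower P (by simpa using hf n) hn (by simpa using hg m) hm
    have hns : (n : ℤ) ∈ (f : A[T;T⁻¹]).coeff.support := by
      rw [Finsupp.mem_support_iff]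
      intro h0
      rw [h0] at hn
      exact hn (zero_mem _)
    rw [MulMemClass.coe_mul, coeff_mul_eq_sum, ← Finset.add_sum_erase _ _ hns, add_sub_cancel_left,
      show ((n : ℤ) + m + 1).toNat = n + m + 1 by omega] at h
    refine hnm ((Ideal.add_mem_iff_left _ (Ideal.sum_mem _ fun i hi ↦ ?_)).1 h)
    -- Off the leading pair, one of the two degrees exceeds the maximal one, so that factor has one
    -- extra order of vanishing.
    rcases lt_or_gt_of_ne (Finset.ne_of_mem_erase hi) with hlt | hgt
    · have := mul_mem_symbolicPower_toNat P (hf i)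
        (hm' (n + m - i) (by omega))
      rwa [show (i + (n + m - i + 1)).toNat = n + m + 1 by omega] at this
    · have := mul_mem_symbolicPower_toNat P (hn' i hgt) (hg (n + m - i))
      rwa [show (i + 1 + (n + m - i)).toNat = n + m + 1 by omega] at this

lemma exists_not_reesInv_pow_dvd {f : symbolicReesAlgebra P} (hf : f ≠ 0) :
    ∃ n : ℕ, ¬ reesInv P ^ n ∣ f := by
  obtain ⟨i, hi⟩ : ∃ i, (f : A[T;T⁻¹]).coeff i ≠ 0 := by
    by_contra! h
    apply hf
    apply Subtype.ext
    ext i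
    exact h i
  obtain ⟨n, hn⟩ := exists_notMem_symbolicPower P hi
  -- Divisibility by `t⁻ᴺ` puts the coefficient of degree `i` into `P⁽ⁱ⁺ᴺ⁾`; this `N` ensures `i + N
  -- ≥ n` for negative `i` too.
  refine ⟨n + (-i).toNat, fun h ↦ hn ?_⟩
  exact symbolicPower_antitone P (by omega) ((reesInv_pow_dvd_iff P).1 h i)

/-- The symbolic Rees algebra of a Noetherian integrally closed domain with respect to a prime
whose localization is a discrete valuation ring is a Krull domain. -/
theorem isKrullDomain_symbolicReesAlgebra [IsNoetherianRing A] [IsIntegrallyClosed A] :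
    IsKrullDomain (symbolicReesAlgebra P) :=
  isKrullDomain_of_away (B := A[T;T⁻¹]) (prime_reesInv P) fun _ hf ↦ exists_not_reesInv_pow_dvd P hf

end SymbolicRees

/-! ### Jaffard and locally Jaffard domains. -/

section Jaffard

lemma IsJaffard.of_ringEquiv {R S : Type*} [CommRing R] [CommRing S] (e : R ≃+* S)
    (h : IsJaffard R) : IsJaffard S := by
  obtain ⟨hd, htop, hn⟩ := h
  refine ⟨e.symm.toMulEquiv.isDomain, ?_, fun n h1 ↦ ?_⟩
  · rwa [← ringKrullDim_eq_of_ringEquiv e]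
  · rw [← ringKrullDim_eq_of_ringEquiv e, ← hn n h1,
      ringKrullDim_eq_of_ringEquiv (MvPolynomial.mapEquiv (Fin n) e)]

/-- The inequality `dim R + n ≤ dim R[X₁, …, Xₙ]` always holds, so only the upper bound has to be
supplied. -/
lemma isJaffard_of_ringKrullDim_le {R : Type*} [CommRing R] [IsDomain R] {h : ℕ}
    (hR : ringKrullDim R = h)
    (hle : ∀ n : ℕ, ringKrullDim (MvPolynomial (Fin n) R) ≤ (h + n : ℕ)) : IsJaffard R := by
  refine ⟨inferInstance, ?_, fun n _ ↦ le_antisymm ?_ ?_⟩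
  · rw [hR]
    exact (WithBot.coe_lt_coe.2 (ENat.natCast_lt_top h)).ne
  · rw [hR, add_comm]
    exact_mod_cast hle n
  · have := ringKrullDim_add_natCard_le_ringKrullDim_mvPolynomial (R := R) (Fin n)
    rwa [Nat.card_eq_fintype_card, Fintype.card_fin, add_comm] at this

lemma isJaffard_of_isNoetherianRing (R : Type*) [CommRing R] [IsDomain R] [IsLocalRing R]
    [IsNoetherianRing R] : IsJaffard R := by
  refine ⟨inferInstance, ringKrullDim_ne_top, fun n _ ↦ ?_⟩
  rw [MvPolynomial.ringKrullDim_of_isNoetherianRing, Nat.card_eq_fintype_card, Fintype.card_fin,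
    add_comm]

lemma isJaffard_of_isDiscreteValuationRing (R : Type*) [CommRing R] [IsDomain R]
    [IsDiscreteValuationRing R] : IsJaffard R :=
  isJaffard_of_isNoetherianRing R

/-- As `u` lies outside `p`, the ring `R_p` is a further localization of `B = R[1/u]`. -/
lemma isNoetherianRing_atPrime_of_away {R B : Type*} [CommRing R] [CommRing B] [Algebra R B] {u : R}
    [IsLocalization.Away u B] [IsNoetherianRing B] (p : Ideal R) [p.IsPrime] (hu : u ∉ p) :
    IsNoetherianRing (Localization.AtPrime p) := by
  have hle : Submonoid.powers u ≤ p.primeCompl := by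
    rintro _ ⟨n, rfl⟩ hn
    exact hu (‹p.IsPrime›.mem_of_pow_mem n hn)
  let _ : Algebra B (Localization.AtPrime p) :=
    IsLocalization.localizationAlgebraOfSubmonoidLe B _ (Submonoid.powers u) p.primeCompl hle
  have : IsScalarTower R B (Localization.AtPrime p) :=
    IsLocalization.localization_isScalarTower_of_submonoid_le B _ (Submonoid.powers u)
      p.primeCompl hle
  have := IsLocalization.isLocalization_of_submonoid_le B (Localization.AtPrime p)
    (Submonoid.powers u) p.primeCompl hle
  exact IsLocalization.isNoetherianRing (p.primeCompl.map (algebraMap R B)) _ inferInstance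

theorem IsLocallyJaffard.atPrime {R : Type*} [CommRing R] (h : IsLocallyJaffard R) (M : Ideal R)
    [M.IsPrime] : IsLocallyJaffard (Localization.AtPrime M) := by
  have := h.1
  refine ⟨IsLocalization.isDomain_of_le_nonZeroDivisors _ M.primeCompl_le_nonZeroDivisors,
    fun p _ ↦ ?_⟩
  exact (h.2 _).of_ringEquiv
    (IsLocalization.localizationLocalizationAtPrimeIsoLocalization M.primeCompl p).toRingEquiv

end Jaffard

/-! ### Homogeneous cores, constant-coefficient ideals and heights in the Rees algebra. -/

section SymbolicReesPrimes

variable {A : Type*} [CommRing A] {P : Ideal A} [P.IsPrime]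

open LaurentPolynomial

/-- The homogeneous component of degree `n` of an element of the symbolic Rees algebra. -/
noncomputable def reesComponent (n : ℤ) (f : symbolicReesAlgebra P) : symbolicReesAlgebra P :=
  reesMonomial P ((mem_symbolicReesAlgebra_iff P).1 f.2 n)

lemma coe_reesComponent (n : ℤ) (f : symbolicReesAlgebra P) :
    (reesComponent n f : A[T;T⁻¹]) = C ((f : A[T;T⁻¹]).coeff n) * T n := rfl

lemma sum_reesComponent (f : symbolicReesAlgebra P) :
    f = ∑ n ∈ (f : A[T;T⁻¹]).coeff.support, reesComponent n f := by
  apply Subtype.ext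
  rw [AddSubmonoidClass.coe_finsetSum]
  exact eq_sum_C_mul_T _

lemma reesComponent_mul (N : ℤ) (f g : symbolicReesAlgebra P) :
    reesComponent N (f * g) =
      ∑ i ∈ (f : A[T;T⁻¹]).coeff.support, reesComponent i f * reesComponent (N - i) g := by
  apply Subtype.ext
  rw [AddSubmonoidClass.coe_finsetSum, coe_reesComponent, MulMemClass.coe_mul, coeff_mul_eq_sum,
    map_sum, Finset.sum_mul]
  refine Finset.sum_congr rfl fun i _ ↦ ?_
  rw [MulMemClass.coe_mul, coe_reesComponent, coe_reesComponent, map_mul]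
  have : (T N : A[T;T⁻¹]) = T i * T (N - i) := by rw [← T_add]; congr 1; ring
  rw [this]
  ring

lemma reesComponent_add (N : ℤ) (f g : symbolicReesAlgebra P) :
    reesComponent N (f + g) = reesComponent N f + reesComponent N g := by
  apply Subtype.ext
  rw [AddMemClass.coe_add, coe_reesComponent, coe_reesComponent, coe_reesComponent,
    AddMemClass.coe_add, AddMonoidAlgebra.coeff_add, Finsupp.add_apply, map_add, add_mul]

lemma reesComponent_reesMonomial (N n : ℤ) {a : A} (ha : a ∈ symbolicPower P n.toNat) :
    reesComponent N (reesMonomial P ha) = if n = N then reesMonomial P ha else 0 := by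
  apply Subtype.ext
  rw [coe_reesComponent]
  change C ((C a * T n).coeff N) * T N = _
  rw [coeff_C_mul_T]
  split_ifs with h
  · subst h; rfl
  · simp

lemma reesComponent_eq_zero {n : ℤ} {f : symbolicReesAlgebra P}
    (h : n ∉ (f : A[T;T⁻¹]).coeff.support) : reesComponent n f = 0 := by
  apply Subtype.ext
  rw [coe_reesComponent, Finsupp.notMem_support_iff.1 h, map_zero, zero_mul]
  rfl

/-- The largest homogeneous ideal inside an ideal of the symbolic Rees algebra. -/
noncomputable def reesHomogeneousCore (p : Ideal (symbolicReesAlgebra P)) :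
    Ideal (symbolicReesAlgebra P) where
  carrier := {f | ∀ n, reesComponent n f ∈ p}
  add_mem' hf hg n := by rw [reesComponent_add]; exact add_mem (hf n) (hg n)
  zero_mem' n := by rw [reesComponent_eq_zero (by simp)]; exact zero_mem _
  smul_mem' r f hf n := by
    rw [smul_eq_mul, reesComponent_mul]
    exact sum_mem fun i _ ↦ Ideal.mul_mem_left _ _ (hf _)

lemma reesHomogeneousCore_le (p : Ideal (symbolicReesAlgebra P)) : reesHomogeneousCore p ≤ p := by
  intro f hf
  rw [sum_reesComponent f]
  exact sum_mem fun n _ ↦ hf n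

lemma reesMonomial_mem_reesHomogeneousCore {p : Ideal (symbolicReesAlgebra P)} {n : ℤ} {a : A}
    (ha : a ∈ symbolicPower P n.toNat) (h : reesMonomial P ha ∈ p) :
    reesMonomial P ha ∈ reesHomogeneousCore p := by
  intro N
  rw [reesComponent_reesMonomial]
  split_ifs
  · exact h
  · exact zero_mem _

/-- Take the highest components of `f` and `g` outside `p`: in the sum of their degrees, every other
term of the product lies in `p`. -/
instance isPrime_reesHomogeneousCore (p : Ideal (symbolicReesAlgebra P)) [p.IsPrime] :
    (reesHomogeneousCore p).IsPrime := by
  have key (f : symbolicReesAlgebra P) (hf : f ∉ reesHomogeneousCore p) :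
      ∃ n : ℤ, reesComponent n f ∉ p ∧ ∀ i : ℤ, n < i → reesComponent i f ∈ p := by
    classical
    obtain ⟨i₀, hi₀⟩ := not_forall.1 hf
    let s := (f : A[T;T⁻¹]).coeff.support.filter fun i ↦ reesComponent i f ∉ p
    have hs (i : ℤ) : i ∈ s ↔ reesComponent i f ∉ p := by
      rw [Finset.mem_filter, and_iff_right_iff_imp]
      intro h
      by_contra h0
      rw [reesComponent_eq_zero h0] at h
      exact h (zero_mem _)
    have hne : s.Nonempty := ⟨i₀, (hs i₀).2 hi₀⟩
    refine ⟨s.max' hne, (hs _).1 (s.max'_mem hne), fun i hi ↦ ?_⟩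
    by_contra hcon
    have := s.le_max' i ((hs i).2 hcon)
    omega
  refine ⟨fun h ↦ ‹p.IsPrime›.ne_top (top_le_iff.1 (h ▸ reesHomogeneousCore_le p)), ?_⟩
  intro f g hfg
  by_contra! hcon
  obtain ⟨n, hn, hn'⟩ := key f hcon.1
  obtain ⟨m, hm, hm'⟩ := key g hcon.2
  have h := hfg (n + m)
  have hns : n ∈ (f : A[T;T⁻¹]).coeff.support := by
    by_contra h0
    rw [reesComponent_eq_zero h0] at hn
    exact hn (zero_mem _)
  rw [reesComponent_mul, ← Finset.add_sum_erase _ _ hns, add_sub_cancel_left] at h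
  refine (‹p.IsPrime›.mul_mem_iff_mem_or_mem.1
    ((Ideal.add_mem_iff_left _ (Ideal.sum_mem _ fun i hi ↦ ?_)).1 h)).elim hn hm
  rcases lt_or_gt_of_ne (Finset.ne_of_mem_erase hi) with hlt | hgt
  · exact Ideal.mul_mem_left _ _ (hm' _ (by omega))
  · exact Ideal.mul_mem_right _ _ (hn' _ hgt)

/-- The cross terms pair degrees `i` and `-i`, one of them positive, and coefficients of positive
degree lie in `P`. Thus the constant coefficient is a ring homomorphism modulo `P`, which makes
`reesConstIdeal` an ideal, prime when `m` is. -/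
lemma coeff_zero_mul_sub_mem (f g : symbolicReesAlgebra P) :
    ((f * g : symbolicReesAlgebra P) : A[T;T⁻¹]).coeff 0 -
      (f : A[T;T⁻¹]).coeff 0 * (g : A[T;T⁻¹]).coeff 0 ∈ P := by
  have hP (h : symbolicReesAlgebra P) (i : ℤ) (hi : 0 < i) : (h : A[T;T⁻¹]).coeff i ∈ P := by
    have := symbolicPower_antitone P (show 1 ≤ i.toNat by omega)
      ((mem_symbolicReesAlgebra_iff P).1 h.2 i)
    rwa [symbolicPower_one] at this
  have hsum : ∑ i ∈ (f : A[T;T⁻¹]).coeff.support.erase 0,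
      (f : A[T;T⁻¹]).coeff i * (g : A[T;T⁻¹]).coeff (0 - i) ∈ P := by
    refine Ideal.sum_mem _ fun i hi ↦ ?_
    rcases lt_or_gt_of_ne (Finset.ne_of_mem_erase hi) with hlt | hgt
    · exact Ideal.mul_mem_left _ _ (hP g _ (by omega))
    · exact Ideal.mul_mem_right _ _ (hP f _ hgt)
  rw [MulMemClass.coe_mul, coeff_mul_eq_sum]
  by_cases h0 : (0 : ℤ) ∈ (f : A[T;T⁻¹]).coeff.support
  · rwa [← Finset.add_sum_erase _ _ h0, sub_zero, add_sub_cancel_left]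
  · rwa [← Finset.erase_eq_of_notMem h0, Finsupp.notMem_support_iff.1 h0, zero_mul, sub_zero]

/-- The ideal of elements of the symbolic Rees algebra of `P` whose constant coefficient lies in
a given ideal containing `P`. -/
noncomputable def reesConstIdeal (m : Ideal A) (hm : P ≤ m) : Ideal (symbolicReesAlgebra P) where
  carrier := {f | (f : A[T;T⁻¹]).coeff 0 ∈ m}
  add_mem' {f g} hf hg := by
    rw [Set.mem_ofPred_eq, AddMemClass.coe_add, AddMonoidAlgebra.coeff_add]
    exact add_mem hf hg
  zero_mem' := zero_mem m
  smul_mem' r f hf := by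
    have := hm (coeff_zero_mul_sub_mem r f)
    exact (Submodule.sub_mem_iff_left _ (Ideal.mul_mem_left _ _ hf)).1 this

lemma mem_reesConstIdeal {m : Ideal A} {hm : P ≤ m} {f : symbolicReesAlgebra P} :
    f ∈ reesConstIdeal m hm ↔ (f : A[T;T⁻¹]).coeff 0 ∈ m := Iff.rfl

lemma isPrime_reesConstIdeal (m : Ideal A) [m.IsPrime] (hm : P ≤ m) :
    (reesConstIdeal m hm).IsPrime := by
  refine ⟨fun h ↦ ?_, fun {f g} hfg ↦ ?_⟩
  · have h1 : (1 : symbolicReesAlgebra P) ∈ reesConstIdeal m hm := h ▸ trivial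
    rw [mem_reesConstIdeal, OneMemClass.coe_one, ← T_zero, T_apply, if_pos rfl] at h1
    exact (Ideal.ne_top_iff_one m).1 ‹m.IsPrime›.ne_top h1
  · have h1 := hm (coeff_zero_mul_sub_mem f g)
    exact ‹m.IsPrime›.mem_or_mem ((Submodule.sub_mem_iff_right m hfg).1 h1)

lemma reesInv_mem_reesConstIdeal {m : Ideal A} (hm : P ≤ m) :
    reesInv P ∈ reesConstIdeal m hm := by
  rw [mem_reesConstIdeal]
  change (T (-1) : A[T;T⁻¹]).coeff 0 ∈ m
  rw [T_apply, if_neg (by norm_num)]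
  exact zero_mem m

lemma coe_algebraMap_coeff (a : A) (n : ℤ) :
    ((algebraMap A (symbolicReesAlgebra P) a : symbolicReesAlgebra P) : A[T;T⁻¹]).coeff n =
      if n = 0 then a else 0 := by
  change (C a).coeff n = _
  rw [C_apply]

lemma algebraMap_eq_reesMonomial (a : A) : algebraMap A (symbolicReesAlgebra P) a =
    reesMonomial P (a := a) (n := 0) (by rw [Int.toNat_zero, symbolicPower_zero]; trivial) := by
  apply Subtype.ext
  change C a = C a * T 0
  rw [T_zero, mul_one]

lemma reesInv_dvd_algebraMap_iff {a : A} :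
    reesInv P ∣ algebraMap A (symbolicReesAlgebra P) a ↔ a ∈ P := by
  rw [reesInv_dvd_iff]
  simp_rw [coe_algebraMap_coeff]
  constructor
  · intro h
    have := h 0
    rwa [if_pos rfl, zero_add, show (1 : ℤ).toNat = 1 from rfl, symbolicPower_one] at this
  · intro h i
    split_ifs with hi
    · subst hi
      rwa [zero_add, show (1 : ℤ).toNat = 1 from rfl, symbolicPower_one]
    · exact zero_mem _

lemma reesInv_dvd_reesMonomial_iff {n : ℤ} {a : A} {ha : a ∈ symbolicPower P n.toNat} :
    reesInv P ∣ reesMonomial P ha ↔ a ∈ symbolicPower P (n + 1).toNat := by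
  rw [reesInv_dvd_iff]
  change (∀ i, (C a * T n : A[T;T⁻¹]).coeff i ∈ _) ↔ _
  simp_rw [coeff_C_mul_T]
  constructor
  · intro h
    simpa using h n
  · intro h i
    split_ifs with hi
    · rwa [← hi]
    · exact zero_mem _

lemma reesMonomial_mem_of_neg {p : Ideal (symbolicReesAlgebra P)} (hu : reesInv P ∈ p) {n : ℤ}
    (hn : n < 0) {a : A} (ha : a ∈ symbolicPower P n.toNat) : reesMonomial P ha ∈ p := by
  refine Ideal.mem_of_dvd _ ((reesInv_dvd_reesMonomial_iff).2 ?_) hu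
  rw [show (n + 1).toNat = 0 by omega, symbolicPower_zero]
  trivial

section Heights

variable [IsDomain A] [IsDiscreteValuationRing (Localization.AtPrime P)]

lemma isPrime_span_reesInv : (Ideal.span {reesInv P}).IsPrime :=
  (Ideal.span_singleton_prime (prime_reesInv P).ne_zero).2 (prime_reesInv P)

lemma span_reesInv_lt_reesConstIdeal : Ideal.span {reesInv P} < reesConstIdeal P le_rfl := by
  refine lt_of_le_of_ne ((Ideal.span_singleton_le_iff_mem _).2 (reesInv_mem_reesConstIdeal _)) ?_
  intro h
  -- For `a` of order exactly one, `a t` has zero constant coefficient but is not divisible by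
  -- `t⁻¹`.
  obtain ⟨a, haP, ha⟩ := exists_mem_notMem_symbolicPower_two P
  have ha1 : a ∈ symbolicPower P (1 : ℤ).toNat := by
    rwa [show (1 : ℤ).toNat = 1 from rfl, symbolicPower_one]
  have : reesMonomial P ha1 ∈ reesConstIdeal P le_rfl := by
    rw [mem_reesConstIdeal]
    change (C a * T 1).coeff 0 ∈ P
    rw [coeff_C_mul_T, if_neg (by norm_num)]
    exact zero_mem P
  rw [← h, Ideal.mem_span_singleton, reesInv_dvd_reesMonomial_iff] at this
  exact ha this

lemma one_le_height_span_reesInv : 1 ≤ (Ideal.span {reesInv P}).height := by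
  rw [Order.one_le_iff_ne_zero, Ne, Ideal.height_eq_zero_iff_eq_bot, Ideal.span_singleton_eq_bot]
  exact (prime_reesInv P).ne_zero

lemma two_le_height_of_span_reesInv_lt {p : Ideal (symbolicReesAlgebra P)} [p.IsPrime]
    (h : Ideal.span {reesInv P} < p) : 2 ≤ p.height := by
  have := isPrime_span_reesInv (P := P)
  refine le_trans ?_ (Ideal.height_add_one_le_of_lt_of_isPrime h)
  exact add_le_add_left (one_le_height_span_reesInv (P := P)) 1

lemma three_le_height_of_lt_of_lt {q p : Ideal (symbolicReesAlgebra P)} [q.IsPrime] [p.IsPrime]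
    (h : Ideal.span {reesInv P} < q) (h' : q < p) : 3 ≤ p.height := by
  refine le_trans ?_ (Ideal.height_add_one_le_of_lt_of_isPrime h')
  exact add_le_add_left (two_le_height_of_span_reesInv_lt h) 1

/-- The chain is `0 < (t⁻¹) < reesConstIdeal P < reesConstIdeal m`; it also gives the lower bound
for the dimension. -/
lemma three_le_height_reesConstIdeal {m : Ideal A} [m.IsPrime] (hm : P < m) :
    3 ≤ (reesConstIdeal m hm.le).height := by
  have := isPrime_reesConstIdeal m hm.le
  have := isPrime_reesConstIdeal P le_rfl
  refine three_le_height_of_lt_of_lt span_reesInv_lt_reesConstIdeal (lt_of_le_of_ne ?_ ?_)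
  · intro f hf
    exact hm.le hf
  · intro h
    obtain ⟨a, ham, haP⟩ := Set.exists_of_ssubset hm
    have : algebraMap A (symbolicReesAlgebra P) a ∈ reesConstIdeal m hm.le := by
      rw [mem_reesConstIdeal, coe_algebraMap_coeff, if_pos rfl]
      exact ham
    rw [← h, mem_reesConstIdeal, coe_algebraMap_coeff, if_pos rfl] at this
    exact haP this

variable {k : Type*} [Field k] [IsAlgClosed k] [Algebra k A]

/-- A prime of the symbolic Rees algebra containing `t⁻¹`, whose residue ring is algebraic over the
algebraically closed base field, has height at least three if `P` is not maximal. -/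
lemma three_le_height_of_isAlgebraic (hP : ¬ P.IsMaximal) {p : Ideal (symbolicReesAlgebra P)}
    [p.IsPrime] (hu : reesInv P ∈ p) [Algebra.IsAlgebraic k (symbolicReesAlgebra P ⧸ p)] :
    3 ≤ p.height := by
  have hbij := IsAlgClosed.algebraMap_bijective_of_isIntegral (k := k)
    (K := symbolicReesAlgebra P ⧸ p)
  have hres (f : symbolicReesAlgebra P) :
      ∃ c : k, f - algebraMap k (symbolicReesAlgebra P) c ∈ p := by
    obtain ⟨c, hc⟩ := hbij.2 (Ideal.Quotient.mk p f)
    exact ⟨c, Ideal.Quotient.eq.1 hc.symm⟩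
  set m := p.comap (algebraMap A (symbolicReesAlgebra P)) with hm
  have hPm : P ≤ m := fun a ha ↦
    Ideal.mem_of_dvd p (reesInv_dvd_algebraMap_iff.2 ha) hu
  have hmax : m.IsMaximal := by
    refine Ideal.isMaximal_def.2 ⟨Ideal.IsPrime.ne_top', fun J hJ ↦ ?_⟩
    obtain ⟨a, haJ, ham⟩ := Set.exists_of_ssubset hJ
    obtain ⟨c, hc⟩ := hres (algebraMap A _ a)
    rw [IsScalarTower.algebraMap_apply k A (symbolicReesAlgebra P), ← map_sub] at hc
    have hc' : a - algebraMap k A c ∈ m := hc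
    have hcJ : algebraMap k A c ∈ J := (Submodule.sub_mem_iff_right _ haJ).1 (hJ.le hc')
    have hc0 : c ≠ 0 := by
      rintro rfl
      rw [map_zero, sub_zero] at hc'
      exact ham hc'
    exact Ideal.eq_top_of_isUnit_mem _ hcJ ((Ne.isUnit hc0).map _)
  have hlt : P < m := lt_of_le_of_ne hPm fun h ↦ hP (h ▸ hmax)
  obtain ⟨a, ham, haP⟩ := Set.exists_of_ssubset hlt
  -- A prime is needed strictly between `(t⁻¹)` and `p`. If `p` is not homogeneous, its core serves:
  -- it contains `a`, which `t⁻¹` does not divide. If `p` is homogeneous, `reesConstIdeal P` serves.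
  by_cases hq : reesHomogeneousCore p = p
  -- Modulo `p` the monomial `b tⁿ` equals a scalar `c`; as `p` is homogeneous and `n ≠ 0`, the
  -- degree-zero part `c` lies in `p`, hence so does `b tⁿ`.
  · have hpos {n : ℤ} (hn : 0 < n) {b : A} (hb : b ∈ symbolicPower P n.toNat) :
        reesMonomial P hb ∈ p := by
      obtain ⟨c, hc⟩ := hres (reesMonomial P hb)
      have hc' := hc
      rw [← hq] at hc'
      have h0 := hc' 0
      have h1 : reesComponent 0 (reesMonomial P hb - algebraMap k _ c) =
          - algebraMap k (symbolicReesAlgebra P) c := by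
        rw [sub_eq_add_neg, reesComponent_add, reesComponent_reesMonomial, if_neg hn.ne', zero_add,
          ← map_neg, IsScalarTower.algebraMap_apply k A (symbolicReesAlgebra P),
          algebraMap_eq_reesMonomial, reesComponent_reesMonomial, if_pos rfl]
      rw [h1, neg_mem_iff] at h0
      exact (Submodule.sub_mem_iff_left _ h0).1 hc
    have := isPrime_reesConstIdeal P le_rfl
    refine three_le_height_of_lt_of_lt span_reesInv_lt_reesConstIdeal (lt_of_le_of_ne ?_ ?_)
    · intro f hf
      rw [sum_reesComponent f]
      refine sum_mem fun n _ ↦ ?_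
      rcases lt_trichotomy n 0 with hn | rfl | hn
      · exact reesMonomial_mem_of_neg hu hn _
      · have h1 : (f : A[T;T⁻¹]).coeff 0 ∈ m := hPm hf
        have h2 : algebraMap A (symbolicReesAlgebra P) ((f : A[T;T⁻¹]).coeff 0) ∈ p := h1
        rwa [algebraMap_eq_reesMonomial] at h2
      · exact hpos hn _
    · intro h
      have : algebraMap A (symbolicReesAlgebra P) a ∈ p := ham
      rw [← h, mem_reesConstIdeal, coe_algebraMap_coeff, if_pos rfl] at this
      exact haP this
  · refine three_le_height_of_lt_of_lt (lt_of_le_of_ne ?_ ?_)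
      (lt_of_le_of_ne (reesHomogeneousCore_le p) hq)
    · rw [Ideal.span_singleton_le_iff_mem]
      have h1 : (1 : A) ∈ symbolicPower P (-1 : ℤ).toNat := by
        rw [show (-1 : ℤ).toNat = 0 from rfl, symbolicPower_zero]; trivial
      have h2 : reesInv P = reesMonomial P h1 := by
        apply Subtype.ext
        change T (-1) = C 1 * T (-1)
        rw [map_one, one_mul]
      rw [h2]
      exact reesMonomial_mem_reesHomogeneousCore _ (h2 ▸ hu)
    · intro h
      have h1 : algebraMap A (symbolicReesAlgebra P) a ∈ p := ham
      have h2 : algebraMap A (symbolicReesAlgebra P) a ∈ reesHomogeneousCore p := by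
        rw [algebraMap_eq_reesMonomial] at h1 ⊢
        exact reesMonomial_mem_reesHomogeneousCore _ h1
      rw [← h, Ideal.mem_span_singleton, reesInv_dvd_algebraMap_iff] at h2
      exact haP h2

end Heights

/-! ### Dimension three and the local Jaffard property. -/

section Dimension

variable {k A : Type*} [Field k] [CommRing A] [IsDomain A] [Algebra k A]

lemma trdeg_symbolicReesAlgebra_le (P : Ideal A) [P.IsPrime] {d : ℕ}
    (hd : Algebra.trdeg k A ≤ d) : Algebra.trdeg k (symbolicReesAlgebra P) ≤ (d + 1 : ℕ) := by
  have h1 : Algebra.trdeg k (Polynomial A) ≤ (d + 1 : ℕ) := by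
    have := trdeg_add_eq k A (A := Polynomial A)
    rw [← this, Polynomial.trdeg_of_isDomain, Nat.cast_add, Nat.cast_one]
    gcongr
  have : IsScalarTower k (Polynomial A) A[T;T⁻¹] := IsScalarTower.of_algebraMap_eq fun c ↦ by
    rw [algebraMap_eq_toLaurent, IsScalarTower.algebraMap_apply k A (Polynomial A),
      Polynomial.algebraMap_eq, Polynomial.toLaurent_C]
    rfl
  have h2 : Algebra.trdeg k A[T;T⁻¹] ≤ (d + 1 : ℕ) :=
    trdeg_localization_le (S := Polynomial A) (Submonoid.powers Polynomial.X)
      (powers_le_nonZeroDivisors_of_noZeroDivisors Polynomial.X_ne_zero) h1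
  refine le_trans ?_ h2
  exact trdeg_le_of_injective ((symbolicReesAlgebra P).val.restrictScalars k)
    Subtype.val_injective

variable (P : Ideal A) [P.IsPrime] [IsDiscreteValuationRing (Localization.AtPrime P)]

theorem ringKrullDim_symbolicReesAlgebra (hd : Algebra.trdeg k A ≤ 2)
    (hP : ¬ P.IsMaximal) :
    ringKrullDim (symbolicReesAlgebra P) = 3 := by
  apply le_antisymm
  · exact ringKrullDim_le_of_trdeg_le (trdeg_symbolicReesAlgebra_le P (by exact_mod_cast hd))
  · obtain ⟨m, hm, hle⟩ := Ideal.exists_le_maximal P Ideal.IsPrime.ne_top'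
    have hlt : P < m := lt_of_le_of_ne hle fun h ↦ hP (h ▸ hm)
    have := isPrime_reesConstIdeal m hle
    refine le_trans ?_ (Ideal.height_le_ringKrullDim_of_isPrime (I := reesConstIdeal m hle))
    exact WithBot.coe_le_coe.2 (three_le_height_reesConstIdeal hlt)

/-- Height three uses up the whole transcendence degree, so polynomial rings over the localization
have dimension at most `3 + n`. -/
lemma isJaffard_atPrime_of_isAlgebraic [IsAlgClosed k] (hd : Algebra.trdeg k A ≤ 2)
    (hP : ¬ P.IsMaximal) {p : Ideal (symbolicReesAlgebra P)} [p.IsPrime] (hu : reesInv P ∈ p)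
    [Algebra.IsAlgebraic k (symbolicReesAlgebra P ⧸ p)] : IsJaffard (Localization.AtPrime p) := by
  have : IsDomain (Localization.AtPrime p) :=
    IsLocalization.isDomain_of_le_nonZeroDivisors _ p.primeCompl_le_nonZeroDivisors
  have htr : Algebra.trdeg k (symbolicReesAlgebra P) ≤ (3 : ℕ) :=
    trdeg_symbolicReesAlgebra_le P (by exact_mod_cast hd)
  have hdim := IsLocalization.AtPrime.ringKrullDim_eq_height p (Localization.AtPrime p)
  have h3 : p.height = 3 :=
    le_antisymm (height_le_of_trdeg_le htr p) (three_le_height_of_isAlgebraic (k := k) hP hu)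
  have : Nontrivial (symbolicReesAlgebra P ⧸ p) :=
    Ideal.Quotient.nontrivial_iff.2 (Ideal.IsPrime.ne_top ‹_›)
  refine isJaffard_of_ringKrullDim_le (h := 3) (by rw [hdim, h3]; rfl) fun n ↦ ?_
  exact ringKrullDim_mvPolynomial_atPrime_le htr p (r := 0) (x := Fin.elim0)
    ((algebraicIndependent_empty_type_iff (R := k)).2
      (algebraMap k (symbolicReesAlgebra P ⧸ p)).injective) n _ le_rfl

/-- Here height two and one transcendental residue use up the transcendence degree three. -/
lemma isJaffard_atPrime_of_transcendental (hd : Algebra.trdeg k A ≤ 2)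
    {p : Ideal (symbolicReesAlgebra P)} [p.IsPrime] (hlt : Ideal.span {reesInv P} < p)
    {y : symbolicReesAlgebra P} (hy : Transcendental k (Ideal.Quotient.mkₐ k p y)) :
    IsJaffard (Localization.AtPrime p) := by
  have : IsDomain (Localization.AtPrime p) :=
    IsLocalization.isDomain_of_le_nonZeroDivisors _ p.primeCompl_le_nonZeroDivisors
  have htr : Algebra.trdeg k (symbolicReesAlgebra P) ≤ (3 : ℕ) :=
    trdeg_symbolicReesAlgebra_le P (by exact_mod_cast hd)
  have hdim := IsLocalization.AtPrime.ringKrullDim_eq_height p (Localization.AtPrime p)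
  have hy' : AlgebraicIndependent k
      (fun i ↦ Ideal.Quotient.mkₐ k p ((fun _ : Fin 1 ↦ y) i)) :=
    (algebraicIndependent_unique_type_iff (ι := Fin 1)).2 hy
  have h2 := two_le_height_of_span_reesInv_lt hlt
  have h2' : p.height = 2 := by
    have h := height_add_le_of_trdeg_le htr p hy'
    obtain ⟨n, hn⟩ := ENat.ne_top_iff_exists.1
      (ne_top_of_le_ne_top (ENat.natCast_ne_top 3) (height_le_of_trdeg_le htr p))
    rw [← hn] at h h2 ⊢
    norm_cast at h h2 ⊢
    omega
  refine isJaffard_of_ringKrullDim_le (h := 2) (by rw [hdim, h2']; rfl) fun n ↦ ?_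
  exact ringKrullDim_mvPolynomial_atPrime_le htr p hy' n _ (by omega)

theorem isLocallyJaffard_symbolicReesAlgebra [IsAlgClosed k] [IsNoetherianRing A]
    (hd : Algebra.trdeg k A ≤ 2) (hP : ¬ P.IsMaximal) :
    IsLocallyJaffard (symbolicReesAlgebra P) := by
  refine ⟨inferInstance, fun p _ ↦ ?_⟩
  have : IsDomain (Localization.AtPrime p) :=
    IsLocalization.isDomain_of_le_nonZeroDivisors _ p.primeCompl_le_nonZeroDivisors
  by_cases hu : reesInv P ∈ p
  · rcases eq_or_ne (Ideal.span {reesInv P}) p with rfl | hne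
    · have := isDiscreteValuationRing_atPrime_span_singleton (prime_reesInv P)
        fun _ hf ↦ exists_not_reesInv_pow_dvd P hf
      exact isJaffard_of_isDiscreteValuationRing _
    · by_cases halg : Algebra.IsAlgebraic k (symbolicReesAlgebra P ⧸ p)
      · exact isJaffard_atPrime_of_isAlgebraic (k := k) P hd hP hu
      · obtain ⟨y', hy'⟩ : ∃ y : symbolicReesAlgebra P ⧸ p, Transcendental k y := by
          by_contra hcon
          exact halg ⟨fun y ↦ not_not.1 fun hy ↦ hcon ⟨y, hy⟩⟩
        obtain ⟨y, rfl⟩ := Ideal.Quotient.mkₐ_surjective k p y'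
        exact isJaffard_atPrime_of_transcendental P hd
          (lt_of_le_of_ne ((Ideal.span_singleton_le_iff_mem _).2 hu) hne) hy'
  · have := isNoetherianRing_atPrime_of_away (u := reesInv P) (B := A[T;T⁻¹]) p hu
    exact isJaffard_of_isNoetherianRing _

end Dimension

end SymbolicReesPrimes

/-! ### Heights of maximal ideals in polynomial rings. -/

section MvPolynomialHeight

/-- Polynomial rings over a field are Jacobson, so a maximal ideal contracts to a maximal ideal in
one variable fewer, and the height drops by exactly one. -/
lemma MvPolynomial.height_eq_of_isMaximal (K : Type*) [Field K] (n : ℕ) :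
    ∀ M : Ideal (MvPolynomial (Fin n) K), M.IsMaximal → M.height = n := by
  induction n with
  | zero =>
    intro M hM
    have h := Ideal.height_le_ringKrullDim_of_isPrime (I := M)
    rw [MvPolynomial.ringKrullDim_of_isNoetherianRing, ringKrullDim_eq_zero_of_field] at h
    have : (M.height : WithBot ℕ∞) ≤ ((0 : ℕ∞) : WithBot ℕ∞) := by simpa using h
    exact le_antisymm (WithBot.coe_le_coe.1 this) bot_le
  | succ n ih =>
    intro M hM
    let e := (MvPolynomial.finSuccEquiv K n).toRingEquiv
    have hmax : (M.map e).IsMaximal := Ideal.map_isMaximal_of_equiv e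
    have hcmax : ((M.map e).comap Polynomial.C).IsMaximal :=
      Polynomial.isMaximal_comap_C_of_isJacobsonRing (M.map e)
    have : (M.map e).LiesOver ((M.map e).comap Polynomial.C) := ⟨rfl⟩
    rw [← e.height_map M, Polynomial.height_eq_height_add_one ((M.map e).comap Polynomial.C) (M.map e),
      ih _ hcmax]
    norm_cast

end MvPolynomialHeight

/-! ### Factors of homogeneous polynomials. -/

section HomogeneousFactors

open MvPolynomial

variable {σ K : Type*} [Field K]

/-- The algebra map `G ↦ ∑ Gᵢ Tⁱ`, where `Gᵢ` is the homogeneous component of degree `i`. -/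
noncomputable def homogenizeHom (σ K : Type*) [Field K] :
    MvPolynomial σ K →ₐ[K] Polynomial (MvPolynomial σ K) :=
  aeval fun i ↦ Polynomial.C (X i) * Polynomial.X

lemma homogenizeHom_monomial (d : σ →₀ ℕ) (c : K) :
    homogenizeHom σ K (monomial d c) = Polynomial.C (monomial d c) * Polynomial.X ^ d.degree := by
  rw [homogenizeHom, aeval_monomial]
  simp_rw [mul_pow]
  rw [Finsupp.prod_mul, ← mul_assoc]
  congr 1
  · rw [monomial_eq (s := d) (a := c), map_mul]
    congr 1
    rw [Finsupp.prod, Finsupp.prod, map_prod]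
    simp_rw [map_pow]
  · rw [Finsupp.prod, Finset.prod_pow_eq_pow_sum]
    rfl

lemma homogenizeHom_of_isHomogeneous {n : ℕ} {G : MvPolynomial σ K} (h : G.IsHomogeneous n) :
    homogenizeHom σ K G = Polynomial.C G * Polynomial.X ^ n := by
  conv_lhs => rw [G.as_sum]
  conv_rhs => rw [G.as_sum]
  rw [map_sum, map_sum, Finset.sum_mul]
  refine Finset.sum_congr rfl fun d hd ↦ ?_
  rw [homogenizeHom_monomial, h.degree_eq_sum_deg_support hd]
  rfl

lemma coeff_homogenizeHom (G : MvPolynomial σ K) (n : ℕ) :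
    (homogenizeHom σ K G).coeff n = homogeneousComponent n G := by
  conv_lhs => rw [← sum_homogeneousComponent G]
  rw [map_sum, Polynomial.finsetSum_coeff]
  simp_rw [homogenizeHom_of_isHomogeneous (homogeneousComponent_isHomogeneous _ G),
    Polynomial.coeff_C_mul, Polynomial.coeff_X_pow, mul_ite, mul_one, mul_zero]
  rw [Finset.sum_ite_eq]
  split_ifs with h
  · rfl
  · rw [homogeneousComponent_eq_zero]
    simpa using h

/-- Factors of nonzero homogeneous polynomials over a field are homogeneous. -/
lemma MvPolynomial.IsHomogeneous.of_mul_left {n : ℕ} {G H : MvPolynomial σ K}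
    (h : (G * H).IsHomogeneous n) (h0 : G * H ≠ 0) : ∃ i, G.IsHomogeneous i := by
  have hG0 : G ≠ 0 := left_ne_zero_of_mul h0
  have hH0 : H ≠ 0 := right_ne_zero_of_mul h0
  have hinj {Q : MvPolynomial σ K} (hQ : Q ≠ 0) : homogenizeHom σ K Q ≠ 0 := by
    intro hz
    apply hQ
    rw [← sum_homogeneousComponent Q]
    refine Finset.sum_eq_zero fun i _ ↦ ?_
    rw [← coeff_homogenizeHom, hz, Polynomial.coeff_zero]
  have hm := homogenizeHom_of_isHomogeneous h
  rw [map_mul] at hm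
  -- The product becomes a single monomial in `T`. Degree and trailing degree are both additive, so
  -- they must agree for each factor.
  have h1 := Polynomial.natDegree_mul (hinj hG0) (hinj hH0)
  have h2 := Polynomial.natTrailingDegree_mul (hinj hG0) (hinj hH0)
  rw [hm, Polynomial.natDegree_C_mul_X_pow _ _ h0] at h1
  rw [hm, Polynomial.C_mul_X_pow_eq_monomial, Polynomial.natTrailingDegree_monomial h0] at h2
  have h3 := Polynomial.natTrailingDegree_le_natDegree (homogenizeHom σ K G)
  have h4 := Polynomial.natTrailingDegree_le_natDegree (homogenizeHom σ K H)
  refine ⟨(homogenizeHom σ K G).natDegree, ?_⟩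
  have h5 : G = homogeneousComponent (homogenizeHom σ K G).natDegree G := by
    conv_lhs => rw [← sum_homogeneousComponent G]
    apply Finset.sum_eq_single
    · intro j _ hj
      rw [← coeff_homogenizeHom]
      rcases lt_or_gt_of_ne hj with hlt | hgt
      · exact Polynomial.coeff_eq_zero_of_lt_natTrailingDegree (by omega)
      · exact Polynomial.coeff_eq_zero_of_natDegree_lt hgt
    · intro hmem
      apply homogeneousComponent_eq_zero
      simpa using hmem
  have h6 := homogeneousComponent_isHomogeneous (homogenizeHom σ K G).natDegree G
  rwa [← h5] at h6

end HomogeneousFactors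

/-! ### Irreducibility of a nonsingular cubic. -/

section Irreducibility

open MvPolynomial

lemma IsNonsingularCubic.ne_zero {F : MvPolynomial (Fin 3) ℂ} (hF : IsNonsingularCubic F) :
    F ≠ 0 := by
  rintro rfl
  obtain ⟨i, hi⟩ := hF.nonsingular (fun _ ↦ 1) (fun h ↦ one_ne_zero (congrFun h 0)) (map_zero _)
  simp at hi

/-- The ideal of polynomials vanishing at a point has height the number of variables. -/
lemma height_vanishingIdeal_singleton (v : Fin 3 → ℂ) :
    (vanishingIdeal ℂ ({v} : Set (Fin 3 → ℂ))).height = 3 :=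
  MvPolynomial.height_eq_of_isMaximal ℂ 3 _ inferInstance

/-- Two polynomials in three variables vanishing at the origin have another common zero. -/
lemma exists_common_zero {G H : MvPolynomial (Fin 3) ℂ} (hG : eval 0 G = 0) (hH : eval 0 H = 0) :
    ∃ v : Fin 3 → ℂ, v ≠ 0 ∧ eval v G = 0 ∧ eval v H = 0 := by
  -- Were the origin the only common zero, its maximal ideal would be minimal over `(G, H)`, hence
  -- of height at most two by Krull's height theorem; but its height is three.
  by_contra! hcon
  set I : Ideal (MvPolynomial (Fin 3) ℂ) := Ideal.span {G, H} with hI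
  set m := vanishingIdeal ℂ ({0} : Set (Fin 3 → ℂ)) with hm
  have hmmax : m.IsMaximal := inferInstance
  have hIm : I ≤ m := by
    rw [hI, Ideal.span_le]
    rintro g (rfl | rfl)
    · exact (mem_vanishingIdeal_singleton_iff _ _).2 (by simpa [aeval_eq_eval] using hG)
    · exact (mem_vanishingIdeal_singleton_iff _ _).2 (by simpa [aeval_eq_eval] using hH)
  have hrad : m ≤ I.radical := by
    rw [← vanishingIdeal_zeroLocus_eq_radical (K := ℂ)]
    apply vanishingIdeal_anti_mono
    intro v hv
    rw [mem_zeroLocus_iff] at hv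
    by_contra hv0
    have h1 := hv G (Ideal.subset_span (Or.inl rfl))
    have h2 := hv H (Ideal.subset_span (Or.inr rfl))
    exact hcon v hv0 (by simpa [aeval_eq_eval] using h1) (by simpa [aeval_eq_eval] using h2)
  have hmin : m ∈ I.minimalPrimes := by
    refine ⟨⟨hmmax.isPrime, hIm⟩, fun q hq hqm ↦ ?_⟩
    exact hrad.trans (hq.1.radical_le_iff.2 hq.2)
  have h := Ideal.height_le_card_of_mem_minimalPrimes_span (Set.toFinite {G, H}) hmin
  rw [height_vanishingIdeal_singleton] at h
  have h2 : ({G, H} : Set (MvPolynomial (Fin 3) ℂ)).ncard ≤ 2 := Set.ncard_insert_le _ _ |>.trans (by simp)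
  have h3 : ((3 : ℕ) : ℕ∞) ≤ (2 : ℕ) := h.trans (by exact_mod_cast h2)
  exact absurd (Nat.cast_le.1 h3) (by norm_num)

/-- Both factors of a nontrivial factorization are homogeneous and vanish at the origin, so they
share a nonzero zero; by the product rule it is a singular point. -/
theorem IsNonsingularCubic.irreducible {F : MvPolynomial (Fin 3) ℂ} (hF : IsNonsingularCubic F) :
    Irreducible F := by
  have hnu {i : ℕ} {G : MvPolynomial (Fin 3) ℂ} (hG : G.IsHomogeneous i) (h0 : G ≠ 0)
      (hu : ¬ IsUnit G) : eval 0 G = 0 := by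
    rw [eval_zero, constantCoeff_eq]
    apply hG.coeff_eq_zero
    rintro hi
    obtain rfl : 0 = i := by simpa using hi
    obtain ⟨c, rfl⟩ : ∃ c, G = C c :=
      ⟨_, totalDegree_eq_zero_iff_eq_C.1 ((totalDegree_zero_iff_isHomogeneous _).2 hG)⟩
    have hc : c ≠ 0 := fun hc ↦ h0 (by rw [hc, map_zero])
    exact hu ((isUnit_iff_ne_zero.2 hc).map C)
  refine ⟨fun hu ↦ ?_, fun G H hGH ↦ ?_⟩
  · have h1 := (isUnit_iff_totalDegree_of_isReduced.1 hu).2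
    rw [hF.isHomogeneous.totalDegree hF.ne_zero] at h1
    exact absurd h1 (by norm_num)
  · by_contra! hcon
    have h0 : G * H ≠ 0 := hGH ▸ hF.ne_zero
    have hhom : (G * H).IsHomogeneous 3 := hGH ▸ hF.isHomogeneous
    obtain ⟨i, hi⟩ := hhom.of_mul_left h0
    obtain ⟨j, hj⟩ := IsHomogeneous.of_mul_left (G := H) (H := G) (mul_comm G H ▸ hhom)
      (mul_comm G H ▸ h0)
    obtain ⟨v, hv, hGv, hHv⟩ := exists_common_zero (hnu hi (left_ne_zero_of_mul h0) hcon.1)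
      (hnu hj (right_ne_zero_of_mul h0) hcon.2)
    obtain ⟨l, hl⟩ := hF.nonsingular v hv (by rw [hGH, map_mul, hGv, zero_mul])
    apply hl
    rw [hGH, Derivation.leibniz, smul_eq_mul, smul_eq_mul, map_add, map_mul, map_mul, hGv, hHv]
    ring

end Irreducibility


/-! ### The coordinate ring: domain, transcendence degree, height-one primes. -/

section CoordinateRing

open MvPolynomial

variable {F : MvPolynomial (Fin 3) ℂ}

theorem IsNonsingularCubic.isDomain (hF : IsNonsingularCubic F) :
    IsDomain (HomogeneousCoordinateRing F) :=
  (Ideal.Quotient.isDomain_iff_prime _).2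
    ((Ideal.span_singleton_prime hF.ne_zero).2 hF.irreducible.prime)

theorem IsNonsingularCubic.trdeg_le (hF : IsNonsingularCubic F) :
    Algebra.trdeg ℂ (HomogeneousCoordinateRing F) ≤ 2 := by
  have hp : (Ideal.span {F}).IsPrime :=
    (Ideal.span_singleton_prime hF.ne_zero).2 hF.irreducible.prime
  have h3 : Algebra.trdeg ℂ (MvPolynomial (Fin 3) ℂ) ≤ ((2 + 1 : ℕ) : Cardinal) := by
    rw [MvPolynomial.trdeg_of_isDomain]
    simp
  exact_mod_cast trdeg_quotient_le h3 (p := Ideal.span {F})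
    (by simpa [Ideal.span_singleton_eq_bot] using hF.ne_zero)

/-- The preimage in three variables has height three, and dividing by one element lowers the height
by at most one. Consequently a height-one prime is not maximal. -/
lemma two_le_height_of_isMaximal (M : Ideal (HomogeneousCoordinateRing F)) (hM : M.IsMaximal) :
    2 ≤ M.height := by
  have hmax : (M.comap (Ideal.Quotient.mk (Ideal.span {F}))).IsMaximal :=
    Ideal.comap_isMaximal_of_surjective _ Ideal.Quotient.mk_surjective
  have h1 := MvPolynomial.height_eq_of_isMaximal ℂ 3 _ hmax
  have hmem : F ∈ M.comap (Ideal.Quotient.mk (Ideal.span {F})) := by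
    rw [Ideal.mem_comap, Ideal.Quotient.eq_zero_iff_mem.2 (Ideal.mem_span_singleton_self F)]
    exact M.zero_mem
  have h2 := Ideal.height_le_height_add_one_of_mem hmem
  rw [Ideal.map_comap_of_surjective _ Ideal.Quotient.mk_surjective M, h1] at h2
  have h5 : (2 : ℕ∞) + 1 ≤ M.height + 1 := by
    convert h2 using 1
    norm_num
  exact (ENat.add_le_add_iff_right ENat.one_ne_top).1 h5

/-- A height one prime of a Noetherian integrally closed domain has a discrete valuation ring as
its localization. -/
theorem isDiscreteValuationRing_atPrime_of_height_eq_one {B : Type*} [CommRing B] [IsDomain B]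
    [IsNoetherianRing B] [IsIntegrallyClosed B] (P : Ideal B) [P.IsPrime] (hP : P.height = 1) :
    IsDiscreteValuationRing (Localization.AtPrime P) := by
  have h0 : P ≠ ⊥ := by
    rintro rfl
    rw [Ideal.height_bot] at hP
    exact zero_ne_one hP
  have hf : ¬ IsField (Localization.AtPrime P) := by
    rw [IsLocalRing.isField_iff_maximalIdeal_eq]
    intro h
    rw [← Localization.AtPrime.under_maximalIdeal (I := P), h] at h0
    exact h0 (Ideal.comap_bot_of_injective _ (IsLocalization.injective _ P.primeCompl_le_nonZeroDivisors))
  have : IsIntegrallyClosed (Localization.AtPrime P) :=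
    isIntegrallyClosed_of_isLocalization _ P.primeCompl P.primeCompl_le_nonZeroDivisors
  have hz : IsLocalRing.maximalIdeal (Localization.AtPrime P) ≠ ⊥ :=
    fun h ↦ hf (IsLocalRing.isField_iff_maximalIdeal_eq.2 h)
  have hone : (IsLocalRing.maximalIdeal (Localization.AtPrime P)).height = 1 := by
    have h1 := IsLocalRing.maximalIdeal_height_eq_ringKrullDim (R := Localization.AtPrime P)
    rw [IsLocalization.AtPrime.ringKrullDim_eq_height P, hP] at h1
    exact WithBot.coe_injective h1
  have hP : (IsLocalRing.maximalIdeal (Localization.AtPrime P)).IsPrime := inferInstance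
  refine ((IsDiscreteValuationRing.TFAE (Localization.AtPrime P) hf).out 0 3).2 ?_
  refine ⟨this, _, ⟨hz, hP⟩, ?_⟩
  rintro Q ⟨hQ0, hQ⟩
  refine (IsLocalRing.le_maximalIdeal hQ.ne_top).eq_or_lt.resolve_right fun hlt ↦ hQ0 ?_
  have h1 := Ideal.height_strict_mono_of_isPrime hlt
  rw [hone, Order.lt_one_iff, Ideal.height_eq_zero_iff,
    IsDomain.minimalPrimes_eq_singleton_bot] at h1
  exact h1

end CoordinateRing

/-! ### Conductors of monogenic extensions and coprime denominators. -/

section Monogenic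

open Polynomial

/-- The derivative of a monic polynomial at a root `y` multiplies integral elements into `R₀[y]`. -/
theorem aeval_derivative_mul_mem_adjoin {R₀ : Type*} (K : Type*) {L : Type*}
    [CommRing R₀] [IsDomain R₀] [IsIntegrallyClosed R₀] [Field K] [CharZero K] [Algebra R₀ K]
    [IsFractionRing R₀ K] [Field L] [Algebra K L] [Algebra R₀ L] [IsScalarTower R₀ K L]
    [FiniteDimensional K L] {y : L} (htop : Algebra.adjoin K {y} = ⊤) {p : R₀[X]} (hp : p.Monic)
    (hpy : aeval y p = 0) {z : L} (hz : IsIntegral R₀ z) :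
    aeval y (derivative p) * z ∈ Algebra.adjoin R₀ {y} := by
  have hyi : IsIntegral R₀ y := ⟨p, hp, hpy⟩
  have hinj : Function.Injective (algebraMap R₀ L) := by
    rw [IsScalarTower.algebraMap_eq R₀ K L]
    exact (algebraMap K L).injective.comp (IsFractionRing.injective R₀ K)
  have : FaithfulSMul R₀ L := (faithfulSMul_iff_algebraMap_injective R₀ L).2 hinj
  -- Traces of integral elements lie in `R₀`, so `z` is in the trace dual of `R₀[y]`, which by
  -- Euler's formula is `R₀[y]` divided by the derivative at `y` of the minimal polynomial.
  have hzmem : z ∈ (Algebra.traceForm K L).dualSubmodule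
      (Subalgebra.toSubmodule (Algebra.adjoin R₀ {y})) := by
    rw [LinearMap.BilinForm.mem_dualSubmodule]
    intro w hw
    have hwi : IsIntegral R₀ w := IsIntegral.of_mem_of_fg _ hyi.fg_adjoin_singleton w hw
    rw [Submodule.mem_one, Algebra.traceForm_apply]
    exact IsIntegrallyClosed.isIntegral_iff.1 (Algebra.isIntegral_trace (hz.mul hwi))
  rw [traceForm_dualSubmodule_adjoin R₀ K htop hyi,
    Submodule.mem_smul_pointwise_iff_exists] at hzmem
  obtain ⟨w, hw, rfl⟩ := hzmem
  -- At the root `y`, the derivative of `p` is that of the minimal polynomial times the value of the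
  -- cofactor `q`.
  obtain ⟨q, hq⟩ := minpoly.isIntegrallyClosed_dvd hyi hpy
  have hmin : aeval y (derivative (minpoly K y)) = aeval y (derivative (minpoly R₀ y)) := by
    rw [minpoly.isIntegrallyClosed_eq_field_fractions' K hyi, derivative_map, aeval_map_algebraMap]
  have hne : aeval y (derivative (minpoly K y)) ≠ 0 :=
    (Algebra.IsSeparable.isSeparable K y).aeval_derivative_ne_zero (minpoly.aeval K y)
  rw [hq, derivative_mul, map_add, map_mul, map_mul, minpoly.aeval, zero_mul, add_zero,
    ← hmin, smul_eq_mul, mul_comm (aeval y (derivative (minpoly K y))), mul_assoc,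
    mul_inv_cancel_left₀ hne]
  refine mul_mem ?_ hw
  rw [Algebra.adjoin_singleton_eq_range_aeval]
  exact ⟨q, rfl⟩

lemma adjoin_algebraMap_eq_top {R₀ B : Type*} (K : Type*) (L : Type*)
    [CommRing R₀] [CommRing B] [IsDomain B]
    [Algebra R₀ B] [Field K] [Algebra R₀ K] [Field L] [Algebra B L]
    [IsFractionRing B L] [Algebra K L] [Algebra R₀ L] [IsScalarTower R₀ B L] [IsScalarTower R₀ K L]
    {x : B} (hx : Algebra.adjoin R₀ {x} = ⊤) (hxi : IsIntegral R₀ x) :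
    Algebra.adjoin K {algebraMap B L x} = ⊤ := by
  set y : L := algebraMap B L x
  have hyK : IsIntegral K y := (hxi.algebraMap (B := L)).tower_top
  have hmem (b : B) : algebraMap B L b ∈ Algebra.adjoin K {y} := by
    have hb : b ∈ Algebra.adjoin R₀ {x} := hx ▸ Algebra.mem_top
    rw [Algebra.adjoin_singleton_eq_range_aeval] at hb ⊢
    obtain ⟨q, rfl⟩ := hb
    exact ⟨q.map (algebraMap R₀ K), (aeval_map_algebraMap K y q).trans
      (aeval_algebraMap_apply L x q)⟩
  refine top_le_iff.1 fun w _ ↦ ?_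
  obtain ⟨a, b, hb, rfl⟩ := IsFractionRing.div_surjective (A := B) w
  rw [div_eq_mul_inv]
  exact mul_mem (hmem a) ((Algebra.adjoin K {y}).inv_mem_of_algebraic
    (x := ⟨_, hmem b⟩) (IsIntegral.of_mem_of_fg _ hyK.fg_adjoin_singleton _ (hmem b)).isAlgebraic)

/-- If `B = R₀[x]` with `p(x) = 0` and `p` monic, then `p'(x)` multiplies every element of the
fraction field of `B` that is integral over `R₀` into `B`. -/
theorem exists_algebraMap_eq_aeval_derivative_mul {R₀ B : Type*} [CommRing R₀] [IsDomain R₀]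
    [IsIntegrallyClosed R₀] [CharZero R₀] [CommRing B] [IsDomain B] [Algebra R₀ B]
    [FaithfulSMul R₀ B] {x : B} (hx : Algebra.adjoin R₀ {x} = ⊤) {p : R₀[X]} (hp : p.Monic)
    (hpx : aeval x p = 0) {z : FractionRing B} (hz : IsIntegral R₀ z) :
    ∃ b : B, algebraMap B (FractionRing B) b =
      algebraMap B (FractionRing B) (aeval x (derivative p)) * z := by
  let := FractionRing.liftAlgebra R₀ (FractionRing B)
  have := FractionRing.isScalarTower_liftAlgebra R₀ (FractionRing B)
  have htop := adjoin_algebraMap_eq_top (FractionRing R₀) (FractionRing B) hx ⟨p, hp, hpx⟩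
  have haeval (q : R₀[X]) := aeval_algebraMap_apply (FractionRing B) x q
  have hi : IsIntegral (FractionRing R₀) (algebraMap B (FractionRing B) x) :=
    (IsIntegral.algebraMap (B := FractionRing B) ⟨p, hp, hpx⟩).tower_top
  have hfd : FiniteDimensional (FractionRing R₀) (FractionRing B) := by
    have hfg := hi.fg_adjoin_singleton
    rw [htop] at hfg
    exact ⟨hfg⟩
  have h := aeval_derivative_mul_mem_adjoin (FractionRing R₀) htop hp
    (by rw [haeval, hpx, map_zero]) hz
  rw [Algebra.adjoin_singleton_eq_range_aeval] at h
  obtain ⟨q, hq⟩ := h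
  exact ⟨aeval x q, (haeval q).symm.trans (hq.trans (by rw [haeval]))⟩

/-- If `B` is free over `R₀` and `s`, `t` are relatively prime in `R₀`, then an element of the
fraction field of `B` multiplied into `B` by `s` and `t` lies in `B`. -/
theorem exists_algebraMap_eq_of_isRelPrime {R₀ B : Type*} [CommRing R₀] [IsDomain R₀]
    [DecompositionMonoid R₀] [CommRing B] [IsDomain B] [Algebra R₀ B] [FaithfulSMul R₀ B]
    [Module.Free R₀ B] {s t : R₀} (hs : s ≠ 0) (hst : IsRelPrime s t) {z : FractionRing B} {b c : B}
    (hb : algebraMap B (FractionRing B) b = algebraMap B _ (algebraMap R₀ B s) * z)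
    (hc : algebraMap B (FractionRing B) c = algebraMap B _ (algebraMap R₀ B t) * z) :
    ∃ a : B, algebraMap B (FractionRing B) a = z := by
  have hs' : algebraMap R₀ B s ≠ 0 := by
    simpa using (FaithfulSMul.algebraMap_injective R₀ B).ne hs
  have h : t • b = s • c := by
    apply IsFractionRing.injective B (FractionRing B)
    rw [Algebra.smul_def, Algebra.smul_def, map_mul, map_mul, hb, hc]
    ring
  let e := Module.Free.chooseBasis R₀ B
  -- In coordinates, `t bᵢ = s cᵢ`, and coprimality makes `s` divide every `bᵢ`.
  have hdvd (i) : s ∣ e.repr b i := by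
    have h1 := congrArg (fun w ↦ e.repr w i) h
    simp only [map_smul, Finsupp.smul_apply, smul_eq_mul] at h1
    exact hst.dvd_of_dvd_mul_left ⟨_, h1⟩
  choose f hf using hdvd
  have hbs : b = s • ∑ i ∈ (e.repr b).support, f i • e i := by
    conv_lhs => rw [← e.linearCombination_repr b, Finsupp.linearCombination_apply, Finsupp.sum]
    rw [Finset.smul_sum]
    exact Finset.sum_congr rfl fun i _ ↦ by rw [hf i, mul_smul]
  refine ⟨∑ i ∈ (e.repr b).support, f i • e i, mul_left_cancel₀ ((map_ne_zero_iff _ (IsFractionRing.injective B _)).2 hs')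
    (Eq.trans ?_ hb)⟩
  rw [← map_mul, ← Algebra.smul_def, ← hbs]

end Monogenic

/-! ### Change of coordinates adapted to a projection centre. -/

section Shear

open MvPolynomial

lemma MvPolynomial.IsHomogeneous.eval_smul {σ K : Type*} [CommRing K] {n : ℕ}
    {G : MvPolynomial σ K} (hG : G.IsHomogeneous n) (c : K) (v : σ → K) :
    eval (c • v) G = c ^ n * eval v G := by
  rw [eval_eq, eval_eq, Finset.mul_sum]
  refine Finset.sum_congr rfl fun d hd ↦ ?_
  simp_rw [Pi.smul_apply, smul_eq_mul, mul_pow]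
  rw [Finset.prod_mul_distrib, Finset.prod_pow_eq_pow_sum, hG.degree_eq_sum_deg_support hd]
  change _ * (c ^ d.degree * _) = c ^ d.degree * _
  ring

/-- The change of coordinates `X₀ ↦ T`, `X₁ ↦ Y₀ + b T`, `X₂ ↦ Y₁ + c T`. -/
noncomputable def shearHom (b c : ℂ) :
    MvPolynomial (Fin 3) ℂ →ₐ[ℂ] Polynomial (MvPolynomial (Fin 2) ℂ) :=
  aeval ![Polynomial.X, Polynomial.C (X 0) + Polynomial.C (C b) * Polynomial.X,
    Polynomial.C (X 1) + Polynomial.C (C c) * Polynomial.X]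

lemma shearHom_X_natDegree_coeff (b c : ℂ) (i : Fin 3) :
    (shearHom b c (X i)).natDegree ≤ 1 ∧ (shearHom b c (X i)).coeff 1 = C ((![1, b, c] : Fin 3 → ℂ) i) := by
  rw [shearHom, aeval_X]
  fin_cases i
  · simp
  · refine ⟨?_, by simp⟩
    simp only [Fin.mk_one, Matrix.cons_val_one, Matrix.cons_val_zero]
    compute_degree
  · refine ⟨?_, by simp⟩
    simp only [Fin.reduceFinMk, Matrix.cons_val]
    compute_degree

/-- The top coefficient in `T` is the value at the centre `(1, b, c)`; hence a centre off the curve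
makes `F` monic in `T` up to a scalar. -/
lemma MvPolynomial.IsHomogeneous.shearHom_natDegree_coeff {n : ℕ} {G : MvPolynomial (Fin 3) ℂ}
    (hG : G.IsHomogeneous n) (b c : ℂ) :
    (shearHom b c G).natDegree ≤ n ∧ (shearHom b c G).coeff n = C (eval ![1, b, c] G) := by
  have hmon (d : Fin 3 →₀ ℕ) (a : ℂ) : (shearHom b c (monomial d a)).natDegree ≤ d.degree ∧
      (shearHom b c (monomial d a)).coeff d.degree = C (eval ![1, b, c] (monomial d a)) := by
    have h (i : Fin 3) := shearHom_X_natDegree_coeff b c i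
    have h1 (i : Fin 3) : (shearHom b c (X i) ^ d i).natDegree ≤ d i :=
      (Polynomial.natDegree_pow_le_of_le _ (h i).1).trans (mul_one _).le
    have h2 (i : Fin 3) : (shearHom b c (X i) ^ d i).coeff (d i) =
        C ((![1, b, c] : Fin 3 → ℂ) i ^ d i) := by
      have := Polynomial.coeff_pow_of_natDegree_le (m := d i) (h i).1
      rwa [mul_one, (h i).2, ← map_pow C] at this
    have h01 : (shearHom b c (X 0) ^ d 0 * shearHom b c (X 1) ^ d 1).natDegree ≤ d 0 + d 1 :=
      Polynomial.natDegree_mul_le_of_le (h1 0) (h1 1)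
    have hdeg : d.degree = d 0 + d 1 + d 2 := by
      rw [Finsupp.degree_eq_sum, Fin.sum_univ_three]
    have heq : shearHom b c (monomial d a) = Polynomial.C (C a) *
        (shearHom b c (X 0) ^ d 0 * shearHom b c (X 1) ^ d 1 * shearHom b c (X 2) ^ d 2) := by
      rw [monomial_eq, map_mul, Finsupp.prod_fintype _ _ (by simp), Fin.prod_univ_three]
      simp [shearHom]
    rw [heq, hdeg, Polynomial.coeff_C_mul]
    refine ⟨(Polynomial.natDegree_C_mul_le _ _).trans
      (Polynomial.natDegree_mul_le_of_le h01 (h1 2)), ?_⟩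
    rw [Polynomial.coeff_mul_add_eq_of_natDegree_le h01 (h1 2),
      Polynomial.coeff_mul_add_eq_of_natDegree_le (h1 0) (h1 1), h2, h2, h2, eval_monomial,
      Finsupp.prod_fintype _ _ (by simp), Fin.prod_univ_three]
    simp only [map_mul]
  rw [G.as_sum, map_sum, map_sum, Polynomial.finsetSum_coeff, map_sum]
  constructor
  · refine Polynomial.natDegree_sum_le_of_forall_le _ _ fun d hd ↦ ?_
    rw [hG.degree_eq_sum_deg_support hd]
    exact (hmon d _).1
  · refine Finset.sum_congr rfl fun d hd ↦ ?_
    rw [hG.degree_eq_sum_deg_support hd]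
    exact (hmon d _).2

lemma derivative_shearHom (b c : ℂ) (G : MvPolynomial (Fin 3) ℂ) :
    Polynomial.derivative (shearHom b c G) =
      shearHom b c (pderiv 0 G + C b * pderiv 1 G + C c * pderiv 2 G) := by
  induction G using MvPolynomial.induction_on with
  | C a => simp [shearHom]
  | add p q hp hq =>
    rw [map_add, map_add, hp, hq, ← map_add]
    congr 1
    simp only [map_add]
    ring
  | mul_X p i hp =>
    rw [map_mul, Polynomial.derivative_mul, hp]
    simp only [Derivation.leibniz, smul_eq_mul, map_add, map_mul]
    fin_cases i <;> simp [shearHom, pderiv_X] <;> ring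

end Shear

/-! ### Normality of the homogeneous coordinate ring. -/

section Normality

open MvPolynomial

variable {F : MvPolynomial (Fin 3) ℂ}

/-- The inclusion `Y₀ ↦ X₁ - b X₀`, `Y₁ ↦ X₂ - c X₀` of a polynomial ring in two variables. -/
noncomputable def linearProjectionHom (b c : ℂ) :
    MvPolynomial (Fin 2) ℂ →ₐ[ℂ] MvPolynomial (Fin 3) ℂ :=
  aeval ![X 1 - C b * X 0, X 2 - C c * X 0]

lemma eval₂_shearHom (b c : ℂ) (G : MvPolynomial (Fin 3) ℂ) :
    (shearHom b c G).eval₂ (linearProjectionHom b c : _ →+* _) (X 0) = G := by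
  have : (Polynomial.eval₂RingHom (linearProjectionHom b c : _ →+* _) (X 0)).comp
      (shearHom b c : MvPolynomial (Fin 3) ℂ →+* Polynomial (MvPolynomial (Fin 2) ℂ)) = RingHom.id _ := by
    apply MvPolynomial.ringHom_ext
    · intro r
      simp [shearHom, linearProjectionHom]
    · intro i
      fin_cases i <;> simp [shearHom, linearProjectionHom]
  exact RingHom.congr_fun this G

lemma shearHom_linearProjectionHom (b c : ℂ) (r : MvPolynomial (Fin 2) ℂ) :
    shearHom b c (linearProjectionHom b c r) = Polynomial.C r := by
  have : ((shearHom b c).comp (linearProjectionHom b c) : MvPolynomial (Fin 2) ℂ →+* _) = Polynomial.C := by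
    apply MvPolynomial.ringHom_ext
    · intro r
      simp [shearHom, linearProjectionHom]
    · intro i
      fin_cases i <;> simp [shearHom, linearProjectionHom]
  exact RingHom.congr_fun this r

/-- Projection away from a point `(1, b, c)` off the curve is dominant. -/
theorem linearProjection_injective (hF : IsNonsingularCubic F) {b c : ℂ}
    (hbc : eval ![1, b, c] F ≠ 0) :
    Function.Injective ((Ideal.Quotient.mkₐ ℂ (Ideal.span {F})).comp (linearProjectionHom b c)) := by
  rw [injective_iff_map_eq_zero]
  intro r hr
  rw [AlgHom.comp_apply, Ideal.Quotient.mkₐ_eq_mk, Ideal.Quotient.eq_zero_iff_mem,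
    Ideal.mem_span_singleton] at hr
  obtain ⟨H, hH⟩ := hr
  have h := congrArg (shearHom b c) hH
  rw [shearHom_linearProjectionHom, map_mul] at h
  obtain ⟨h1, h2⟩ := hF.isHomogeneous.shearHom_natDegree_coeff b c
  -- A nonzero multiple of `F` has degree at least three in `T`, while `r` has degree zero.
  by_contra hr0
  have hz : Polynomial.C r ≠ 0 := Polynomial.C_ne_zero.2 hr0
  rw [h] at hz
  have h3 := congrArg Polynomial.natDegree h
  rw [Polynomial.natDegree_C, Polynomial.natDegree_mul (left_ne_zero_of_mul hz)
    (right_ne_zero_of_mul hz)] at h3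
  have h4 : 3 ≤ (shearHom b c F).natDegree := by
    apply Polynomial.le_natDegree_of_ne_zero
    rw [h2]
    simpa using hbc
  omega

/-- The conductor of `z`, pulled back to the polynomial ring. -/
def conductorIdeal (F : MvPolynomial (Fin 3) ℂ) [IsDomain (HomogeneousCoordinateRing F)]
    (z : FractionRing (HomogeneousCoordinateRing F)) : Ideal (MvPolynomial (Fin 3) ℂ) where
  carrier := {G | ∃ a : HomogeneousCoordinateRing F, algebraMap _ _ a =
    algebraMap _ (FractionRing (HomogeneousCoordinateRing F)) (Ideal.Quotient.mk (Ideal.span {F}) G) * z}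
  add_mem' := by
    rintro G H ⟨a, ha⟩ ⟨b, hb⟩
    exact ⟨a + b, by rw [map_add, ha, hb, map_add, map_add, add_mul]⟩
  zero_mem' := ⟨0, by simp⟩
  smul_mem' := by
    rintro c G ⟨a, ha⟩
    exact ⟨Ideal.Quotient.mk (Ideal.span {F}) c * a, by rw [map_mul, ha, smul_eq_mul, map_mul, map_mul, mul_assoc]⟩

/-- Since the coordinate ring is free and monogenic over the polynomial ring of a projection away
from a point off the curve, the conductor of an integral element contains a directional derivative
of `F`, and such an element lies in the ring if two coprime powers multiply it into the ring. -/
theorem conductorIdeal_of_eval_ne_zero (hF : IsNonsingularCubic F) [IsDomain (HomogeneousCoordinateRing F)] {b c : ℂ}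
    (hbc : eval ![1, b, c] F ≠ 0) {z : FractionRing (HomogeneousCoordinateRing F)}
    (hz : IsIntegral (HomogeneousCoordinateRing F) z) :
    pderiv 0 F + C b * pderiv 1 F + C c * pderiv 2 F ∈ conductorIdeal F z ∧
    ∀ m n : ℕ, (X 1 - C b * X 0) ^ m ∈ conductorIdeal F z →
      (X 2 - C c * X 0) ^ n ∈ conductorIdeal F z →
      ∃ a : HomogeneousCoordinateRing F, algebraMap _ _ a = z := by
  let φ := (Ideal.Quotient.mkₐ ℂ (Ideal.span {F})).comp (linearProjectionHom b c)
  have hinj : Function.Injective φ := linearProjection_injective hF hbc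
  let : Algebra (MvPolynomial (Fin 2) ℂ) (HomogeneousCoordinateRing F) := φ.toRingHom.toAlgebra
  let : Module (MvPolynomial (Fin 2) ℂ) (HomogeneousCoordinateRing F) := Algebra.toModule
  have halg (r : MvPolynomial (Fin 2) ℂ) : algebraMap _ (HomogeneousCoordinateRing F) r =
    Ideal.Quotient.mk _ (linearProjectionHom b c r) := rfl
  have : FaithfulSMul (MvPolynomial (Fin 2) ℂ) (HomogeneousCoordinateRing F) :=
    (faithfulSMul_iff_algebraMap_injective _ _).2 hinj
  let x : HomogeneousCoordinateRing F := Ideal.Quotient.mk _ (X 0)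
  have hev (G : MvPolynomial (Fin 3) ℂ) :
      Polynomial.aeval x (shearHom b c G) = Ideal.Quotient.mk (Ideal.span {F}) G := by
    conv_rhs => rw [← eval₂_shearHom b c G, Polynomial.hom_eval₂]
    rfl
  have hadj : Algebra.adjoin (MvPolynomial (Fin 2) ℂ) {x} = ⊤ := by
    refine top_le_iff.1 fun a _ ↦ ?_
    obtain ⟨G, rfl⟩ := Ideal.Quotient.mk_surjective a
    rw [← hev]
    exact Polynomial.aeval_mem_adjoin_singleton _ _
  obtain ⟨h1, h2⟩ := hF.isHomogeneous.shearHom_natDegree_coeff b c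
  set u := (eval ![1, b, c] F)⁻¹ with hu
  let p : Polynomial (MvPolynomial (Fin 2) ℂ) := Polynomial.C (C u) * shearHom b c F
  have hp : p.Monic := by
    refine Polynomial.monic_of_natDegree_le_of_coeff_eq_one 3
      ((Polynomial.natDegree_C_mul_le _ _).trans h1) ?_
    rw [Polynomial.coeff_C_mul, h2, ← map_mul, hu, inv_mul_cancel₀ hbc, map_one]
  have hpx : Polynomial.aeval x p = 0 := by
    rw [map_mul, hev, Ideal.Quotient.eq_zero_iff_mem.2 (Ideal.mem_span_singleton_self F), mul_zero]
  have hxi : IsIntegral (MvPolynomial (Fin 2) ℂ) x := ⟨p, hp, hpx⟩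
  have hint : Algebra.IsIntegral (MvPolynomial (Fin 2) ℂ) (HomogeneousCoordinateRing F) := by
    refine ⟨fun a ↦ IsIntegral.of_mem_of_fg _ hxi.fg_adjoin_singleton a ?_⟩
    rw [hadj]
    trivial
  have hzi : IsIntegral (MvPolynomial (Fin 2) ℂ) z := isIntegral_trans z hz
  have hchar : CharZero (MvPolynomial (Fin 2) ℂ) := inferInstance
  constructor
  · obtain ⟨a, ha⟩ := exists_algebraMap_eq_aeval_derivative_mul hadj hp hpx hzi
    have h3 : C u * (pderiv 0 F + C b * pderiv 1 F + C c * pderiv 2 F) ∈ conductorIdeal F z := by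
      refine ⟨a, ?_⟩
      rw [ha, Polynomial.derivative_C_mul, derivative_shearHom, map_mul, hev, Polynomial.aeval_C,
        halg, ← map_mul, linearProjectionHom, aeval_C, MvPolynomial.algebraMap_apply]
      rfl
    have h4 := (conductorIdeal F z).mul_mem_left (C (eval ![1, b, c] F)) h3
    rwa [← mul_assoc, ← map_mul, hu, mul_inv_cancel₀ hbc, map_one, one_mul] at h4
  · rintro m n ⟨a, ha⟩ ⟨d, hd⟩
    have hfree : Module.Free (MvPolynomial (Fin 2) ℂ) (HomogeneousCoordinateRing F) := by
      let e := (Subalgebra.equivOfEq _ _ hadj).trans Subalgebra.topEquiv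
      exact Module.Free.of_basis
        ((Algebra.adjoin.powerBasis' hxi).basis.map e.toLinearEquiv)
    have hrel : IsRelPrime (X 0 : MvPolynomial (Fin 2) ℂ) (X 1) :=
      (Irreducible.isRelPrime_iff_not_dvd (X_prime (i := 0)).irreducible).2
        (by rw [X_dvd_X]; exact zero_ne_one)
    refine exists_algebraMap_eq_of_isRelPrime (s := (X 0 : MvPolynomial (Fin 2) ℂ) ^ m)
      (t := X 1 ^ n) (pow_ne_zero _ (X_ne_zero _)) hrel.pow (b := a) (c := d) ?_ ?_
    · rw [ha, halg, map_pow (linearProjectionHom b c), linearProjectionHom, aeval_X]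
      rfl
    · rw [hd, halg, map_pow (linearProjectionHom b c), linearProjectionHom, aeval_X]
      rfl

/-- Restricted to the line, `G` is a polynomial in `s` that is nonzero at `0`; the extra factor `X`
in the proof rules out `s = 0`. It serves to move the projection centre along a coordinate axis. -/
lemma exists_eval_ne_zero_add {G : MvPolynomial (Fin 3) ℂ} {v : Fin 3 → ℂ} (h : eval v G ≠ 0)
    (w : Fin 3 → ℂ) : ∃ s : ℂ, s ≠ 0 ∧ eval (v + s • w) G ≠ 0 := by
  let q : Polynomial ℂ := aeval (fun i ↦ Polynomial.C (v i) + Polynomial.X * Polynomial.C (w i)) G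
  have hq (s : ℂ) : q.eval s = eval (v + s • w) G := by
    rw [← Polynomial.coe_aeval_eq_eval]
    change Polynomial.aeval s (aeval _ G) = _
    rw [← AlgHom.comp_apply, comp_aeval, ← aeval_eq_eval]
    congr 2
    ext i
    simp [mul_comm s]
  have h0 : Polynomial.X * q ≠ 0 := by
    refine mul_ne_zero Polynomial.X_ne_zero ?_
    intro hq0
    have := hq 0
    rw [hq0, Polynomial.eval_zero, zero_smul, add_zero] at this
    exact h this.symm
  by_contra! hcon
  apply h0
  refine Polynomial.funext fun s ↦ ?_
  rw [Polynomial.eval_mul, Polynomial.eval_X, hq, Polynomial.eval_zero]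
  by_cases hs : s = 0
  · rw [hs, zero_mul]
  · rw [hcon s hs, mul_zero]

theorem IsNonsingularCubic.exists_eval_ne_zero (hF : IsNonsingularCubic F) :
    ∃ b c : ℂ, eval ![1, b, c] F ≠ 0 := by
  have h : X 0 * F ≠ 0 := mul_ne_zero (X_ne_zero _) hF.ne_zero
  obtain ⟨v, hv⟩ : ∃ v : Fin 3 → ℂ, eval v (X 0 * F) ≠ 0 := by
    by_contra! hcon
    exact h (MvPolynomial.funext fun v ↦ by rw [hcon, map_zero])
  rw [map_mul, eval_X] at hv
  have hv0 := left_ne_zero_of_mul hv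
  refine ⟨v 1 / v 0, v 2 / v 0, fun hz ↦ right_ne_zero_of_mul hv ?_⟩
  have hsm : v = v 0 • ![1, v 1 / v 0, v 2 / v 0] := by
    ext i
    fin_cases i <;> simp [mul_div_cancel₀ _ hv0]
  rw [hsm, hF.isHomogeneous.eval_smul, hz, mul_zero]

/-- Differences of directional derivatives from two centres put every partial derivative of `F` into
the conductor of `z`. By nonsingularity and the Nullstellensatz the conductor contains powers of the
two coordinates of the projection, which are coprime, so freeness forces `z` into the ring. -/
theorem IsNonsingularCubic.isIntegrallyClosed (hF : IsNonsingularCubic F) :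
    IsIntegrallyClosed (HomogeneousCoordinateRing F) := by
  have := hF.isDomain
  rw [isIntegrallyClosed_iff (FractionRing (HomogeneousCoordinateRing F))]
  intro z hz
  obtain ⟨b, c, hbc⟩ := hF.exists_eval_ne_zero
  set I := conductorIdeal F z
  have h0 := (conductorIdeal_of_eval_ne_zero hF hbc hz).1
  have h1 : pderiv 1 F ∈ I := by
    obtain ⟨s, hs, hsF⟩ := exists_eval_ne_zero_add hbc ![0, 1, 0]
    have hvec : ![1, b, c] + s • ![0, 1, 0] = ![1, b + s, c] := by simp
    rw [hvec] at hsF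
    have h := I.mul_mem_left (C s⁻¹) (I.sub_mem (conductorIdeal_of_eval_ne_zero hF hsF hz).1 h0)
    convert h using 1
    have : C s⁻¹ * C s = (1 : MvPolynomial (Fin 3) ℂ) := by
      rw [← map_mul, inv_mul_cancel₀ hs, map_one]
    rw [map_add]
    linear_combination (-pderiv 1 F) * this
  have h2 : pderiv 2 F ∈ I := by
    obtain ⟨s, hs, hsF⟩ := exists_eval_ne_zero_add hbc ![0, 0, 1]
    have hvec : ![1, b, c] + s • ![0, 0, 1] = ![1, b, c + s] := by simp
    rw [hvec] at hsF
    have h := I.mul_mem_left (C s⁻¹) (I.sub_mem (conductorIdeal_of_eval_ne_zero hF hsF hz).1 h0)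
    convert h using 1
    have : C s⁻¹ * C s = (1 : MvPolynomial (Fin 3) ℂ) := by
      rw [← map_mul, inv_mul_cancel₀ hs, map_one]
    rw [map_add]
    linear_combination (-pderiv 2 F) * this
  have h3 : pderiv 0 F ∈ I := by
    have h := I.sub_mem (I.sub_mem h0 (I.mul_mem_left (C b) h1)) (I.mul_mem_left (C c) h2)
    convert h using 1
    ring
  have hFI : F ∈ I := ⟨0, by
    rw [Ideal.Quotient.eq_zero_iff_mem.2 (Ideal.mem_span_singleton_self F)]; simp⟩
  have hrad : vanishingIdeal ℂ ({0} : Set (Fin 3 → ℂ)) ≤ I.radical := by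
    rw [← vanishingIdeal_zeroLocus_eq_radical (K := ℂ)]
    apply vanishingIdeal_anti_mono
    intro v hv
    rw [mem_zeroLocus_iff] at hv
    by_contra hv0
    have he {G : MvPolynomial (Fin 3) ℂ} (hG : G ∈ I) : eval v G = 0 := by
      simpa [aeval_eq_eval] using hv G hG
    obtain ⟨i, hi⟩ := hF.nonsingular v hv0 (he hFI)
    fin_cases i
    · exact hi (he h3)
    · exact hi (he h1)
    · exact hi (he h2)
  obtain ⟨m, hm⟩ : X 1 - C b * X 0 ∈ I.radical :=
    hrad ((mem_vanishingIdeal_singleton_iff _ _).2 (by simp))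
  obtain ⟨n, hn⟩ : X 2 - C c * X 0 ∈ I.radical :=
    hrad ((mem_vanishingIdeal_singleton_iff _ _).2 (by simp))
  exact (conductorIdeal_of_eval_ne_zero hF hbc hz).2 m n hm hn

end Normality

/-! ### The positive statements for all height-one primes. -/

section KrullLocallyJaffard

theorem IsNonsingularCubic.symbolicReesAlgebra {F : MvPolynomial (Fin 3) ℂ}
    (hF : IsNonsingularCubic F) (P : Ideal (HomogeneousCoordinateRing F)) [P.IsPrime]
    (hP : P.height = 1) :
    IsKrullDomain (symbolicReesAlgebra P) ∧ ringKrullDim (symbolicReesAlgebra P) = 3 ∧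
      IsLocallyJaffard (symbolicReesAlgebra P) := by
  have := hF.isDomain
  have := hF.isIntegrallyClosed
  have := isDiscreteValuationRing_atPrime_of_height_eq_one P hP
  have hmax : ¬ P.IsMaximal := fun h ↦ by
    have h2 := two_le_height_of_isMaximal P h
    rw [hP] at h2
    exact absurd h2 (by norm_num)
  exact ⟨isKrullDomain_symbolicReesAlgebra P,
    ringKrullDim_symbolicReesAlgebra P hF.trdeg_le hmax,
    isLocallyJaffard_symbolicReesAlgebra P hF.trdeg_le hmax⟩

end KrullLocallyJaffard

/-! ### Extending derivations, and their constants. -/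

section DerivationExtension

open TrivSqZeroExt in
/-- A derivation of a domain extends to its fraction field. -/
theorem Derivation.exists_extension_fractionRing {k B : Type*} (L : Type*) [CommRing k] [CommRing B]
    [IsDomain B] [Algebra k B] [Field L] [Algebra B L] [IsFractionRing B L] [Algebra k L]
    [IsScalarTower k B L] (D : Derivation k B B) :
    ∃ δ : Derivation k L L, ∀ b, δ (algebraMap B L b) = algebraMap B L (D b) := by
  -- A derivation is a homomorphism `b ↦ b + ε D b` into the dual numbers. Nonzero elements of `B`
  -- become units there, so the homomorphism extends to `L`.
  let f : B →+* TrivSqZeroExt L L :=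
    { toFun := fun b ↦ inl (algebraMap B L b) + inr (algebraMap B L (D b))
      map_one' := by ext <;> simp
      map_zero' := by ext <;> simp
      map_mul' := fun a b ↦ by
        ext
        · simp
        · simp only [snd_add, snd_inl, snd_inr, snd_mul, fst_add, fst_inl, fst_inr, map_mul, map_add,
            D.leibniz, smul_eq_mul, op_smul_eq_smul, zero_add, add_zero]
      map_add' := fun a b ↦ by ext <;> simp [Algebra.smul_def] }
  have hf (b : B) : f b = inl (algebraMap B L b) + inr (algebraMap B L (D b)) := rfl
  have hu (s : nonZeroDivisors B) : IsUnit (f s) := by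
    rw [isUnit_iff_isUnit_fst, hf]
    simp
  let g : L →+* TrivSqZeroExt L L := IsLocalization.lift hu
  have hg (b : B) : g (algebraMap B L b) = f b := IsLocalization.lift_eq hu b
  have hfst (x : L) : (g x).fst = x := by
    have : ((fstHom L L L : TrivSqZeroExt L L →+* L).comp g) = RingHom.id L := by
      apply IsLocalization.ringHom_ext (nonZeroDivisors B)
      ext b
      simp [hg, hf]
    exact RingHom.congr_fun this x
  have hk (c : k) : g (algebraMap k L c) = inl (algebraMap k L c) := by
    rw [IsScalarTower.algebraMap_apply k B L, hg, hf]
    simp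
  refine ⟨Derivation.mk'
    { toFun := fun x ↦ (g x).snd
      map_add' := fun x y ↦ by simp
      map_smul' := fun c x ↦ by
        rw [Algebra.smul_def, map_mul, hk, snd_mul]
        simp [Algebra.smul_def] } fun x y ↦ ?_, fun b ↦ ?_⟩
  · change (g (x * y)).snd = x • (g y).snd + y • (g x).snd
    rw [map_mul, snd_mul, hfst, hfst, op_smul_eq_smul]
  · change (g _).snd = _
    rw [hg, hf, snd_add, snd_inl, snd_inr, zero_add]

/-- In characteristic zero, the constants of a nonzero derivation of a field of transcendence
degree one over an algebraically closed field `k` are the elements of `k`. -/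
theorem Derivation.mem_range_of_apply_eq_zero {k L : Type*} [Field k] [IsAlgClosed k] [CharZero k]
    [Field L] [Algebra k L] (hd : Algebra.trdeg k L ≤ 1) {δ : Derivation k L L} (hδ : δ ≠ 0) {c : L}
    (hc : δ c = 0) : c ∈ (algebraMap k L).range := by
  by_contra hcr
  apply hδ
  have htr : Transcendental k c := by
    intro halg
    apply hcr
    have hi := halg.isIntegral
    have h1 := IsAlgClosed.degree_eq_one_of_irreducible k (minpoly.irreducible hi)
    exact minpoly.mem_range_of_degree_eq_one k c h1
  -- The constants form a field `E`. Once `E` contains the transcendental `c`, all of `L` is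
  -- algebraic over `E`, and separability forces `δ = 0`.
  let E : IntermediateField k L :=
    { carrier := {e | δ e = 0}
      mul_mem' := fun {a b} ha hb ↦ by
        simp only [Set.mem_ofPred_eq] at ha hb ⊢
        rw [δ.leibniz, ha, hb, smul_zero, smul_zero, add_zero]
      add_mem' := fun {a b} ha hb ↦ by
        simp only [Set.mem_ofPred_eq] at ha hb ⊢
        rw [map_add, ha, hb, add_zero]
      algebraMap_mem' := fun r ↦ δ.map_algebraMap r
      inv_mem' := fun a ha ↦ by
        simp only [Set.mem_ofPred_eq] at ha ⊢
        rw [δ.leibniz_inv, ha, smul_zero] }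
  let δE : Derivation E L L := Derivation.mk'
    { toFun := δ
      map_add' := map_add δ
      map_smul' := fun e x ↦ by
        have he : δ (e : L) = 0 := e.2
        rw [IntermediateField.smul_def, smul_eq_mul, δ.leibniz, he, smul_zero, add_zero]
        rfl } fun a b ↦ δ.leibniz a b
  ext y
  change δE y = 0
  have halg : IsAlgebraic E y := by
    by_contra hy
    have hx : AlgebraicIndependent k (fun _ : Unit ↦ c) :=
      algebraicIndependent_unique_type_iff.2 htr
    have hle : Algebra.adjoin k (Set.range fun _ : Unit ↦ c) ≤ E.toSubalgebra := by
      rw [Algebra.adjoin_le_iff]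
      rintro _ ⟨_, rfl⟩
      exact hc
    have hty : Transcendental (Algebra.adjoin k (Set.range fun _ : Unit ↦ c)) y := by
      rintro ⟨p, hp0, hp⟩
      refine hy ⟨p.map (Subalgebra.inclusion hle).toRingHom, ?_, ?_⟩
      · exact (Polynomial.map_ne_zero_iff (Subalgebra.inclusion_injective hle)).2 hp0
      · rw [Polynomial.aeval_def, Polynomial.eval₂_map, ← hp]
        rfl
    have := (hx.option_iff_transcendental y).2 hty
    have h2 := this.lift_cardinalMk_le_trdeg
    have h3 := h2.trans (Cardinal.lift_le.2 hd)
    simp at h3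
  have hi := halg.isIntegral
  have h := δE.map_aeval (minpoly E y) y
  rw [minpoly.aeval, map_zero, smul_eq_mul] at h
  exact (mul_eq_zero.1 h.symm).resolve_left
    ((minpoly.irreducible hi).separable.aeval_derivative_ne_zero (minpoly.aeval E y))

end DerivationExtension

/-! ### Nonvanishing of Wronskians. -/

section Wronskian

/-- If the constants of a derivation `δ` of a field are the elements of `k`, the Wronskian of a
family of `k`-linearly independent elements does not vanish. -/
theorem det_iterate_derivation_ne_zero {k L : Type*} [Field k] [Field L] [Algebra k L]
    {δ : Derivation k L L} (hδ : ∀ c, δ c = 0 → c ∈ (algebraMap k L).range) {N : ℕ}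
    {g : Fin N → L} (hg : LinearIndependent k g) :
    (Matrix.of fun i j : Fin N ↦ δ^[i] (g j)).det ≠ 0 := by
  intro hdet
  let u (i : ℕ) (j : Fin N) : L := δ^[i] (g j)
  obtain ⟨c, hc0, hc⟩ := Matrix.exists_mulVec_eq_zero_iff.2 hdet
  obtain ⟨v, hv0, hv⟩ := Matrix.exists_vecMul_eq_zero_iff.2 hdet
  have hδu (n : ℕ) : (fun j ↦ δ (u n j)) = u (n + 1) := by
    ext j
    exact (Function.iterate_succ_apply' δ n (g j)).symm
  classical
  -- The last nonzero coefficient of the row relation `v` writes `u r` through the earlier rows.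
  -- Their span is then stable under `δ`, so it contains all `u n`, and the column relation `c`
  -- kills every one of them.
  obtain ⟨r, hrN, hr⟩ : ∃ r < N, u r ∈ Submodule.span L (u '' Set.Iio r) := by
    let w (i : ℕ) : L := if h : i < N then v ⟨i, h⟩ else 0
    obtain ⟨i₀, hi₀⟩ := Function.ne_iff.1 hv0
    have hwi₀ : w i₀ ≠ 0 := by simpa [w] using hi₀
    set r := Nat.findGreatest (fun i ↦ w i ≠ 0) N with hr
    have hwr : w r ≠ 0 := Nat.findGreatest_spec (P := fun i ↦ w i ≠ 0) i₀.2.le hwi₀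
    have hrN : r < N := by
      by_contra h
      exact hwr (dif_neg h)
    have hgt (i : ℕ) (hi : r < i) : w i = 0 := by
      by_cases hiN : i < N
      · by_contra h
        exact absurd (Nat.le_findGreatest hiN.le h) (not_le.2 hi)
      · exact dif_neg hiN
    have hsum : ∑ i ∈ Finset.range N, w i • u i = 0 := by
      rw [Finset.sum_range]
      ext j
      have := congrFun hv j
      simpa [Matrix.vecMul, dotProduct, w, u] using this
    have hsum' : ∑ i ∈ Finset.range (r + 1), w i • u i = 0 := by
      rw [← hsum]
      refine Finset.sum_subset (Finset.range_mono hrN) fun i _ hi ↦ ?_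
      rw [hgt i (by simpa using hi), zero_smul]
    rw [Finset.sum_range_succ] at hsum'
    refine ⟨r, hrN, ?_⟩
    have h1 : u r = -((w r)⁻¹ • ∑ i ∈ Finset.range r, w i • u i) := by
      rw [eq_neg_of_add_eq_zero_left hsum', smul_neg, neg_neg, inv_smul_smul₀ hwr]
    rw [h1]
    refine neg_mem (Submodule.smul_mem _ _ (Submodule.sum_mem _ fun i hi ↦
      Submodule.smul_mem _ _ (Submodule.subset_span ⟨i, by simpa using hi, rfl⟩)))
  have hstable (x) (hx : x ∈ Submodule.span L (u '' Set.Iio r)) :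
      (fun j ↦ δ (x j)) ∈ Submodule.span L (u '' Set.Iio r) := by
    induction hx using Submodule.span_induction with
    | mem x hx =>
      obtain ⟨i, hi, rfl⟩ := hx
      rw [hδu]
      rcases (Nat.succ_le_of_lt hi).eq_or_lt with h | h
      · exact h ▸ hr
      · exact Submodule.subset_span ⟨i + 1, h, rfl⟩
    | zero =>
      convert Submodule.zero_mem _ using 1
      ext j
      simp
    | add x y _ _ hx hy =>
      convert add_mem hx hy using 1
      ext j
      simp
    | smul a x h hx =>
      convert add_mem (Submodule.smul_mem _ a hx) (Submodule.smul_mem _ (δ a) h) using 1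
      ext j
      simp [mul_comm]
  have hmem (n : ℕ) : u n ∈ Submodule.span L (u '' Set.Iio r) := by
    induction n with
    | zero =>
      rcases Nat.eq_zero_or_pos r with h | h
      · exact h ▸ h ▸ hr
      · exact Submodule.subset_span ⟨0, h, rfl⟩
    | succ n ih => exact hδu n ▸ hstable _ ih
  have hcu (n : ℕ) : c ⬝ᵥ u n = 0 := by
    have h := hmem n
    generalize u n = x at h
    induction h using Submodule.span_induction with
    | mem x hx =>
      obtain ⟨i, hi, rfl⟩ := hx
      have := congrFun hc ⟨i, lt_trans hi hrN⟩
      rw [dotProduct_comm]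
      exact this
    | zero => exact dotProduct_zero c
    | add x y _ _ hx hy => rw [dotProduct_add, hx, hy, add_zero]
    | smul a x _ hx => rw [dotProduct_smul, hx, smul_zero]
  -- Choose a relation of smallest support and scale one entry to `1`. Differentiating gives a
  -- relation of smaller support, so all entries are constants: a linear relation over `k` among the
  -- `g j`.
  have hex : ∃ m : ℕ, ∃ c : Fin N → L, c ≠ 0 ∧ (∀ n, c ⬝ᵥ u n = 0) ∧
      (Finset.univ.filter fun i ↦ c i ≠ 0).card = m := ⟨_, c, hc0, hcu, rfl⟩
  obtain ⟨d, hd0, hd, hcard⟩ := Nat.find_spec hex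
  obtain ⟨j, hj⟩ := Function.ne_iff.1 hd0
  have hδd : (fun i ↦ δ ((d j)⁻¹ * d i)) = 0 := by
    by_contra hne
    refine Nat.find_min hex (m := (Finset.univ.filter fun i ↦ δ ((d j)⁻¹ * d i) ≠ 0).card) ?_
      ⟨_, hne, fun n ↦ ?_, rfl⟩
    · rw [← hcard]
      apply Finset.card_lt_card
      rw [Finset.ssubset_iff_of_subset]
      · refine ⟨j, by simpa using hj, ?_⟩
        rw [Finset.mem_filter, inv_mul_cancel₀ hj, δ.map_one_eq_zero]
        simp
      · intro i
        simp only [Finset.mem_filter, Finset.mem_univ, true_and]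
        exact mt fun h ↦ by rw [h, mul_zero, map_zero]
    · have h1 : ∑ i, (d j)⁻¹ * d i * u n i = 0 := by
        simp_rw [mul_assoc]
        rw [← Finset.mul_sum]
        exact mul_eq_zero_of_right _ (hd n)
      have h2 : ∑ i, (d j)⁻¹ * d i * δ (u n i) = 0 := by
        simp_rw [mul_assoc]
        rw [← Finset.mul_sum]
        exact mul_eq_zero_of_right _ ((congrArg (d ⬝ᵥ ·) (hδu n)).trans (hd (n + 1)))
      have h3 := congrArg δ h1
      rw [map_sum, map_zero] at h3
      have hl (i : Fin N) : δ ((d j)⁻¹ * d i * u n i) =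
          (d j)⁻¹ * d i * δ (u n i) + u n i * δ ((d j)⁻¹ * d i) := δ.leibniz _ _
      simp_rw [hl] at h3
      rw [Finset.sum_add_distrib, h2, zero_add] at h3
      rw [← h3]
      exact Finset.sum_congr rfl fun i _ ↦ mul_comm _ _
  choose a ha using fun i ↦ hδ _ (congrFun hδd i)
  have h0 : ∑ i, a i • g i = 0 := by
    simp_rw [Algebra.smul_def, ha, mul_assoc]
    rw [← Finset.mul_sum]
    exact mul_eq_zero_of_right _ (hd 0)
  have haj := Fintype.linearIndependent_iff.1 hg a h0 j
  have h1 := ha j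
  rw [haj, map_zero, inv_mul_cancel₀ hj] at h1
  exact zero_ne_one h1

lemma Derivation.iterate_apply_algebraMap {k B L : Type*} [CommRing k] [CommRing B] [CommRing L]
    [Algebra k B] [Algebra k L] [Algebra B L] {D : Derivation k B B} {δ : Derivation k L L}
    (h : ∀ b, δ (algebraMap B L b) = algebraMap B L (D b)) (i : ℕ) (b : B) :
    δ^[i] (algebraMap B L b) = algebraMap B L (D^[i] b) := by
  induction i with
  | zero => rfl
  | succ i ih => rw [Function.iterate_succ_apply', Function.iterate_succ_apply', ih, h]

/-- On a curve over an algebraically closed field of characteristic zero, the Wronskian of linearly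
independent functions with respect to a nonzero derivation does not vanish. -/
theorem det_iterate_derivation_ne_zero_of_trdeg_le {k B : Type*} [Field k] [IsAlgClosed k]
    [CharZero k] [CommRing B] [IsDomain B] [Algebra k B] (hd : Algebra.trdeg k B ≤ 1)
    {D : Derivation k B B} (hD : D ≠ 0) {N : ℕ} {g : Fin N → B} (hg : LinearIndependent k g) :
    (Matrix.of fun i j : Fin N ↦ D^[i] (g j)).det ≠ 0 := by
  obtain ⟨δ, hδ⟩ := D.exists_extension_fractionRing (FractionRing B)
  have hinj := IsFractionRing.injective B (FractionRing B)
  have hδ0 : δ ≠ 0 := by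
    rintro rfl
    apply hD
    ext b
    apply hinj
    rw [← hδ]
    simp
  have htr : Algebra.trdeg k (FractionRing B) ≤ 1 := by
    have h := trdeg_localization_le (k := k) (T := FractionRing B) (nonZeroDivisors B) le_rfl
      (d := 1) (by exact_mod_cast hd)
    exact_mod_cast h
  have hdet := det_iterate_derivation_ne_zero
    (fun c hc ↦ δ.mem_range_of_apply_eq_zero htr hδ0 hc)
    (hg.map' (IsScalarTower.toAlgHom k B (FractionRing B)).toLinearMap
      (LinearMap.ker_eq_bot.2 hinj))
  intro h
  apply hdet
  have h2 := congrArg (algebraMap B (FractionRing B)) h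
  rw [RingHom.map_det, map_zero] at h2
  rw [← h2]
  congr 1
  ext i j
  exact Derivation.iterate_apply_algebraMap hδ i _

end Wronskian

/-! ### Points avoiding countably many hypersurfaces. -/

section Points

open MvPolynomial

/-- A field extension of `ℂ` of countable dimension is trivial. -/
theorem isAlgebraic_of_rank_le_aleph0 (κ : Type) [Field κ] [Algebra ℂ κ]
    (h : Module.rank ℂ κ ≤ Cardinal.aleph0) : Algebra.IsAlgebraic ℂ κ := by
  refine ⟨fun x ↦ ?_⟩
  by_contra hx
  -- A transcendental `x` would give continuum many independent elements `1/(x - c)`.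
  have h1 := (Transcendental.linearIndependent_sub_inv (F := ℂ) hx).cardinal_le_rank
  rw [Cardinal.mk_complex] at h1
  exact absurd (h1.trans h) (not_le.2 Cardinal.aleph0_lt_continuum)

/-- A nontrivial quotient of a polynomial ring over `ℂ` in countably many variables has a point. -/
theorem exists_algHom_of_countable {σ : Type} [Countable σ] {R : Type} [CommRing R] [Nontrivial R]
    [Algebra ℂ R] (f : MvPolynomial σ ℂ →ₐ[ℂ] R) (hf : Function.Surjective f) :
    Nonempty (R →ₐ[ℂ] ℂ) := by
  obtain ⟨M, hM⟩ := Ideal.exists_maximal R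
  let := Ideal.Quotient.field M
  have hrank : Module.rank ℂ (R ⧸ M) ≤ Cardinal.aleph0 := by
    have hsurj : Function.Surjective ((Ideal.Quotient.mkₐ ℂ M).comp f) :=
      (Ideal.Quotient.mkₐ_surjective ℂ M).comp hf
    refine (LinearMap.rank_le_of_surjective ((Ideal.Quotient.mkₐ ℂ M).comp f).toLinearMap
      hsurj).trans ?_
    rw [← (basisMonomials σ ℂ).mk_eq_rank'']
    exact Cardinal.mk_le_aleph0
  have := isAlgebraic_of_rank_le_aleph0 (R ⧸ M) hrank
  have hbij := IsAlgClosed.algebraMap_bijective_of_isIntegral (k := ℂ) (K := R ⧸ M)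
  exact ⟨((AlgEquiv.ofBijective (Algebra.ofId ℂ (R ⧸ M)) hbij).symm : (R ⧸ M) →ₐ[ℂ] ℂ).comp
    (Ideal.Quotient.mkₐ ℂ M)⟩

/-- On an irreducible affine variety over `ℂ` there is a point at which none of countably many given
nonzero functions vanishes. -/
theorem exists_algHom_forall_ne_zero {σ : Type} [Countable σ] {B : Type} [CommRing B] [IsDomain B]
    [Algebra ℂ B] (f : MvPolynomial σ ℂ →ₐ[ℂ] B) (hf : Function.Surjective f) {w : ℕ → B}
    (hw : ∀ n, w n ≠ 0) : ∃ φ : B →ₐ[ℂ] ℂ, ∀ n, φ (w n) ≠ 0 := by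
  let ι := IsScalarTower.toAlgHom ℂ B (FractionRing B)
  -- Adjoining all the inverses of the `w n` keeps the algebra countably generated, so it has a
  -- point; there every `w n` is invertible.
  let F : MvPolynomial (σ ⊕ ℕ) ℂ →ₐ[ℂ] FractionRing B :=
    aeval (Sum.elim (fun i ↦ ι (f (X i))) fun n ↦ (ι (w n))⁻¹)
  obtain ⟨ψ⟩ := exists_algHom_of_countable F.rangeRestrict F.rangeRestrict_surjective
  have hι (b : B) : ι b ∈ F.range := by
    obtain ⟨G, rfl⟩ := hf b
    refine ⟨rename Sum.inl G, ?_⟩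
    change F (rename Sum.inl G) = ι (f G)
    have : F.comp (rename Sum.inl) = ι.comp f := by
      ext i
      simp [F]
    exact AlgHom.congr_fun this G
  refine ⟨ψ.comp (ι.codRestrict F.range hι), fun n h0 ↦ ?_⟩
  have hinv : (ι (w n))⁻¹ ∈ F.range := ⟨X (Sum.inr n), by simp [F]⟩
  have hne : ι (w n) ≠ 0 := by
    simpa [ι] using hw n
  have h1 : ι.codRestrict F.range hι (w n) * ⟨_, hinv⟩ = 1 :=
    Subtype.ext (mul_inv_cancel₀ hne)
  have h2 := congrArg ψ h1
  rw [map_mul, map_one] at h2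
  change ψ (ι.codRestrict F.range hι (w n)) = 0 at h0
  rw [h0, zero_mul] at h2
  exact zero_ne_one h2

end Points

/-! ### Derivations lower symbolic powers by one. -/

section Differentiation

variable {k A : Type*} [CommRing k] [CommRing A] [Algebra k A]

lemma Derivation.apply_mem_pow (D : Derivation k A A) (P : Ideal A) (n : ℕ) {a : A}
    (ha : a ∈ P ^ (n + 1)) : D a ∈ P ^ n := by
  induction n generalizing a with
  | zero => simp
  | succ n ih =>
    rw [pow_succ] at ha
    induction ha using Submodule.mul_induction_on' with
    | mem_mul_mem x hx y hy =>
      rw [D.leibniz, smul_eq_mul, smul_eq_mul]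
      refine add_mem (Ideal.mul_mem_right _ _ hx) ?_
      rw [pow_succ']
      exact Ideal.mul_mem_mul hy (ih hx)
    | add x _ y _ hx hy => rw [map_add]; exact add_mem hx hy

variable {P : Ideal A} [P.IsPrime]

/-- If `s a ∈ Pⁿ⁺¹`, then `s D(s a)` differs from `s² D a` by an element of `Pⁿ`, and `s² ∉ P`. -/
lemma Derivation.apply_mem_symbolicPower (D : Derivation k A A) {n : ℕ} {a : A}
    (ha : a ∈ symbolicPower P (n + 1)) : D a ∈ symbolicPower P n := by
  obtain ⟨s, hs, hsa⟩ := (mem_symbolicPower_iff P).1 ha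
  have h := D.apply_mem_pow P n hsa
  rw [D.leibniz, smul_eq_mul, smul_eq_mul] at h
  refine (mem_symbolicPower_iff P).2 ⟨s * s, fun hss ↦ hs ((or_self_iff).1
    (Ideal.IsPrime.mem_or_mem ‹_› hss)), ?_⟩
  have h1 : s * (a * D s) ∈ P ^ n := by
    rw [← mul_assoc]
    exact Ideal.mul_mem_right _ _ (Ideal.pow_le_pow_right n.le_succ hsa)
  have h2 := sub_mem (Ideal.mul_mem_left _ s h) h1
  convert h2 using 1
  ring

lemma Derivation.iterate_mem_of_mem_symbolicPower (D : Derivation k A A) {n : ℕ} {a : A}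
    (ha : a ∈ symbolicPower P n) {i : ℕ} (hi : i < n) : D^[i] a ∈ P := by
  induction n generalizing a i with
  | zero => omega
  | succ n ih =>
    cases i with
    | zero =>
      rw [Function.iterate_zero, id, ← symbolicPower_one P]
      exact symbolicPower_antitone P (by omega) ha
    | succ i =>
      rw [Function.iterate_succ_apply]
      exact ih (D.apply_mem_symbolicPower ha) (by omega)

end Differentiation

/-! ### Symbolic powers detected by iterated derivatives. -/

section DifferentialCriterion

variable {k A : Type*} [Field k] [CharZero k] [CommRing A] [IsDomain A] [Algebra k A] {P : Ideal A}
  [P.IsPrime] [IsDiscreteValuationRing (Localization.AtPrime P)]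

lemma pow_mem_symbolicPower_and_notMem {a : A} (ha : a ∈ P) (ha2 : a ∉ symbolicPower P 2) (n : ℕ) :
    a ^ n ∈ symbolicPower P n ∧ a ^ n ∉ symbolicPower P (n + 1) := by
  have ha1 : a ∈ symbolicPower P 1 := (symbolicPower_one P).symm ▸ ha
  induction n with
  | zero =>
    rw [pow_zero, symbolicPower_zero, zero_add, symbolicPower_one]
    exact ⟨trivial, Ideal.IsPrime.one_notMem ‹_›⟩
  | succ n ih =>
    rw [pow_succ]
    exact ⟨mul_mem_symbolicPower P ih.1 ha1, mul_notMem_symbolicPower P ih.1 ih.2 ha1 ha2⟩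

/-- The element `a` is a uniformizer of `A_P`, so `aⁿ` divides `g` there; clear the denominator. -/
lemma exists_mul_eq_mul_pow {a : A} (ha : a ∈ P) (ha2 : a ∉ symbolicPower P 2) {n : ℕ} {g : A}
    (hg : g ∈ symbolicPower P n) : ∃ s ∉ P, ∃ b, s * g = b * a ^ n := by
  obtain ⟨h1, h2⟩ := pow_mem_symbolicPower_and_notMem ha ha2 n
  have h3 := (mem_symbolicPower_iff_le_primeOrder P).1 hg
  rw [← primeOrder_eq P h1 h2, primeOrder, primeOrder, IsDiscreteValuationRing.addVal_le_iff_dvd] at h3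
  obtain ⟨x, hx⟩ := h3
  obtain ⟨⟨b, s⟩, hs⟩ := IsLocalization.surj P.primeCompl x
  refine ⟨s, s.2, b, IsLocalization.injective (Localization.AtPrime P)
    P.primeCompl_le_nonZeroDivisors ?_⟩
  rw [map_mul, map_mul, hx, ← hs]
  ring

/-- Integrating along a derivation transversal to `P` raises the order of vanishing. -/
lemma Derivation.mem_symbolicPower_succ (D : Derivation k A A) {a : A} (ha : a ∈ P)
    (hDa : D a ∉ P) {n : ℕ} {g : A} (hg : g ∈ P) (hDg : D g ∈ symbolicPower P n) :
    g ∈ symbolicPower P (n + 1) := by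
  have ha2 : a ∉ symbolicPower P 2 := fun h ↦
    hDa ((symbolicPower_one P) ▸ D.apply_mem_symbolicPower h)
  induction n with
  | zero => exact (symbolicPower_one P).symm ▸ hg
  | succ m ih =>
    have hgm := ih (symbolicPower_antitone P m.le_succ hDg)
    -- Otherwise `s g = b aᵐ⁺¹` with `s, b ∉ P`. On differentiating, `(m + 1) b aᵐ D a` has order
    -- exactly `m` in characteristic zero, while every other term has order at least `m + 1`.
    by_contra hcon
    obtain ⟨s, hs, b, hb⟩ := exists_mul_eq_mul_pow ha ha2 hgm
    have hunit (c : A) : c ∈ symbolicPower P 0 := by rw [symbolicPower_zero]; trivial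
    have hbP : b ∉ P := fun h ↦ by
      have h1 : s * g ∉ symbolicPower P (0 + (m + 1) + 1) :=
        mul_notMem_symbolicPower P (hunit s) (by rwa [zero_add, symbolicPower_one]) hgm hcon
      rw [hb, zero_add, add_comm (m + 1)] at h1
      exact h1 (mul_mem_symbolicPower P ((symbolicPower_one P).symm ▸ h)
        (pow_mem_symbolicPower_and_notMem ha ha2 _).1)
    have hD := congrArg D hb
    rw [D.leibniz, D.leibniz, D.leibniz_pow, Nat.add_sub_cancel] at hD
    simp only [smul_eq_mul, nsmul_eq_mul] at hD
    have hmP : ((m + 1 : ℕ) : A) ∉ P := by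
      have hu : IsUnit ((m + 1 : ℕ) : A) := by
        rw [← _root_.map_natCast (algebraMap k A)]
        exact (isUnit_iff_ne_zero.2 (Nat.cast_ne_zero.2 m.succ_ne_zero)).map _
      exact fun h ↦ Ideal.IsPrime.ne_top' (Ideal.eq_top_of_isUnit_mem _ h hu)
    have hc : b * ((m + 1 : ℕ) : A) * D a ∉ P := fun h ↦
      (Ideal.IsPrime.mem_or_mem ‹_› h).elim
        (fun h ↦ (Ideal.IsPrime.mem_or_mem ‹_› h).elim hbP hmP) hDa
    have hpm := pow_mem_symbolicPower_and_notMem ha ha2 m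
    have h1 : b * ((m + 1 : ℕ) : A) * D a * a ^ m ∉ symbolicPower P (0 + m + 1) :=
      mul_notMem_symbolicPower P (hunit _) (by rwa [zero_add, symbolicPower_one]) hpm.1 hpm.2
    apply h1
    rw [zero_add]
    have h2 := sub_mem (add_mem (Ideal.mul_mem_left _ s hDg) (Ideal.mul_mem_right (D s) _ hgm))
      (Ideal.mul_mem_right (D b) _ (pow_mem_symbolicPower_and_notMem ha ha2 (m + 1)).1)
    rw [hD] at h2
    convert h2 using 1
    ring

/-- As `D a` is a unit at `P`, the derivation acts there like differentiation along a uniformizer,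
and in characteristic zero the order is read off as from Taylor coefficients. -/
theorem Derivation.mem_symbolicPower_iff_forall_iterate (D : Derivation k A A) {a : A} (ha : a ∈ P)
    (hDa : D a ∉ P) {n : ℕ} {g : A} :
    g ∈ symbolicPower P n ↔ ∀ i < n, D^[i] g ∈ P := by
  refine ⟨fun h i hi ↦ D.iterate_mem_of_mem_symbolicPower h hi, fun h ↦ ?_⟩
  induction n generalizing g with
  | zero => rw [symbolicPower_zero]; trivial
  | succ n ih =>
    refine D.mem_symbolicPower_succ ha hDa (h 0 n.succ_pos) (ih fun i hi ↦ ?_)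
    rw [← Function.iterate_succ_apply]
    exact h (i + 1) (by omega)

end DifferentialCriterion

/-! ### The grading of the coordinate ring and its Hilbert function. -/

section Grading

open MvPolynomial

/-- The homogeneous elements of degree `m` of the coordinate ring. -/
noncomputable def gradedPiece (F : MvPolynomial (Fin 3) ℂ) (m : ℕ) :
    Submodule ℂ (HomogeneousCoordinateRing F) :=
  (homogeneousSubmodule (Fin 3) ℂ m).map (Ideal.Quotient.mkₐ ℂ (Ideal.span {F})).toLinearMap

variable {F : MvPolynomial (Fin 3) ℂ}

lemma mk_mem_gradedPiece {m : ℕ} {G : MvPolynomial (Fin 3) ℂ} (hG : G.IsHomogeneous m) :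
    Ideal.Quotient.mk (Ideal.span {F}) G ∈ gradedPiece F m :=
  ⟨G, hG, rfl⟩

lemma mem_gradedPiece_iff {m : ℕ} {a : HomogeneousCoordinateRing F} :
    a ∈ gradedPiece F m ↔
      ∃ G : MvPolynomial (Fin 3) ℂ, G.IsHomogeneous m ∧ Ideal.Quotient.mk (Ideal.span {F}) G = a :=
  Iff.rfl

/-- The algebra map sending `a` to `∑ aᵢ Tⁱ` with `aᵢ` the homogeneous component of degree `i`. -/
noncomputable def gradingHom (hF : F.IsHomogeneous 3) :
    HomogeneousCoordinateRing F →ₐ[ℂ] Polynomial (HomogeneousCoordinateRing F) :=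
  Ideal.Quotient.liftₐ _
    ((Polynomial.mapAlgHom (Ideal.Quotient.mkₐ ℂ (Ideal.span {F}))).comp (homogenizeHom (Fin 3) ℂ))
    (fun G hG ↦ by
      obtain ⟨H, rfl⟩ := Ideal.mem_span_singleton.1 hG
      rw [map_mul]
      refine mul_eq_zero_of_left ?_ _
      rw [AlgHom.comp_apply, homogenizeHom_of_isHomogeneous hF]
      simp [Ideal.Quotient.eq_zero_iff_mem.2 (Ideal.mem_span_singleton_self F)])

lemma gradingHom_mk (hF : F.IsHomogeneous 3) (G : MvPolynomial (Fin 3) ℂ) :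
    gradingHom hF (Ideal.Quotient.mk _ G) =
      (homogenizeHom (Fin 3) ℂ G).map (Ideal.Quotient.mk (Ideal.span {F})) := rfl

lemma gradingHom_mk_coeff (hF : F.IsHomogeneous 3) (G : MvPolynomial (Fin 3) ℂ) (n : ℕ) :
    (gradingHom hF (Ideal.Quotient.mk _ G)).coeff n =
      Ideal.Quotient.mk (Ideal.span {F}) (homogeneousComponent n G) := by
  rw [gradingHom_mk, Polynomial.coeff_map, coeff_homogenizeHom]

lemma gradingHom_coeff_mem (hF : F.IsHomogeneous 3) (a : HomogeneousCoordinateRing F) (n : ℕ) :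
    (gradingHom hF a).coeff n ∈ gradedPiece F n := by
  obtain ⟨G, rfl⟩ := Ideal.Quotient.mk_surjective a
  rw [gradingHom_mk_coeff]
  exact mk_mem_gradedPiece (homogeneousComponent_isHomogeneous n G)

lemma gradingHom_of_mem (hF : F.IsHomogeneous 3) {m : ℕ} {a : HomogeneousCoordinateRing F}
    (ha : a ∈ gradedPiece F m) : gradingHom hF a = Polynomial.C a * Polynomial.X ^ m := by
  obtain ⟨G, hG, rfl⟩ := mem_gradedPiece_iff.1 ha
  rw [gradingHom_mk, homogenizeHom_of_isHomogeneous hG, Polynomial.map_mul, Polynomial.map_C,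
    Polynomial.map_pow, Polynomial.map_X]

lemma eval_one_gradingHom (hF : F.IsHomogeneous 3) (a : HomogeneousCoordinateRing F) :
    (gradingHom hF a).eval 1 = a := by
  obtain ⟨G, rfl⟩ := Ideal.Quotient.mk_surjective a
  conv_rhs => rw [← sum_homogeneousComponent G]
  conv_lhs => rw [← sum_homogeneousComponent G]
  rw [map_sum, map_sum, Polynomial.eval_finsetSum]
  refine Finset.sum_congr rfl fun i _ ↦ ?_
  rw [gradingHom_of_mem hF (mk_mem_gradedPiece (homogeneousComponent_isHomogeneous i G))]
  simp

lemma mk_ne_zero_of_isHomogeneous (hF : F.IsHomogeneous 3) {m : ℕ} (hm : m < 3)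
    {G : MvPolynomial (Fin 3) ℂ} (hG : G.IsHomogeneous m) (h0 : G ≠ 0) :
    Ideal.Quotient.mk (Ideal.span {F}) G ≠ 0 := by
  intro h
  obtain ⟨H, rfl⟩ := Ideal.mem_span_singleton.1 (Ideal.Quotient.eq_zero_iff_mem.1 h)
  have h1 := homogenizeHom_of_isHomogeneous hG
  rw [map_mul, homogenizeHom_of_isHomogeneous hF] at h1
  have h2 := congrArg (fun p ↦ Polynomial.coeff p m) h1
  simp only [Polynomial.coeff_C_mul_X_pow, if_true] at h2
  rw [mul_assoc, Polynomial.coeff_C_mul, mul_comm (_ ^ 3), Polynomial.coeff_mul_X_pow',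
    if_neg (by omega), mul_zero] at h2
  exact h0 h2.symm

lemma finrank_homogeneousSubmodule (m : ℕ) :
    Module.finrank ℂ (homogeneousSubmodule (Fin 3) ℂ m) = (m + 2).choose 2 := by
  classical
  have hset : {d : Fin 3 →₀ ℕ | d.degree = m} = ↑(Finset.finsuppAntidiag (Finset.univ : Finset (Fin 3)) m) := by
    ext d
    simp [Finset.mem_finsuppAntidiag, Finsupp.degree_eq_sum]
  rw [homogeneousSubmodule_eq_finsupp_supported, hset,
    (AddMonoidAlgebra.supportedEquivFinsupp _).finrank_eq, Module.finrank_finsupp_self]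
  rw [← Nat.card_eq_fintype_card, Nat.card_coe_set_eq, Set.ncard_coe_finset, Finset.card_finsuppAntidiag_nat_eq_choose, Finset.card_univ, Fintype.card_fin]
  rw [show 3 + m - 1 = m + 2 by omega, ← Nat.choose_symm_add]

lemma homogeneousSubmodule_inf_span (hF : F.IsHomogeneous 3) (m : ℕ) :
    homogeneousSubmodule (Fin 3) ℂ (m + 3) ⊓ LinearMap.ker
      (Ideal.Quotient.mkₐ ℂ (Ideal.span {F})).toLinearMap =
      (homogeneousSubmodule (Fin 3) ℂ m).map (LinearMap.mulLeft ℂ F) := by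
  ext G
  constructor
  · rintro ⟨hG, hGF⟩
    obtain ⟨H, rfl⟩ := Ideal.mem_span_singleton.1 (Ideal.Quotient.eq_zero_iff_mem.1 hGF)
    refine ⟨homogeneousComponent m H, homogeneousComponent_isHomogeneous m H, ?_⟩
    have h1 := homogenizeHom_of_isHomogeneous hG
    rw [map_mul, homogenizeHom_of_isHomogeneous hF] at h1
    have h2 := congrArg (fun p ↦ Polynomial.coeff p (m + 3)) h1
    simp only [Polynomial.coeff_C_mul_X_pow, if_true] at h2
    rw [mul_assoc, Polynomial.coeff_C_mul, mul_comm (_ ^ 3), Polynomial.coeff_mul_X_pow,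
      coeff_homogenizeHom] at h2
    exact h2
  · rintro ⟨H, hH, rfl⟩
    refine ⟨?_, ?_⟩
    · rw [add_comm]
      exact hF.mul hH
    · exact Ideal.Quotient.eq_zero_iff_mem.2 (Ideal.mul_mem_right _ _ (Ideal.mem_span_singleton_self F))

instance finite_gradedPiece (m : ℕ) : Module.Finite ℂ (gradedPiece F m) :=
  Module.Finite.iff_fg.2 ((homogeneousSubmodule_fg _ _ m).map _)

lemma finrank_gradedPiece_add (m : ℕ) :
    Module.finrank ℂ (gradedPiece F m) + Module.finrank ℂ
      ↥(homogeneousSubmodule (Fin 3) ℂ m ⊓ LinearMap.ker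
        (Ideal.Quotient.mkₐ ℂ (Ideal.span {F})).toLinearMap) = (m + 2).choose 2 := by
  have : Module.Finite ℂ (homogeneousSubmodule (Fin 3) ℂ m) :=
    Module.Finite.iff_fg.2 (homogeneousSubmodule_fg _ _ m)
  rw [← finrank_homogeneousSubmodule]
  have h := ((Ideal.Quotient.mkₐ ℂ (Ideal.span {F})).toLinearMap.domRestrict
    (homogeneousSubmodule (Fin 3) ℂ m)).finrank_range_add_finrank_ker
  rw [LinearMap.range_domRestrict] at h
  rw [← h]
  congr 1
  rw [LinearMap.ker_domRestrict, ← Submodule.map_comap_subtype, Submodule.finrank_map_subtype_eq]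

/-- For `m ≥ 3` this is the binomial difference `C(m+2, 2) - C(m-1, 2)`; for `m = 1, 2` the ideal
`(F)` contributes nothing. Degree zero is excluded, its dimension being one. -/
theorem finrank_gradedPiece (hF : F.IsHomogeneous 3) (h0 : F ≠ 0) {m : ℕ} (hm : 0 < m) :
    Module.finrank ℂ (gradedPiece F m) = 3 * m := by
  have h := finrank_gradedPiece_add (F := F) m
  rcases lt_or_ge m 3 with hlt | hge
  · have hbot : homogeneousSubmodule (Fin 3) ℂ m ⊓ LinearMap.ker
        (Ideal.Quotient.mkₐ ℂ (Ideal.span {F})).toLinearMap = ⊥ := by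
      rw [eq_bot_iff]
      rintro G ⟨hG, hGF⟩
      by_contra hne
      exact mk_ne_zero_of_isHomogeneous hF hlt hG hne hGF
    rw [hbot, finrank_bot] at h
    interval_cases m
    · simpa using h
    · simpa [Nat.choose] using h
  · obtain ⟨n, rfl⟩ := Nat.exists_eq_add_of_le' hge
    rw [homogeneousSubmodule_inf_span hF,
      ← ((homogeneousSubmodule (Fin 3) ℂ n).equivMapOfInjective _
        (fun _ _ h ↦ mul_left_cancel₀ h0 h)).finrank_eq, finrank_homogeneousSubmodule] at h
    have h1 : (n + 3 + 2).choose 2 = (n + 2).choose 2 + 3 * (n + 3) := by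
      have h2 := Nat.choose_succ_succ' (n + 4) 1
      have h3 := Nat.choose_succ_succ' (n + 3) 1
      have h4 := Nat.choose_succ_succ' (n + 2) 1
      simp only [Nat.choose_one_right, Nat.reduceAdd, add_assoc] at h2 h3 h4 ⊢
      omega
    omega

end Grading

/-! ### The derivation along the curve. -/

section CurveDerivation

open MvPolynomial

variable {F : MvPolynomial (Fin 3) ℂ}

/-- The derivation `F_Y ∂_X - F_X ∂_Y`, which annihilates `F` and `Z`. -/
noncomputable def hamiltonianDerivation (F : MvPolynomial (Fin 3) ℂ) :
    Derivation ℂ (MvPolynomial (Fin 3) ℂ) (MvPolynomial (Fin 3) ℂ) :=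
  pderiv 1 F • pderiv 0 - pderiv 0 F • pderiv 1

lemma hamiltonianDerivation_apply (G : MvPolynomial (Fin 3) ℂ) :
    hamiltonianDerivation F G = pderiv 1 F * pderiv 0 G - pderiv 0 F * pderiv 1 G := rfl

lemma hamiltonianDerivation_isHomogeneous (hF : F.IsHomogeneous 3) {m : ℕ}
    {G : MvPolynomial (Fin 3) ℂ} (hG : G.IsHomogeneous m) :
    (hamiltonianDerivation F G).IsHomogeneous (m + 1) := by
  rw [hamiltonianDerivation_apply]
  -- For `m = 0` the truncated degree `m - 1` of a partial derivative breaks the count; constants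
  -- are killed anyway.
  rcases Nat.eq_zero_or_pos m with rfl | hm
  · obtain ⟨c, rfl⟩ : ∃ c, G = C c :=
      ⟨_, totalDegree_eq_zero_iff_eq_C.1 ((totalDegree_zero_iff_isHomogeneous _).2 hG)⟩
    simp only [pderiv_C, mul_zero, sub_zero]
    exact isHomogeneous_zero _ _ _
  · have h (i j : Fin 3) : (pderiv i F * pderiv j G).IsHomogeneous (m + 1) := by
      convert (hF.pderiv (i := i)).mul (hG.pderiv (i := j)) using 1
      omega
    exact (h 1 0).sub (h 0 1)

lemma mk_hamiltonianDerivation_eq_zero (G : MvPolynomial (Fin 3) ℂ)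
    (hG : Ideal.Quotient.mkₐ ℂ (Ideal.span {F}) G = 0) :
    Ideal.Quotient.mkₐ ℂ (Ideal.span {F}) (hamiltonianDerivation F G) = 0 := by
  obtain ⟨H, rfl⟩ := Ideal.mem_span_singleton.1 (Ideal.Quotient.eq_zero_iff_mem.1 hG)
  refine Ideal.Quotient.eq_zero_iff_mem.2 (Ideal.mem_span_singleton.2
    ⟨hamiltonianDerivation F H, ?_⟩)
  rw [Derivation.leibniz, hamiltonianDerivation_apply F, smul_eq_mul, smul_eq_mul]
  ring

/-- The derivation of the coordinate ring induced by `F_Y ∂_X - F_X ∂_Y`. -/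
noncomputable def curveDerivation (F : MvPolynomial (Fin 3) ℂ) :
    Derivation ℂ (HomogeneousCoordinateRing F) (HomogeneousCoordinateRing F) :=
  Derivation.liftOfSurjective (f := Ideal.Quotient.mkₐ ℂ (Ideal.span {F}))
    (Ideal.Quotient.mkₐ_surjective ℂ _) mk_hamiltonianDerivation_eq_zero

lemma curveDerivation_mk (G : MvPolynomial (Fin 3) ℂ) :
    curveDerivation F (Ideal.Quotient.mk _ G) =
      Ideal.Quotient.mk (Ideal.span {F}) (hamiltonianDerivation F G) :=
  Derivation.liftOfSurjective_apply (Ideal.Quotient.mkₐ_surjective ℂ _)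
    mk_hamiltonianDerivation_eq_zero G

lemma curveDerivation_mem (hF : F.IsHomogeneous 3) {m : ℕ} {a : HomogeneousCoordinateRing F}
    (ha : a ∈ gradedPiece F m) : curveDerivation F a ∈ gradedPiece F (m + 1) := by
  obtain ⟨G, hG, rfl⟩ := mem_gradedPiece_iff.1 ha
  rw [curveDerivation_mk]
  exact mk_mem_gradedPiece (hamiltonianDerivation_isHomogeneous hF hG)

lemma iterate_curveDerivation_mem (hF : F.IsHomogeneous 3) {m : ℕ}
    {a : HomogeneousCoordinateRing F} (ha : a ∈ gradedPiece F m) (i : ℕ) :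
    (curveDerivation F)^[i] a ∈ gradedPiece F (m + i) := by
  induction i with
  | zero => exact ha
  | succ i ih =>
    rw [Function.iterate_succ_apply']
    exact curveDerivation_mem hF ih

lemma gradingHom_curveDerivation_coeff (hF : F.IsHomogeneous 3) (a : HomogeneousCoordinateRing F)
    (n : ℕ) : (gradingHom hF (curveDerivation F a)).coeff (n + 1) =
      curveDerivation F ((gradingHom hF a).coeff n) := by
  have ha : a = ∑ i ∈ Finset.range ((gradingHom hF a).natDegree + 1), (gradingHom hF a).coeff i := by
    conv_lhs => rw [← eval_one_gradingHom hF a, Polynomial.eval_eq_sum_range]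
    simp
  conv_lhs => rw [ha]
  rw [map_sum, map_sum, Polynomial.finsetSum_coeff]
  simp_rw [gradingHom_of_mem hF (curveDerivation_mem hF (gradingHom_coeff_mem hF a _)),
    Polynomial.coeff_C_mul_X_pow, Nat.add_right_cancel_iff]
  rw [Finset.sum_ite_eq]
  split_ifs with h
  · rfl
  · rw [Polynomial.coeff_eq_zero_of_natDegree_lt (by simpa using h), map_zero]

lemma gradingHom_iterate_curveDerivation_coeff (hF : F.IsHomogeneous 3)
    (a : HomogeneousCoordinateRing F) (n i : ℕ) :
    (gradingHom hF ((curveDerivation F)^[i] a)).coeff (n + i) =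
      (curveDerivation F)^[i] ((gradingHom hF a).coeff n) := by
  induction i with
  | zero => rfl
  | succ i ih =>
    rw [Function.iterate_succ_apply', Function.iterate_succ_apply', ← ih, ← add_assoc,
      gradingHom_curveDerivation_coeff]

end CurveDerivation

/-! ### The affine curve `Z = 1`. -/

section AffinePart

open MvPolynomial

variable {F : MvPolynomial (Fin 3) ℂ}

/-- The linear form `Z` in the coordinate ring. -/
noncomputable abbrev lineAtInfinity (F : MvPolynomial (Fin 3) ℂ) : HomogeneousCoordinateRing F :=
  Ideal.Quotient.mk _ (X 2)

lemma curveDerivation_lineAtInfinity : curveDerivation F (lineAtInfinity F) = 0 := by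
  rw [curveDerivation_mk, hamiltonianDerivation_apply]
  simp [pderiv_X]

lemma lineAtInfinity_mem : lineAtInfinity F ∈ gradedPiece F 1 :=
  mk_mem_gradedPiece (isHomogeneous_X _ _)

lemma lineAtInfinity_ne_zero (hF : F.IsHomogeneous 3) : lineAtInfinity F ≠ 0 :=
  mk_ne_zero_of_isHomogeneous hF (by norm_num) (isHomogeneous_X _ _) (X_ne_zero _)

/-- The coordinate ring of the affine curve `Z = 1`. -/
abbrev AffineCoordinateRing (F : MvPolynomial (Fin 3) ℂ) : Type :=
  HomogeneousCoordinateRing F ⧸ Ideal.span {lineAtInfinity F - 1}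

/-- Dehomogenization `a ↦ ∑ aᵢ Z⁻ⁱ`. -/
noncomputable def dehomogenizeHom (hF : F.IsHomogeneous 3) [IsDomain (HomogeneousCoordinateRing F)] :
    HomogeneousCoordinateRing F →+* FractionRing (HomogeneousCoordinateRing F) :=
  (Polynomial.eval₂RingHom (algebraMap _ _) (algebraMap _ _ (lineAtInfinity F))⁻¹).comp
    (gradingHom hF : HomogeneousCoordinateRing F →+* Polynomial (HomogeneousCoordinateRing F))

lemma dehomogenizeHom_apply (hF : F.IsHomogeneous 3) [IsDomain (HomogeneousCoordinateRing F)]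
    (a : HomogeneousCoordinateRing F) : dehomogenizeHom hF a =
      (gradingHom hF a).eval₂ (algebraMap _ (FractionRing (HomogeneousCoordinateRing F)))
        (algebraMap _ _ (lineAtInfinity F))⁻¹ := rfl

lemma dehomogenizeHom_of_mem (hF : F.IsHomogeneous 3) [IsDomain (HomogeneousCoordinateRing F)]
    {m : ℕ} {a : HomogeneousCoordinateRing F} (ha : a ∈ gradedPiece F m) :
    dehomogenizeHom hF a = algebraMap _ _ a * (algebraMap _ _ (lineAtInfinity F))⁻¹ ^ m := by
  rw [dehomogenizeHom_apply, gradingHom_of_mem hF ha]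
  simp

/-- If `∑ aᵢ Z⁻ⁱ = 0`, then clearing denominators gives `a = ∑ aᵢ (1 - Zᴺ⁻ⁱ)`, a multiple of `Z -
1`. As the target is a field, `(Z - 1)` is prime. -/
lemma ker_dehomogenizeHom (hF : F.IsHomogeneous 3) [IsDomain (HomogeneousCoordinateRing F)] :
    RingHom.ker (dehomogenizeHom hF) = Ideal.span {lineAtInfinity F - 1} := by
  set z := lineAtInfinity F
  have hz : algebraMap _ (FractionRing (HomogeneousCoordinateRing F)) z ≠ 0 := by
    simpa using lineAtInfinity_ne_zero hF
  apply le_antisymm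
  · intro a ha
    rw [RingHom.mem_ker, dehomogenizeHom_apply] at ha
    set N := (gradingHom hF a).natDegree
    rw [Polynomial.eval₂_eq_sum_range] at ha
    have h1 : ∑ i ∈ Finset.range (N + 1), (gradingHom hF a).coeff i * z ^ (N - i) = 0 := by
      apply IsFractionRing.injective (HomogeneousCoordinateRing F)
        (FractionRing (HomogeneousCoordinateRing F))
      have h2 := congrArg (· * algebraMap _ (FractionRing (HomogeneousCoordinateRing F)) z ^ N) ha
      simp only [zero_mul, Finset.sum_mul] at h2
      rw [map_zero, map_sum, ← h2]
      refine Finset.sum_congr rfl fun i hi ↦ ?_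
      have hiN : i ≤ N := by simpa [Nat.lt_succ_iff] using hi
      rw [map_mul, map_pow, mul_assoc, ← pow_mul_pow_sub _ hiN, inv_pow,
        inv_mul_cancel_left₀ (pow_ne_zero _ hz)]
    have h3 : a = ∑ i ∈ Finset.range (N + 1), (gradingHom hF a).coeff i * (1 - z ^ (N - i)) := by
      simp_rw [mul_sub, mul_one]
      rw [Finset.sum_sub_distrib, h1, sub_zero]
      conv_lhs => rw [← eval_one_gradingHom hF a, Polynomial.eval_eq_sum_range]
      simp [N]
    rw [h3]
    refine Ideal.sum_mem _ fun i _ ↦ Ideal.mul_mem_left _ _ ?_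
    obtain ⟨q, hq⟩ := sub_dvd_pow_sub_pow z 1 (N - i)
    rw [one_pow] at hq
    exact Ideal.mem_span_singleton.2 ⟨-q, by linear_combination -hq⟩
  · rw [Ideal.span_singleton_le_iff_mem, RingHom.mem_ker, map_sub, map_one,
      dehomogenizeHom_of_mem hF lineAtInfinity_mem, pow_one, mul_inv_cancel₀ hz, sub_self]

theorem isDomain_affineCoordinateRing (hF : F.IsHomogeneous 3)
    [IsDomain (HomogeneousCoordinateRing F)] : IsDomain (AffineCoordinateRing F) := by
  rw [Ideal.Quotient.isDomain_iff_prime, ← ker_dehomogenizeHom hF]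
  exact RingHom.ker_isPrime _

lemma mk_injOn_gradedPiece (hF : F.IsHomogeneous 3) [IsDomain (HomogeneousCoordinateRing F)]
    {m : ℕ} {a : HomogeneousCoordinateRing F} (ha : a ∈ gradedPiece F m)
    (h : Ideal.Quotient.mk (Ideal.span {lineAtInfinity F - 1}) a = 0) : a = 0 := by
  rw [Ideal.Quotient.eq_zero_iff_mem, ← ker_dehomogenizeHom hF, RingHom.mem_ker,
    dehomogenizeHom_of_mem hF ha] at h
  have hz : algebraMap _ (FractionRing (HomogeneousCoordinateRing F)) (lineAtInfinity F) ≠ 0 := by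
    simpa using lineAtInfinity_ne_zero hF
  simpa using (mul_eq_zero.1 h).resolve_right (pow_ne_zero _ (inv_ne_zero hz))

theorem trdeg_affineCoordinateRing_le (hF : IsNonsingularCubic F) :
    Algebra.trdeg ℂ (AffineCoordinateRing F) ≤ 1 := by
  have := hF.isDomain
  have hp : (Ideal.span {lineAtInfinity F - 1}).IsPrime := by
    rw [← ker_dehomogenizeHom hF.isHomogeneous]
    exact RingHom.ker_isPrime _
  have h2 : Algebra.trdeg ℂ (HomogeneousCoordinateRing F) ≤ ((1 + 1 : ℕ) : Cardinal) := by
    exact_mod_cast hF.trdeg_le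
  refine (trdeg_quotient_le h2 (p := Ideal.span {lineAtInfinity F - 1}) ?_).trans (by simp)
  rw [Ne, Ideal.span_singleton_eq_bot, sub_eq_zero]
  intro h
  have h1 := gradingHom_of_mem hF.isHomogeneous (lineAtInfinity_mem (F := F))
  have h3 := congrArg (fun p ↦ Polynomial.coeff p 1) h1
  simp [h, Polynomial.coeff_one] at h3

lemma mk_curveDerivation_eq_zero (a : HomogeneousCoordinateRing F)
    (ha : Ideal.Quotient.mkₐ ℂ (Ideal.span {lineAtInfinity F - 1}) a = 0) :
    Ideal.Quotient.mkₐ ℂ (Ideal.span {lineAtInfinity F - 1}) (curveDerivation F a) = 0 := by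
  obtain ⟨b, rfl⟩ := Ideal.mem_span_singleton.1 (Ideal.Quotient.eq_zero_iff_mem.1 ha)
  refine Ideal.Quotient.eq_zero_iff_mem.2 (Ideal.mem_span_singleton.2
    ⟨curveDerivation F b, ?_⟩)
  rw [Derivation.leibniz, map_sub, curveDerivation_lineAtInfinity, Derivation.map_one_eq_zero,
    sub_zero, smul_zero, add_zero, smul_eq_mul]

/-- The derivation of the affine coordinate ring induced by `F_Y ∂_X - F_X ∂_Y`. -/
noncomputable def affineDerivation (F : MvPolynomial (Fin 3) ℂ) :
    Derivation ℂ (AffineCoordinateRing F) (AffineCoordinateRing F) :=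
  Derivation.liftOfSurjective (f := Ideal.Quotient.mkₐ ℂ (Ideal.span {lineAtInfinity F - 1}))
    (Ideal.Quotient.mkₐ_surjective ℂ _) mk_curveDerivation_eq_zero

lemma affineDerivation_mk (a : HomogeneousCoordinateRing F) :
    affineDerivation F (Ideal.Quotient.mk _ a) =
      Ideal.Quotient.mk (Ideal.span {lineAtInfinity F - 1}) (curveDerivation F a) :=
  Derivation.liftOfSurjective_apply (Ideal.Quotient.mkₐ_surjective ℂ _)
    mk_curveDerivation_eq_zero a

lemma iterate_affineDerivation_mk (a : HomogeneousCoordinateRing F) (i : ℕ) :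
    (affineDerivation F)^[i] (Ideal.Quotient.mk _ a) =
      Ideal.Quotient.mk (Ideal.span {lineAtInfinity F - 1}) ((curveDerivation F)^[i] a) := by
  induction i with
  | zero => rfl
  | succ i ih => rw [Function.iterate_succ_apply', Function.iterate_succ_apply', ih,
      affineDerivation_mk]

/-- At a point of the affine curve, one of the partial derivatives `F_X`, `F_Y` does not vanish. -/
theorem IsNonsingularCubic.map_pderiv_ne_zero (hF : IsNonsingularCubic F)
    (φ : HomogeneousCoordinateRing F →ₐ[ℂ] ℂ) (hφ : φ (lineAtInfinity F) = 1) :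
    φ (Ideal.Quotient.mk _ (pderiv 0 F)) ≠ 0 ∨ φ (Ideal.Quotient.mk _ (pderiv 1 F)) ≠ 0 := by
  set v : Fin 3 → ℂ := fun i ↦ φ (Ideal.Quotient.mk _ (X i))
  have hev (G : MvPolynomial (Fin 3) ℂ) : φ (Ideal.Quotient.mk _ G) = eval v G := by
    have : φ.comp (Ideal.Quotient.mkₐ ℂ (Ideal.span {F})) = aeval v := by
      ext i
      simp [v]
    rw [← coe_aeval_eq_eval]
    exact AlgHom.congr_fun this G
  have hv2 : v 2 = 1 := hφ
  rw [hev, hev]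
  by_contra! hcon
  have hFv : eval v F = 0 := by
    rw [← hev, Ideal.Quotient.eq_zero_iff_mem.2 (Ideal.mem_span_singleton_self F), map_zero]
  obtain ⟨i, hi⟩ := hF.nonsingular v (fun h ↦ by simp [h] at hv2) hFv
  -- Euler's identity with `Z = 1` forces `F_Z` to vanish along with `F`, `F_X` and `F_Y`, so the
  -- point would be singular.
  have h := congrArg (eval v) hF.isHomogeneous.sum_X_mul_pderiv
  rw [Fin.sum_univ_three, map_add, map_add, map_mul, map_mul, map_mul, hcon.1, hcon.2, map_nsmul,
    hFv, eval_X, eval_X, eval_X, hv2] at h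
  have h2 : eval v (pderiv 2 F) = 0 := by simpa using h
  fin_cases i
  · exact hi hcon.1
  · exact hi hcon.2
  · exact hi h2

end AffinePart

/-! ### The homogeneous prime of a point. -/

section PointIdeal

open MvPolynomial

variable {F : MvPolynomial (Fin 3) ℂ}

/-- The homogeneous prime ideal of a point `φ` of the curve. -/
noncomputable def pointIdeal (hF : F.IsHomogeneous 3) (φ : HomogeneousCoordinateRing F →ₐ[ℂ] ℂ) :
    Ideal (HomogeneousCoordinateRing F) :=
  RingHom.ker ((Polynomial.mapAlgHom φ).comp (gradingHom hF))

instance isPrime_pointIdeal (hF : F.IsHomogeneous 3) (φ : HomogeneousCoordinateRing F →ₐ[ℂ] ℂ) :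
    (pointIdeal hF φ).IsPrime :=
  RingHom.ker_isPrime _

variable {hF : F.IsHomogeneous 3} {φ : HomogeneousCoordinateRing F →ₐ[ℂ] ℂ}

lemma mem_pointIdeal_iff {a : HomogeneousCoordinateRing F} :
    a ∈ pointIdeal hF φ ↔ ∀ n, φ ((gradingHom hF a).coeff n) = 0 := by
  rw [pointIdeal, RingHom.mem_ker, Polynomial.ext_iff]
  refine forall_congr' fun n ↦ ?_
  rw [AlgHom.comp_apply, Polynomial.coe_mapAlgHom, Polynomial.coeff_map, Polynomial.coeff_zero]
  rfl

lemma mem_pointIdeal_iff_of_mem_gradedPiece {m : ℕ} {a : HomogeneousCoordinateRing F}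
    (ha : a ∈ gradedPiece F m) : a ∈ pointIdeal hF φ ↔ φ a = 0 := by
  rw [mem_pointIdeal_iff]
  simp_rw [gradingHom_of_mem hF ha, Polynomial.coeff_C_mul_X_pow]
  refine ⟨fun h ↦ by simpa using h m, fun h n ↦ ?_⟩
  split_ifs
  · exact h
  · exact map_zero φ

lemma gradingHom_coeff_mem_pointIdeal {a : HomogeneousCoordinateRing F} (ha : a ∈ pointIdeal hF φ)
    (n : ℕ) : (gradingHom hF a).coeff n ∈ pointIdeal hF φ :=
  (mem_pointIdeal_iff_of_mem_gradedPiece (gradingHom_coeff_mem hF a n)).2 (mem_pointIdeal_iff.1 ha n)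

/-- The linear form `Xᵢ - φ(Xᵢ) Z` vanishing at the point `φ`. -/
noncomputable def linearFormAt (φ : HomogeneousCoordinateRing F →ₐ[ℂ] ℂ) (i : Fin 3) :
    HomogeneousCoordinateRing F :=
  Ideal.Quotient.mk _ (X i - C (φ (Ideal.Quotient.mk _ (X i))) * X 2)

lemma linearForm_isHomogeneous (i : Fin 3) (c : ℂ) :
    (X i - C c * X 2 : MvPolynomial (Fin 3) ℂ).IsHomogeneous 1 := by
  refine (isHomogeneous_X _ _).sub ?_
  simpa using (isHomogeneous_C (Fin 3) c).mul (isHomogeneous_X ℂ (2 : Fin 3))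

lemma linearFormAt_mem_pointIdeal (hφ : φ (lineAtInfinity F) = 1) (i : Fin 3) :
    linearFormAt φ i ∈ pointIdeal hF φ := by
  rw [linearFormAt, mem_pointIdeal_iff_of_mem_gradedPiece
    (mk_mem_gradedPiece (linearForm_isHomogeneous i _)), map_sub, map_sub, map_mul, map_mul, hφ]
  have h : φ (Ideal.Quotient.mk (Ideal.span {F}) (C (φ (Ideal.Quotient.mk _ (X i))))) =
      φ (Ideal.Quotient.mk _ (X i)) := φ.commutes _
  rw [h, mul_one, sub_self]

lemma pointIdeal_ne_bot (hφ : φ (lineAtInfinity F) = 1) : pointIdeal hF φ ≠ ⊥ := by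
  intro h
  have h1 := linearFormAt_mem_pointIdeal (hF := hF) hφ 0
  rw [h, Ideal.mem_bot] at h1
  refine mk_ne_zero_of_isHomogeneous hF (by norm_num) (linearForm_isHomogeneous 0 _) (fun h0 ↦ ?_) h1
  have h2 := congrArg (eval ![1, 0, 0]) h0
  simp at h2

/-- Restriction to the line over the point sends `Z` to the variable of `ℂ[T]`, which is not a unit.
-/
lemma not_isMaximal_pointIdeal (hφ : φ (lineAtInfinity F) = 1) : ¬ (pointIdeal hF φ).IsMaximal := by
  intro h
  have hz : lineAtInfinity F ∉ pointIdeal hF φ := by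
    rw [mem_pointIdeal_iff_of_mem_gradedPiece lineAtInfinity_mem, hφ]
    exact one_ne_zero
  obtain ⟨b, p, hp, hb⟩ := h.exists_inv hz
  have h1 := congrArg ((Polynomial.mapAlgHom φ).comp (gradingHom hF)) hb
  have hp0 : ((Polynomial.mapAlgHom φ).comp (gradingHom hF)) p = 0 := hp
  have hz1 : ((Polynomial.mapAlgHom φ).comp (gradingHom hF)) (lineAtInfinity F) = Polynomial.X := by
    rw [AlgHom.comp_apply, gradingHom_of_mem hF lineAtInfinity_mem, map_mul]
    simp [hφ]
  rw [map_add, map_mul, hp0, hz1, add_zero, map_one] at h1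
  exact Polynomial.not_isUnit_X (IsUnit.of_mul_eq_one_right _ h1)

theorem height_pointIdeal (hFn : IsNonsingularCubic F) (hφ : φ (lineAtInfinity F) = 1) :
    (pointIdeal hF φ).height = 1 := by
  have := hFn.isDomain
  apply le_antisymm
  · obtain ⟨M, hM, hle⟩ := Ideal.exists_le_maximal (pointIdeal hF φ) Ideal.IsPrime.ne_top'
    have hlt : pointIdeal hF φ < M :=
      lt_of_le_of_ne hle fun h ↦ not_isMaximal_pointIdeal (hF := hF) hφ (h ▸ hM)
    have h2 : M.height ≤ 2 := height_le_of_trdeg_le (d := 2) (by exact_mod_cast hFn.trdeg_le) M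
    have h3 := (Ideal.height_strict_mono_of_isPrime hlt).trans_le h2
    exact Order.le_of_lt_add_one (by convert h3 using 1; norm_num)
  · rw [Order.one_le_iff_ne_zero, Ne, Ideal.height_eq_zero_iff,
      IsDomain.minimalPrimes_eq_singleton_bot]
    exact pointIdeal_ne_bot hφ

/-- `D(X - xZ) = F_Y` and `D(Y - yZ) = -F_X`, and one of them is nonzero at a smooth point; this is
the transversality that the differential criterion requires. -/
lemma exists_curveDerivation_notMem_pointIdeal (hFn : IsNonsingularCubic F)
    (hφ : φ (lineAtInfinity F) = 1) :
    ∃ a ∈ pointIdeal hF φ, curveDerivation F a ∉ pointIdeal hF φ := by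
  rcases hFn.map_pderiv_ne_zero φ hφ with h | h
  · refine ⟨linearFormAt φ 1, linearFormAt_mem_pointIdeal hφ 1, ?_⟩
    have hD : curveDerivation F (linearFormAt φ 1) = -Ideal.Quotient.mk _ (pderiv 0 F) := by
      rw [linearFormAt, curveDerivation_mk, hamiltonianDerivation_apply, ← map_neg]
      congr 1
      simp [pderiv_X]
    rw [hD, neg_mem_iff, mem_pointIdeal_iff_of_mem_gradedPiece (mk_mem_gradedPiece hF.pderiv)]
    exact h
  · refine ⟨linearFormAt φ 0, linearFormAt_mem_pointIdeal hφ 0, ?_⟩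
    have hD : curveDerivation F (linearFormAt φ 0) = Ideal.Quotient.mk _ (pderiv 1 F) := by
      rw [linearFormAt, curveDerivation_mk, hamiltonianDerivation_apply]
      congr 1
      simp [pderiv_X]
    rw [hD, mem_pointIdeal_iff_of_mem_gradedPiece (mk_mem_gradedPiece hF.pderiv)]
    exact h

end PointIdeal

/-! ### Existence of a very general point. -/

section GeneralPoint

open MvPolynomial

variable {F : MvPolynomial (Fin 3) ℂ}

lemma mk_lineAtInfinity :
    (Ideal.Quotient.mk (Ideal.span {lineAtInfinity F - 1}) (lineAtInfinity F) :
      AffineCoordinateRing F) = 1 :=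
  Ideal.Quotient.eq.2 (Ideal.mem_span_singleton_self _)

lemma IsNonsingularCubic.affineDerivation_ne_zero (hF : IsNonsingularCubic F) :
    affineDerivation F ≠ 0 := by
  have := hF.isDomain
  have := isDomain_affineCoordinateRing hF.isHomogeneous
  let f := (Ideal.Quotient.mkₐ ℂ (Ideal.span {lineAtInfinity F - 1})).comp
    (Ideal.Quotient.mkₐ ℂ (Ideal.span {F}))
  have hf : Function.Surjective f :=
    (Ideal.Quotient.mkₐ_surjective ℂ _).comp (Ideal.Quotient.mkₐ_surjective ℂ _)
  obtain ⟨ψ⟩ := exists_algHom_of_countable (R := AffineCoordinateRing F) f hf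
  intro h0
  have hφ : ψ (Ideal.Quotient.mk _ (lineAtInfinity F)) = 1 :=
    (congrArg ψ mk_lineAtInfinity).trans (map_one ψ)
  have hD (i : Fin 3) : ψ (Ideal.Quotient.mk _ (Ideal.Quotient.mk _
      (hamiltonianDerivation F (X i)))) = 0 := by
    rw [← curveDerivation_mk, ← affineDerivation_mk, h0]
    exact map_zero ψ
  rcases hF.map_pderiv_ne_zero (ψ.comp (Ideal.Quotient.mkₐ ℂ _)) hφ with h | h
  · apply h
    have := hD 1
    rw [hamiltonianDerivation_apply] at this
    simpa [pderiv_X] using this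
  · apply h
    have := hD 0
    rw [hamiltonianDerivation_apply] at this
    simpa [pderiv_X] using this

/-- The Wronskian of the forms of degree `m` does not vanish on the affine curve. -/
theorem IsNonsingularCubic.det_iterate_affineDerivation_ne_zero (hF : IsNonsingularCubic F)
    {m N : ℕ} (e : Module.Basis (Fin N) ℂ (gradedPiece F m)) :
    (Matrix.of fun i j : Fin N ↦ (affineDerivation F)^[i]
      (Ideal.Quotient.mk (Ideal.span {lineAtInfinity F - 1})
        (e j : HomogeneousCoordinateRing F))).det ≠ 0 := by
  have := hF.isDomain
  have := isDomain_affineCoordinateRing hF.isHomogeneous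
  let ι : gradedPiece F m →ₗ[ℂ] AffineCoordinateRing F :=
    (Ideal.Quotient.mkₐ ℂ (Ideal.span {lineAtInfinity F - 1})).toLinearMap ∘ₗ (gradedPiece F m).subtype
  have hι : LinearMap.ker ι = ⊥ := by
    rw [LinearMap.ker_eq_bot']
    exact fun g hg ↦ Subtype.ext (mk_injOn_gradedPiece hF.isHomogeneous g.2 hg)
  exact det_iterate_derivation_ne_zero_of_trdeg_le (k := ℂ) (B := AffineCoordinateRing F)
    (trdeg_affineCoordinateRing_le hF) hF.affineDerivation_ne_zero (e.linearIndependent.map' ι hι)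

/-- There is a point of the curve at which no nonzero form of degree `m` vanishes to order `3m`. -/
theorem IsNonsingularCubic.exists_general_point (hF : IsNonsingularCubic F) :
    ∃ φ : HomogeneousCoordinateRing F →ₐ[ℂ] ℂ, φ (lineAtInfinity F) = 1 ∧
      ∀ m, 0 < m → ∀ g ∈ gradedPiece F m,
        (∀ i < 3 * m, φ ((curveDerivation F)^[i] g) = 0) → g = 0 := by
  have := hF.isDomain
  have := isDomain_affineCoordinateRing hF.isHomogeneous
  let e (m : ℕ) : Module.Basis (Fin (3 * (m + 1))) ℂ (gradedPiece F (m + 1)) :=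
    Module.finBasisOfFinrankEq ℂ _
      (finrank_gradedPiece hF.isHomogeneous hF.ne_zero m.succ_pos)
  let f := (Ideal.Quotient.mkₐ ℂ (Ideal.span {lineAtInfinity F - 1})).comp
    (Ideal.Quotient.mkₐ ℂ (Ideal.span {F}))
  have hf : Function.Surjective f :=
    (Ideal.Quotient.mkₐ_surjective ℂ _).comp (Ideal.Quotient.mkₐ_surjective ℂ _)
  -- One Wronskian for each positive degree: at `ψ` none vanishes, so the matrix of derivatives of
  -- each basis is invertible there. The coordinates of a form vanishing to order `3m` lie in its
  -- kernel.
  obtain ⟨ψ, hψ⟩ := exists_algHom_forall_ne_zero (B := AffineCoordinateRing F) f hf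
    fun m ↦ hF.det_iterate_affineDerivation_ne_zero (e m)
  refine ⟨ψ.comp (Ideal.Quotient.mkₐ ℂ _), ?_, ?_⟩
  · exact (congrArg ψ mk_lineAtInfinity).trans (map_one ψ)
  · rintro m hm g hg hgi
    obtain ⟨n, rfl⟩ := Nat.exists_eq_add_of_le' hm
    have hdet := hψ n
    rw [← AlgHom.coe_toRingHom, RingHom.map_det] at hdet
    let g' : gradedPiece F (n + 1) := ⟨g, hg⟩
    have hc := Matrix.eq_zero_of_mulVec_eq_zero hdet (v := (e n).repr g') (by
      ext i
      have h1 := hgi i i.2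
      have h2 : g = ∑ j, (e n).repr g' j • (e n j : HomogeneousCoordinateRing F) := by
        have := congrArg (gradedPiece F (n + 1)).subtype ((e n).sum_repr g')
        rw [map_sum] at this
        exact this.symm
      have h3 (x : HomogeneousCoordinateRing F) :
        (curveDerivation F)^[i] x = ((curveDerivation F).toLinearMap ^ (i : ℕ)) x := by
          rw [Module.End.pow_apply]; rfl
      rw [h2, h3, map_sum, map_sum] at h1
      simp_rw [map_smul, ← h3] at h1
      rw [Matrix.mulVec, dotProduct]
      refine Eq.trans (Finset.sum_congr rfl fun j _ ↦ ?_) h1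
      rw [smul_eq_mul, mul_comm]
      congr 1
      exact congrArg ψ (iterate_affineDerivation_mk _ _))
    have hg0 : g' = 0 := (e n).repr.map_eq_zero_iff.1 (Finsupp.ext fun i ↦ congrFun hc i)
    exact congrArg Subtype.val hg0

end GeneralPoint

/-! ### Failure of the Noetherian property. -/

section NotNoetherian

open MvPolynomial

variable {F : MvPolynomial (Fin 3) ℂ}

/-- At a general point `φ`, the symbolic power `P⁽³ᵐ⁾` of its prime contains no nonzero form of
degree `m`. -/
def IsGeneralPoint (φ : HomogeneousCoordinateRing F →ₐ[ℂ] ℂ) : Prop :=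
  φ (lineAtInfinity F) = 1 ∧ ∀ m, 0 < m → ∀ g ∈ gradedPiece F m,
    (∀ i < 3 * m, φ ((curveDerivation F)^[i] g) = 0) → g = 0

variable {φ : HomogeneousCoordinateRing F →ₐ[ℂ] ℂ}

lemma mem_symbolicPower_pointIdeal_iff (hF : IsNonsingularCubic F) (hφ : φ (lineAtInfinity F) = 1)
    {n : ℕ} {a : HomogeneousCoordinateRing F} :
    a ∈ symbolicPower (pointIdeal hF.isHomogeneous φ) n ↔
      ∀ i < n, (curveDerivation F)^[i] a ∈ pointIdeal hF.isHomogeneous φ := by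
  have := hF.isDomain
  have := hF.isIntegrallyClosed
  have := isDiscreteValuationRing_atPrime_of_height_eq_one (pointIdeal hF.isHomogeneous φ)
    (height_pointIdeal hF hφ)
  obtain ⟨b, hb, hDb⟩ := exists_curveDerivation_notMem_pointIdeal (hF := hF.isHomogeneous) hF hφ
  exact (curveDerivation F).mem_symbolicPower_iff_forall_iterate hb hDb

/-- Symbolic powers are homogeneous because `P` is and the derivation shifts degrees uniformly. -/
lemma gradingHom_coeff_mem_symbolicPower (hF : IsNonsingularCubic F)
    (hφ : φ (lineAtInfinity F) = 1) {n : ℕ} {a : HomogeneousCoordinateRing F}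
    (ha : a ∈ symbolicPower (pointIdeal hF.isHomogeneous φ) n) (k : ℕ) :
    (gradingHom hF.isHomogeneous a).coeff k ∈ symbolicPower (pointIdeal hF.isHomogeneous φ) n := by
  rw [mem_symbolicPower_pointIdeal_iff hF hφ] at ha ⊢
  intro i hi
  rw [← gradingHom_iterate_curveDerivation_coeff]
  exact gradingHom_coeff_mem_pointIdeal (ha i hi) _

lemma IsGeneralPoint.eq_zero_of_mem (hF : IsNonsingularCubic F) (hφ : IsGeneralPoint φ) {m : ℕ}
    (hm : 0 < m) {g : HomogeneousCoordinateRing F} (hg : g ∈ gradedPiece F m)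
    (hgP : g ∈ symbolicPower (pointIdeal hF.isHomogeneous φ) (3 * m)) : g = 0 := by
  refine hφ.2 m hm g hg fun i hi ↦ ?_
  rw [← mem_pointIdeal_iff_of_mem_gradedPiece (hF := hF.isHomogeneous)
    (iterate_curveDerivation_mem hF.isHomogeneous hg i)]
  exact (mem_symbolicPower_pointIdeal_iff hF hφ.1).1 hgP i hi

/-- Vanishing to order `3m` imposes `3m` linear conditions on a space of dimension `3m + 3`. -/
lemma exists_mem_gradedPiece_succ_symbolicPower (hF : IsNonsingularCubic F)
    (hφ : φ (lineAtInfinity F) = 1) (m : ℕ) :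
    ∃ g ∈ gradedPiece F (m + 1), g ≠ 0 ∧
      g ∈ symbolicPower (pointIdeal hF.isHomogeneous φ) (3 * m) := by
  let ev : gradedPiece F (m + 1) →ₗ[ℂ] (Fin (3 * m) → ℂ) := LinearMap.pi fun i ↦
    φ.toLinearMap ∘ₗ ((curveDerivation F).toLinearMap ^ (i : ℕ)) ∘ₗ (gradedPiece F (m + 1)).subtype
  have hker : LinearMap.ker ev ≠ ⊥ := by
    apply LinearMap.ker_ne_bot_of_finrank_lt
    rw [finrank_gradedPiece hF.isHomogeneous hF.ne_zero m.succ_pos, Module.finrank_fin_fun]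
    omega
  obtain ⟨g, hg, hg0⟩ := (Submodule.ne_bot_iff _).1 hker
  refine ⟨g, g.2, fun h ↦ hg0 (Subtype.ext h), ?_⟩
  rw [mem_symbolicPower_pointIdeal_iff hF hφ]
  intro i hi
  rw [mem_pointIdeal_iff_of_mem_gradedPiece (iterate_curveDerivation_mem hF.isHomogeneous g.2 i)]
  have h := congrFun (LinearMap.mem_ker.1 hg) ⟨i, hi⟩
  change φ (((curveDerivation F).toLinearMap ^ i) (g : HomogeneousCoordinateRing F)) = 0 at h
  rwa [Module.End.pow_apply] at h

theorem IsGeneralPoint.not_isNoetherianRing (hF : IsNonsingularCubic F) (hφ : IsGeneralPoint φ) :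
    ¬ IsNoetherianRing (symbolicReesAlgebra (pointIdeal hF.isHomogeneous φ)) := by
  intro hN
  set P := pointIdeal hF.isHomogeneous φ
  choose g hg hg0 hgP using fun m ↦ exists_mem_gradedPiece_succ_symbolicPower hF hφ.1 m
  let x (m : ℕ) : symbolicReesAlgebra P := reesMonomial P (a := g m) (n := ((3 * m : ℕ) : ℤ)) (hgP m)
  let I : ℕ →o Ideal (symbolicReesAlgebra P) :=
    ⟨fun n ↦ Ideal.span (x '' (Finset.range n : Set ℕ)), fun m n h ↦ Ideal.span_mono
      (Set.image_mono (by exact_mod_cast Finset.range_mono h))⟩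
  -- If the chain of ideals stabilized, some `g_M t³ᴹ` would be a combination of the `g_i t³ⁱ` with
  -- `i < M`.
  obtain ⟨M, hM⟩ := monotone_stabilizes_iff_noetherian.2 hN I
  have hx : x M ∈ I M := by
    rw [hM (M + 1) M.le_succ]
    exact Ideal.subset_span ⟨M, by simp, rfl⟩
  obtain ⟨r, hr⟩ := (Submodule.mem_span_image_finset_iff_exists_fun' _).1 hx
  have h1 := congrArg (fun f : symbolicReesAlgebra P ↦
    (f : (HomogeneousCoordinateRing F)[T;T⁻¹]).coeff ((3 * M : ℕ) : ℤ)) hr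
  let b (i : ℕ) : HomogeneousCoordinateRing F :=
    (r i : (HomogeneousCoordinateRing F)[T;T⁻¹]).coeff (((3 * M : ℕ) : ℤ) - ((3 * i : ℕ) : ℤ))
  have h2 : ∑ i ∈ Finset.range M, g i * b i = g M := by
    have hMx : (x M : (HomogeneousCoordinateRing F)[T;T⁻¹]).coeff ((3 * M : ℕ) : ℤ) = g M := by
      simp [x, reesMonomial, LaurentPolynomial.coeff_C_mul_T]
    rw [← hMx, ← h1, AddSubmonoidClass.coe_finsetSum, AddMonoidAlgebra.coeff_sum,
      Finsupp.finsetSum_apply]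
    refine Finset.sum_congr rfl fun i _ ↦ ?_
    rw [show ((r i • x i : symbolicReesAlgebra P) : (HomogeneousCoordinateRing F)[T;T⁻¹]) =
      LaurentPolynomial.T ((3 * i : ℕ) : ℤ) * g i • (r i : (HomogeneousCoordinateRing F)[T;T⁻¹]) by
        rw [smul_eq_mul, MulMemClass.coe_mul, LaurentPolynomial.smul_eq_C_mul]
        simp only [x, reesMonomial]
        ring, LaurentPolynomial.coeff_T_mul]
    rfl
  have hb (i : ℕ) (hi : i < M) : b i ∈ symbolicPower P (3 * (M - i)) := by
    have h := (mem_symbolicReesAlgebra_iff P).1 (r i).2 (((3 * M : ℕ) : ℤ) - ((3 * i : ℕ) : ℤ))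
    rwa [show (((3 * M : ℕ) : ℤ) - ((3 * i : ℕ) : ℤ)).toNat = 3 * (M - i) by omega] at h
  -- In degree `M + 1` the form `g i` of degree `i + 1` meets the component of `b i` of degree `M -
  -- i`. That component lies in `P⁽³⁽ᴹ⁻ⁱ⁾⁾`, so it is zero at a general point, and `g M` would
  -- vanish.
  have h3 := congrArg (fun a ↦ (gradingHom hF.isHomogeneous a).coeff (M + 1)) h2
  refine hg0 M ?_
  simp only [map_sum, map_mul, gradingHom_of_mem (hF := hF.isHomogeneous) (hg _)] at h3
  rw [Polynomial.coeff_C_mul_X_pow, if_pos rfl, Polynomial.finsetSum_coeff] at h3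
  rw [← h3]
  refine Finset.sum_eq_zero fun i hi ↦ ?_
  rw [Finset.mem_range] at hi
  rw [show M + 1 = (M - i) + (i + 1) by omega, mul_assoc, Polynomial.coeff_C_mul,
    Polynomial.coeff_X_pow_mul, hφ.eq_zero_of_mem hF (by omega : 0 < M - i)
      (gradingHom_coeff_mem _ _ _) (gradingHom_coeff_mem_symbolicPower hF hφ.1 (hb i hi) _), mul_zero]

end NotNoetherian

theorem mainTheorem6 (F : MvPolynomial (Fin 3) ℂ) (hF : IsNonsingularCubic F) :
    (∀ (P : Ideal (HomogeneousCoordinateRing F)) [P.IsPrime], P.height = 1 →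
      IsKrullDomain (symbolicReesAlgebra P) ∧
      ringKrullDim (symbolicReesAlgebra P) = 3 ∧
      IsLocallyJaffard (symbolicReesAlgebra P) ∧
      ∀ (M : Ideal (symbolicReesAlgebra P)) [M.IsPrime],
        IsLocallyJaffard (Localization.AtPrime M)) ∧
    ∃ (P : Ideal (HomogeneousCoordinateRing F)) (_ : P.IsPrime), P.height = 1 ∧
      ¬ IsNoetherianRing (symbolicReesAlgebra P) := by
  refine ⟨fun P _ hP ↦ ?_, ?_⟩
  · obtain ⟨h1, h2, h3⟩ := hF.symbolicReesAlgebra P hP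
    exact ⟨h1, h2, h3, fun M _ ↦ h3.atPrime M⟩
  · obtain ⟨φ, hφ⟩ := hF.exists_general_point
    exact ⟨pointIdeal hF.isHomogeneous φ, inferInstance, height_pointIdeal hF hφ.1,
      IsGeneralPoint.not_isNoetherianRing hF hφ⟩
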